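/- Let $G=Sp(4,\mathbb R)=\{g\in M_4(\mathbb R): g^tJg=J\}$ with $J=\begin{pmatrix}0&I_2\\-I_2&0\end{pmatrix}$, and let $K=\{g\in G: gg^t=1\}$, identified with $U(2)$ by $\begin{pmatrix}A&B\\-B&A\end{pmatrix}\mapsto A+iB$. Put $H_1=E_{11}-E_{33}$, $H_2=E_{22}-E_{44}$, $X_{\alpha_1}=E_{12}-E_{43}$, $X_{\alpha_2}=E_{24}$, $X_{\alpha_1+\alpha_2}=E_{23}+E_{14}$, $X_{2\alpha_1+\alpha_2}=E_{13}$, $X_{-\alpha}=X_\alpha^t$. Let $N$ be the unipotent group with Lie algebra spanned by the $X_\alpha$, $\alpha\in\{\alpha_1,\alpha_2,\alpha_1+\alpha_2,2\alpha_1+\alpha_2\}$, and put $\gamma_{\alpha_2}=\mathrm{diag}(1,-1,1,-1)$, $\gamma_{2\alpha_1+\alpha_2}=\mathrm{diag}(-1,1,-1,1)$; these generate the group $M$. For $\delta=(\delta_1,\delta_2)\in\{0,1\}^2$ and $\lambda=(\lambda_1,\lambda_2)\in\mathbb C^2$, let $I(\chi_{\delta,\lambda})$ be the space of smooth $f:G\to\mathbb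 C$ with $$f\bigl(g\,\gamma_{\alpha_2}^{e_1}\gamma_{2\alpha_1+\alpha_2}^{e_2}\,e^{t_1H_1+t_2H_2}\,\nu\bigr)=\bigl((-1)^{\delta_1e_1+\delta_2e_2}e^{(\lambda_1+2)t_1+(\lambda_2+1)t_2}\bigr)^{-1}f(g)$$ for all $g\in G$, $e_i\in\mathbb Z_{\ge0}$, $t_i\in\mathbb R$, $\nu\in N$. Restriction to $K$ realizes its elements in $C_\delta(K)$, the space of smooth $\varphi:K\to\mathbb C$ with $\varphi(k\gamma_{\alpha_2}^{e_1}\gamma_{2\alpha_1+\alpha_2}^{e_2})=(-1)^{\delta_1e_1+\delta_2e_2}\varphi(k)$. The Lie algebra $\mathfrak g$ of $G$ acts by $(dl(X)f)(h)=\frac{d}{dt}\big|_{t=0}f(e^{-tX}h)$, and $\mathfrak g_{\mathbb C}$ by complex linear extension. The noncompact root vectors are, for a sign $s=\pm1$, $$u_{s\beta_2}=\tfrac{i}{\sqrt2}\bigl(H_2+si(X_{\alpha_2}+X_{-\alpha_2})\bigr),\qquad u_{s(2\beta_1+\beta_2)}=\tfrac{i}{\sqrt2}\bigl(H_1+si(X_{2\alpha_1+\alpha_2}+X_{-2\alpha_1-\alpha_2})\bigr),$$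 $$u_{s(\beta_1+\beta_2)}=\tfrac12\bigl(X_{\alpha_1+\alpha_2}+X_{-\alpha_1-\alpha_2}-si(X_{\alpha_1}+X_{-\alpha_1})\bigr),$$ with $m_{s\beta_2}=-s$, $m_{s(\beta_1+\beta_2)}=0$, $m_{s(2\beta_1+\beta_2)}=s$. For $j\in\frac12\mathbb Z_{\ge0}$ and $n\in\frac12\mathbb Z$ with $j-n\in\mathbb Z$, and $m_1,m_2\in\{-j,-j+1,\dots,j\}$, let $W^{(j,n)}_{m_1,m_2}(k)=\langle v^j_{m_1},\pi_{j,n}(k)v^j_{m_2}\rangle$ be the Wigner $D$-function on $K\cong U(2)$. Here $(\pi_{j,n}(k)f)(z)=\det(k)^{j+n}f(k^{-1}z)$ on homogeneous polynomials of degree $2j$ in $z=(z_1,z_2)$, and the inner product is conjugate linear in its second argument and makes the vectors $v^j_m=z_1^{j-m}z_2^{j+m}/\sqrt{(j-m)!\,(j+m)!}$ orthonormal. Put $W^{(j,n)}_{m_1,m_2}=0$ if $m_1$ or $m_2$ is not in $\{-j,\dots,j\}$. **Theorem.** Let $j\in\frac12\mathbb Z_{\ge0}$ and $n\in\frac12\mathbb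 Z$ with $2j\equiv2n\equiv\delta_1+\delta_2 \pmod 2$, and let $m_1,m_2\in\{-j,\dots,j\}$ with $n-m_2\equiv\delta_1$ and $n+m_2\equiv\delta_2\pmod 2$. Then $W^{(j,n)}_{m_1,m_2}\in C_\delta(K)$, and it is the restriction to $K$ of a unique $f\in I(\chi_{\delta,\lambda})$. For each noncompact root $\beta=s\beta_2,\ s(\beta_1+\beta_2),\ s(2\beta_1+\beta_2)$ with $s=\pm1$, the function $dl(u_\beta)f$ lies in $I(\chi_{\delta,\lambda})$, and its restriction to $K$ is $$\frac i2\sum_{j_0\in\{-1,0,1\},\ \varepsilon=\pm1}\begin{pmatrix}j+j_0,\,m_1+m_\beta\\ j,m_1,1,m_\beta\end{pmatrix}C_{j+j_0}\,q_{j_0,\varepsilon}\,\kappa_{s,j_0,\varepsilon}\;W^{(j+j_0,\,n+s)}_{m_1+m_\beta,\,m_2+\varepsilon}.$$ For $j=0$ only the terms with $j_0=1$ are present. The coefficients are as follows. Clebsch–Gordan coefficients $\begin{pmatrix}j+j_0,m+\mu\\ j,m,1,\mu\end{pmatrix}$: $$\begin{array}{c|ccc}&\mu=-1&\mu=0&\mu=1\\\hline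 j_0=-1&\sqrt{\frac{(j+m)(j+m-1)}{2j(2j+1)}}&-\sqrt{\frac{(j-m)(j+m)}{j(2j+1)}}&\sqrt{\frac{(j-m)(j-m-1)}{2j(2j+1)}}\\ j_0=0&\sqrt{\frac{(j+m)(j-m+1)}{2j(j+1)}}&\frac{m}{\sqrt{j(j+1)}}&-\sqrt{\frac{(j-m)(j+m+1)}{2j(j+1)}}\\ j_0=1&\sqrt{\frac{(j-m+1)(j-m+2)}{(2j+2)(2j+1)}}&\sqrt{\frac{(j-m+1)(j+m+1)}{(j+1)(2j+1)}}&\sqrt{\frac{(j+m+1)(j+m+2)}{(2j+2)(2j+1)}}\end{array}$$ $C_{j-1}=\frac1{\sqrt{j(2j+1)}}$, $C_{j}=\frac1{\sqrt{j(j+1)}}$, $C_{j+1}=\frac1{\sqrt{(j+1)(2j+1)}}$, where the subscript is $j+j_0$. $$\begin{array}{c|cc}q_{j_0,\varepsilon}&\varepsilon=-1&\varepsilon=1\\\hline j_0=-1&\sqrt{(j+m_2-1)(j+m_2)}&\sqrt{(j-m_2-1)(j-m_2)}\\ j_0=0&\sqrt{(j+m_2)(j-m_2+1)}&\sqrt{(j-m_2)(j+m_2+1)}\\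 j_0=1&\sqrt{(j-m_2+1)(j-m_2+2)}&\sqrt{(j+m_2+1)(j+m_2+2)}\end{array}$$ $$\begin{array}{c|cc}\kappa_{+,j_0,\varepsilon}&\varepsilon=-1&\varepsilon=1\\\hline j_0=-1&n-m_2+(\lambda_2+1)&-2-2j+n-m_2+(\lambda_1+2)\\ j_0=0&n-m_2+(\lambda_2+1)&2-n+m_2-(\lambda_1+2)\\ j_0=1&n-m_2+(\lambda_2+1)&2j+n-m_2+(\lambda_1+2)\end{array}$$ $$\begin{array}{c|cc}\kappa_{-,j_0,\varepsilon}&\varepsilon=-1&\varepsilon=1\\\hline j_0=-1&-2-2j-n+m_2+(\lambda_1+2)&-n+m_2+(\lambda_2+1)\\ j_0=0&-2-n+m_2+(\lambda_1+2)&n-m_2-(\lambda_2+1)\\ j_0=1&2j-n+m_2+(\lambda_1+2)&-n+m_2+(\lambda_2+1)\end{array}$$ -/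

import Mathlib

open scoped ContDiff

noncomputable section

namespace Sp4

open Matrix

/-- The real symplectic group `G = Sp(4, ℝ)`; the index type `Fin 2 ⊕ Fin 2` is ordered as
`1 = inl 0`, `2 = inl 1`, `3 = inr 0`, `4 = inr 1`. -/
abbrev G : Type := symplecticGroup (Fin 2) ℝ

/-- `𝔤 = 𝔰𝔭(4, ℝ)`. -/
abbrev gR : Type := LieAlgebra.Symplectic.sp (Fin 2) ℝ

/-- `𝔤_ℂ = 𝔰𝔭(4, ℂ)`. -/
abbrev gC : Type := LieAlgebra.Symplectic.sp (Fin 2) ℂ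

theorem mem_sp_iff {R : Type*} [CommRing R] {X : Matrix (Fin 2 ⊕ Fin 2) (Fin 2 ⊕ Fin 2) R} :
    X ∈ LieAlgebra.Symplectic.sp (Fin 2) R ↔ Xᵀ * J (Fin 2) R = J (Fin 2) R * -X := by
  rw [LieAlgebra.Symplectic.sp, mem_skewAdjointMatricesLieSubalgebra,
    mem_skewAdjointMatricesSubmodule, Matrix.IsSkewAdjoint, Matrix.IsAdjointPair]

theorem exp_mem {X : Matrix (Fin 2 ⊕ Fin 2) (Fin 2 ⊕ Fin 2) ℝ}
    (hX : X ∈ LieAlgebra.Symplectic.sp (Fin 2) ℝ) :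
    NormedSpace.exp X ∈ symplecticGroup (Fin 2) ℝ := by
  rw [mem_sp_iff] at hX
  have hU : IsUnit (J (Fin 2) ℝ) := (Matrix.isUnit_iff_isUnit_det _).2 (isUnit_det_J _ _)
  have hd : IsUnit (J (Fin 2) ℝ).det := isUnit_det_J _ _
  have h1 : Xᵀ = J (Fin 2) ℝ * (-X) * (J (Fin 2) ℝ)⁻¹ := by
    rw [← hX, Matrix.mul_assoc, Matrix.mul_nonsing_inv _ hd, Matrix.mul_one]
  rw [SymplecticGroup.mem_iff', ← Matrix.exp_transpose, h1, Matrix.exp_conj _ _ hU,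
    Matrix.nonsing_inv_mul_cancel_right _ _ hd, Matrix.exp_neg, Matrix.mul_assoc,
    Matrix.nonsing_inv_mul _ ((Matrix.isUnit_iff_isUnit_det _).1 (Matrix.isUnit_exp X)),
    Matrix.mul_one]

/-- The exponential map `𝔤 → G`. -/
def expG (X : gR) : G := ⟨NormedSpace.exp (X : Matrix _ _ ℝ), exp_mem X.2⟩

theorem map_re_mem {Z : Matrix (Fin 2 ⊕ Fin 2) (Fin 2 ⊕ Fin 2) ℂ}
    (hZ : Z ∈ LieAlgebra.Symplectic.sp (Fin 2) ℂ) :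
    Z.map Complex.re ∈ LieAlgebra.Symplectic.sp (Fin 2) ℝ := by
  rw [mem_sp_iff] at hZ ⊢
  ext a b
  have h := congrArg Complex.re (congrFun (congrFun hZ a) b)
  rcases a with a | a <;> rcases b with b | b <;> fin_cases a <;> fin_cases b <;>
    simp [Matrix.mul_apply, J, Fin.sum_univ_two] at h ⊢ <;> exact h

theorem map_im_mem {Z : Matrix (Fin 2 ⊕ Fin 2) (Fin 2 ⊕ Fin 2) ℂ}
    (hZ : Z ∈ LieAlgebra.Symplectic.sp (Fin 2) ℂ) :
    Z.map Complex.im ∈ LieAlgebra.Symplectic.sp (Fin 2) ℝ := by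
  rw [mem_sp_iff] at hZ ⊢
  ext a b
  have h := congrArg Complex.im (congrFun (congrFun hZ a) b)
  rcases a with a | a <;> rcases b with b | b <;> fin_cases a <;> fin_cases b <;>
    simp [Matrix.mul_apply, J, Fin.sum_univ_two] at h ⊢ <;> exact h

/-- The real part of `Z ∈ 𝔤_ℂ = 𝔤 ⊕ i𝔤`. -/
def reG (Z : gC) : gR := ⟨(Z : Matrix _ _ ℂ).map Complex.re, map_re_mem Z.2⟩

/-- The imaginary part of `Z ∈ 𝔤_ℂ = 𝔤 ⊕ i𝔤`. -/
def imG (Z : gC) : gR := ⟨(Z : Matrix _ _ ℂ).map Complex.im, map_im_mem Z.2⟩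

/-! ### The left regular action -/

/-- The differential of the left regular action `(l(g) f)(h) = f (g⁻¹ h)` at `X ∈ 𝔤`. -/
def dlReal (X : gR) (f : G → ℂ) : G → ℂ :=
  fun h => deriv (fun t : ℝ => f ((expG (t • X))⁻¹ * h)) 0

/-- The action `dl` of `𝔤_ℂ`: the complex linear extension of the action of `𝔤`. -/
def dl (Z : gC) (f : G → ℂ) : G → ℂ :=
  fun h => dlReal (reG Z) f h + Complex.I * dlReal (imG Z) f h

/-! ### Noncompact root vectors -/

/-- `H₁ = E₁₁ - E₃₃`. -/
def H₁ : Matrix (Fin 2 ⊕ Fin 2) (Fin 2 ⊕ Fin 2) ℂ :=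
  fromBlocks !![1, 0; 0, 0] 0 0 !![-1, 0; 0, 0]

/-- `H₂ = E₂₂ - E₄₄`. -/
def H₂ : Matrix (Fin 2 ⊕ Fin 2) (Fin 2 ⊕ Fin 2) ℂ :=
  fromBlocks !![0, 0; 0, 1] 0 0 !![0, 0; 0, -1]

/-- The root vector `E₁₂ - E₄₃` of `α₁`. -/
def Xα₁ : Matrix (Fin 2 ⊕ Fin 2) (Fin 2 ⊕ Fin 2) ℂ :=
  fromBlocks !![0, 1; 0, 0] 0 0 !![0, 0; -1, 0]

/-- The root vector `E₂₄` of `α₂`. -/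
def Xα₂ : Matrix (Fin 2 ⊕ Fin 2) (Fin 2 ⊕ Fin 2) ℂ :=
  fromBlocks 0 !![0, 0; 0, 1] 0 0

/-- The root vector `E₂₃ + E₁₄` of `α₁ + α₂`. -/
def Xα₁α₂ : Matrix (Fin 2 ⊕ Fin 2) (Fin 2 ⊕ Fin 2) ℂ :=
  fromBlocks 0 !![0, 1; 1, 0] 0 0

/-- The root vector `E₁₃` of `2α₁ + α₂`. -/
def X2α₁α₂ : Matrix (Fin 2 ⊕ Fin 2) (Fin 2 ⊕ Fin 2) ℂ :=
  fromBlocks 0 !![1, 0; 0, 0] 0 0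

/-- The positive noncompact roots `β₂`, `β₁ + β₂`, `2β₁ + β₂`. -/
inductive PosRoot
  | β₂
  | β₁β₂
  | twoβ₁β₂

/-- The matrix of `u_{sβ}` for the noncompact root `sβ`, `s = ±1`:
`u_{±β₂} = √2 i · ½ (H₂ ± i (X_{α₂} + X_{-α₂}))`,
`u_{±(β₁+β₂)} = ½ (X_{α₁+α₂} + X_{-α₁-α₂} ∓ i (X_{α₁} + X_{-α₁}))`,
`u_{±(2β₁+β₂)} = √2 i · ½ (H₁ ± i (X_{2α₁+α₂} + X_{-2α₁-α₂}))`, where `X_{-α} = X_αᵀ`. -/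
def uMatrix (s : ℤˣ) : PosRoot → Matrix (Fin 2 ⊕ Fin 2) (Fin 2 ⊕ Fin 2) ℂ
  | .β₂ => ((√2 : ℝ) * Complex.I) •
      ((1 / 2 : ℂ) • (H₂ + (((s : ℤ) : ℂ) * Complex.I) • (Xα₂ + Xα₂ᵀ)))
  | .β₁β₂ => (1 / 2 : ℂ) • (Xα₁α₂ + Xα₁α₂ᵀ - (((s : ℤ) : ℂ) * Complex.I) • (Xα₁ + Xα₁ᵀ))
  | .twoβ₁β₂ => ((√2 : ℝ) * Complex.I) •
      ((1 / 2 : ℂ) • (H₁ + (((s : ℤ) : ℂ) * Complex.I) • (X2α₁α₂ + X2α₁α₂ᵀ)))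

theorem uMatrix_mem (s : ℤˣ) (β : PosRoot) :
    uMatrix s β ∈ LieAlgebra.Symplectic.sp (Fin 2) ℂ := by
  have key : ∀ P Q R : Matrix (Fin 2) (Fin 2) ℂ, Qᵀ = Q → Rᵀ = R →
      fromBlocks P Q R (-Pᵀ) ∈ LieAlgebra.Symplectic.sp (Fin 2) ℂ := by
    intro P Q R hQ hR
    rw [mem_sp_iff, J, fromBlocks_transpose, fromBlocks_neg, fromBlocks_multiply,
      fromBlocks_multiply]
    simp [hQ, hR]
  have hH₁ : H₁ ∈ LieAlgebra.Symplectic.sp (Fin 2) ℂ := by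
    convert key !![1, 0; 0, 0] 0 0 (by ext i j; fin_cases i <;> fin_cases j <;> rfl)
      (by ext i j; fin_cases i <;> fin_cases j <;> rfl) using 1
    simp [H₁, ← Matrix.ext_iff, Fin.forall_fin_two]
  have hH₂ : H₂ ∈ LieAlgebra.Symplectic.sp (Fin 2) ℂ := by
    convert key !![0, 0; 0, 1] 0 0 (by ext i j; fin_cases i <;> fin_cases j <;> rfl)
      (by ext i j; fin_cases i <;> fin_cases j <;> rfl) using 1
    simp [H₂, ← Matrix.ext_iff, Fin.forall_fin_two]
  have h₁ : Xα₁ + Xα₁ᵀ ∈ LieAlgebra.Symplectic.sp (Fin 2) ℂ := by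
    convert key !![0, 1; 1, 0] 0 0 (by ext i j; fin_cases i <;> fin_cases j <;> rfl)
      (by ext i j; fin_cases i <;> fin_cases j <;> rfl) using 1
    simp [Xα₁, fromBlocks_transpose, fromBlocks_add, ← Matrix.ext_iff, Fin.forall_fin_two]
  have h₂ : Xα₂ + Xα₂ᵀ ∈ LieAlgebra.Symplectic.sp (Fin 2) ℂ := by
    convert key 0 !![0, 0; 0, 1] !![0, 0; 0, 1] (by ext i j; fin_cases i <;> fin_cases j <;> rfl)
      (by ext i j; fin_cases i <;> fin_cases j <;> rfl) using 1
    simp [Xα₂, fromBlocks_transpose, fromBlocks_add, ← Matrix.ext_iff, Fin.forall_fin_two]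
  have h₃ : Xα₁α₂ + Xα₁α₂ᵀ ∈ LieAlgebra.Symplectic.sp (Fin 2) ℂ := by
    convert key 0 !![0, 1; 1, 0] !![0, 1; 1, 0] (by ext i j; fin_cases i <;> fin_cases j <;> rfl)
      (by ext i j; fin_cases i <;> fin_cases j <;> rfl) using 1
    simp [Xα₁α₂, fromBlocks_transpose, fromBlocks_add, ← Matrix.ext_iff, Fin.forall_fin_two]
  have h₄ : X2α₁α₂ + X2α₁α₂ᵀ ∈ LieAlgebra.Symplectic.sp (Fin 2) ℂ := by
    convert key 0 !![1, 0; 0, 0] !![1, 0; 0, 0] (by ext i j; fin_cases i <;> fin_cases j <;> rfl)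
      (by ext i j; fin_cases i <;> fin_cases j <;> rfl) using 1
    simp [X2α₁α₂, fromBlocks_transpose, fromBlocks_add, ← Matrix.ext_iff, Fin.forall_fin_two]
  cases β
  · exact Submodule.smul_mem _ _ (Submodule.smul_mem _ _
      (Submodule.add_mem _ hH₂ (Submodule.smul_mem _ _ h₂)))
  · exact Submodule.smul_mem _ _ (Submodule.sub_mem _ h₃ (Submodule.smul_mem _ _ h₁))
  · exact Submodule.smul_mem _ _ (Submodule.smul_mem _ _
      (Submodule.add_mem _ hH₁ (Submodule.smul_mem _ _ h₄)))

/-- The noncompact root vector `u_{sβ} ∈ 𝔭_ℂ ⊂ 𝔤_ℂ`. -/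
def u (s : ℤˣ) (β : PosRoot) : gC := ⟨uMatrix s β, uMatrix_mem s β⟩

/-- The integer `m_{sβ} = -i (sβ)(U₃)`. The integer `n_{sβ} = -i (sβ)(U₀)` is `s`. -/
def mRoot (s : ℤˣ) : PosRoot → SignType
  | .β₂ => if s = 1 then -1 else 1
  | .β₁β₂ => 0
  | .twoβ₁β₂ => if s = 1 then 1 else -1

/-! ### The principal series -/

/-- A function on a set of `4 × 4` real matrices (with inclusion `ι`) is smooth if it is the
restriction of a smooth function defined on an open neighbourhood of that set. For the closed
submanifolds `G` and `K` of the space of matrices this is the usual notion. -/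
def IsSmooth {S : Type} (ι : S → Matrix (Fin 2 ⊕ Fin 2) (Fin 2 ⊕ Fin 2) ℝ) (f : S → ℂ) : Prop :=
  ∃ (U : Set (Fin 2 ⊕ Fin 2 → Fin 2 ⊕ Fin 2 → ℝ)) (F : (Fin 2 ⊕ Fin 2 → Fin 2 ⊕ Fin 2 → ℝ) → ℂ),
    IsOpen U ∧ ContDiffOn ℝ ∞ F U ∧
      ∀ x : S, (fun a b => ι x a b) ∈ U ∧ f x = F (fun a b => ι x a b)

/-- The diagonal element `diag(a, b, a⁻¹, b⁻¹)` of `G`. -/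
def torus (a b : ℝˣ) : G :=
  ⟨fromBlocks (diagonal ![(a : ℝ), (b : ℝ)]) 0 0 (diagonal ![((a⁻¹ : ℝˣ) : ℝ), ((b⁻¹ : ℝˣ) : ℝ)]), by
    rw [SymplecticGroup.mem_iff]
    ext i j
    rcases i with i | i <;> rcases j with j | j <;> fin_cases i <;> fin_cases j <;>
      simp [Matrix.mul_apply, J, Fin.sum_univ_two]⟩

/-- `γ_{α₂} = exp π(X_{α₂} - X_{-α₂}) = diag(1, -1, 1, -1)`. -/
def γα₂ : G := torus 1 (-1)

/-- `γ_{2α₁+α₂} = exp π(X_{2α₁+α₂} - X_{-2α₁-α₂}) = diag(-1, 1, -1, 1)`. -/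
def γ2α₁α₂ : G := torus (-1) 1

/-- `exp (t₁ H₁ + t₂ H₂) ∈ A₀`. -/
def expA (t₁ t₂ : ℝ) : G :=
  torus (Units.mk0 (Real.exp t₁) (Real.exp_ne_zero t₁)) (Units.mk0 (Real.exp t₂) (Real.exp_ne_zero t₂))

/-- The unipotent radical `N₀` of the minimal parabolic subgroup, whose Lie algebra is spanned by
the root vectors of `α₁, α₂, α₁ + α₂, 2α₁ + α₂`: the elements of `G` whose lower left block
vanishes and whose upper left block is upper triangular with ones on the diagonal. -/
def N₀ : Set G :=
  {g | g.1.toBlocks₂₁ = 0 ∧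
    ∃ x : ℝ, g.1.toBlocks₁₁ = !![1, x; 0, 1]}

/-- The principal series `I(χ_{δ,λ})`: smooth `f : G → ℂ` with
`f (g m a n) = (δ(m) a^{λ+ρ})⁻¹ f(g)`, where `m = γ_{α₂}^{e₁} γ_{2α₁+α₂}^{e₂}`,
`δ(m) = (-1)^{δ₁ e₁ + δ₂ e₂}`, `a = exp(t₁ H₁ + t₂ H₂)`, and `ρ = (2, 1)`. -/
def principalSeries (δ₁ δ₂ : Fin 2) (lam₁ lam₂ : ℂ) : Set (G → ℂ) :=
  {f | IsSmooth (fun g : G => g.1) f ∧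
    ∀ (g : G) (e₁ e₂ : ℕ) (t₁ t₂ : ℝ), ∀ ν ∈ N₀,
      f (g * (γα₂ ^ e₁ * γ2α₁α₂ ^ e₂) * expA t₁ t₂ * ν) =
        ((-1) ^ ((δ₁ : ℕ) * e₁ + (δ₂ : ℕ) * e₂) *
          Complex.exp ((lam₁ + 2) * t₁ + (lam₂ + 1) * t₂))⁻¹ * f g}

/-- The maximal compact subgroup `K`, the fixed points of `θ(g) = (gᵀ)⁻¹`. -/
def K : Set G := {g | g.1 * g.1ᵀ = 1}

/-- `C_δ(K)`: smooth `φ : K → ℂ` with `φ (k m) = δ(m)⁻¹ φ(k)` for `m ∈ M`. -/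
def CδK (δ₁ δ₂ : Fin 2) : Set (K → ℂ) :=
  {φ | IsSmooth (fun k : K => k.1.1) φ ∧
    ∀ (k k' : K) (e₁ e₂ : ℕ), (k' : G) = k * (γα₂ ^ e₁ * γ2α₁α₂ ^ e₂) →
      φ k' = ((-1) ^ ((δ₁ : ℕ) * e₁ + (δ₂ : ℕ) * e₂))⁻¹ * φ k}

/-! ### Wigner D-functions -/

/-- The isomorphism `K ≅ U(2)`: the matrix with blocks `A, B; -B, A` goes to `A + iB`. -/
def toU2 (k : K) : Matrix (Fin 2) (Fin 2) ℂ :=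
  k.1.1.toBlocks₁₁.map Complex.ofReal +
    Complex.I • k.1.1.toBlocks₁₂.map Complex.ofReal

/-- The set `{-j, -j+1, …, j}` of weights. -/
def weights (j : ℝ) : Set ℝ := {m | ∃ p : ℕ, m = -j + p ∧ m ≤ j}

/-- The monomial exponent of `z₁^{j-m} z₂^{j+m}`. -/
def weightExponent (j m : ℝ) : Fin 2 →₀ ℕ :=
  Finsupp.single 0 ⌊j - m⌋₊ + Finsupp.single 1 ⌊j + m⌋₊

/-- `c^j_m = √((j+m)! (j-m)!)`. -/
def cNorm (j m : ℝ) : ℝ := √((⌊j + m⌋₊.factorial : ℝ) * (⌊j - m⌋₊.factorial : ℝ))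

/-- The weight vector `v^j_m = z₁^{j-m} z₂^{j+m} / √((j-m)! (j+m)!)`. -/
def weightVector (j m : ℝ) : MvPolynomial (Fin 2) ℂ :=
  MvPolynomial.monomial (weightExponent j m) ((cNorm j m : ℂ)⁻¹)

/-- The representation `π_{j,n}` of `U(2)` on homogeneous polynomials of degree `2j`:
`(π_{j,n}(κ) f)(z) = det(κ)^{j+n} f(κ⁻¹ z)`. -/
def wignerRep (j n : ℝ) (κ : Matrix (Fin 2) (Fin 2) ℂ) (f : MvPolynomial (Fin 2) ℂ) :
    MvPolynomial (Fin 2) ℂ :=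
  (κ.det ^ ⌊j + n⌋) •
    MvPolynomial.aeval (fun a => ∑ b, MvPolynomial.C (κ⁻¹ a b) * MvPolynomial.X b) f

open Classical in
/-- The Wigner D-function `W^{(j,n)}_{m₁,m₂}(k) = ⟨v^j_{m₁}, π_{j,n}(k) v^j_{m₂}⟩` on `K ≅ U(2)`,
for the hermitian inner product that makes the `v^j_m` orthonormal and is conjugate linear in its
second argument: the conjugate of the coordinate of `π_{j,n}(k) v^j_{m₂}` along `v^j_{m₁}`. By
convention it is zero if `m₁` or `m₂` is not in `{-j, …, j}`. -/
def W (j n m₁ m₂ : ℝ) (k : K) : ℂ :=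
  if m₁ ∈ weights j ∧ m₂ ∈ weights j then
    starRingEnd ℂ (cNorm j m₁ *
      MvPolynomial.coeff (weightExponent j m₁) (wignerRep j n (toU2 k) (weightVector j m₂)))
  else 0

/-- The pairs `(j, n) ∈ ½ℤ_{≥0} × ½ℤ` with `2j ≡ 2n ≡ δ₁ + δ₂ mod 2`. -/
def KTypes (δ₁ δ₂ : Fin 2) : Set (ℝ × ℝ) :=
  {p | ∃ (a : ℕ) (b : ℤ), p.1 = a / 2 ∧ p.2 = b / 2 ∧
    (a : ℤ) ≡ b [ZMOD 2] ∧ b ≡ ((δ₁ : ℕ) + (δ₂ : ℕ) : ℤ) [ZMOD 2]}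

/-- The `m₂ ∈ {-j, …, j}` with `n - m₂ ≡ δ₁` and `n + m₂ ≡ δ₂ mod 2`. -/
def MSet (j n : ℝ) (δ₁ δ₂ : Fin 2) : Set ℝ :=
  {m₂ | m₂ ∈ weights j ∧ (∃ z : ℤ, n - m₂ = ((δ₁ : ℕ) : ℝ) + 2 * z) ∧
    ∃ z : ℤ, n + m₂ = ((δ₂ : ℕ) : ℝ) + 2 * z}

/-! ### The coefficients -/

/-- The Clebsch–Gordan coefficient of `V^j ⊗ V^1` with upper entries `j + j₀, m + μ` and lower
entries `j, m, 1, μ`. It is zero for `j = 0`, `j₀ ∈ {-1, 0}`, where `V^{j+j₀}` does not occur. -/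
def clebschGordan (j m : ℝ) : SignType → SignType → ℝ
  | .neg, .neg => √((j + m) * (j + m - 1) / (2 * j * (2 * j + 1)))
  | .neg, .zero => -√((j - m) * (j + m) / (j * (2 * j + 1)))
  | .neg, .pos => √((j - m) * (j - m - 1) / (2 * j * (2 * j + 1)))
  | .zero, .neg => √((j + m) * (j - m + 1) / (2 * j * (j + 1)))
  | .zero, .zero => m / √(j * (j + 1))
  | .zero, .pos => -√((j - m) * (j + m + 1) / (2 * j * (j + 1)))
  | .pos, .neg => √((j - m + 1) * (j - m + 2) / ((2 * j + 2) * (2 * j + 1)))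
  | .pos, .zero => √((j - m + 1) * (j + m + 1) / ((j + 1) * (2 * j + 1)))
  | .pos, .pos => √((j + m + 1) * (j + m + 2) / ((2 * j + 2) * (2 * j + 1)))

/-- The factor `C_{j+j₀}`. -/
def coeffC (j : ℝ) : SignType → ℝ
  | .neg => (√j)⁻¹ * (√(2 * j + 1))⁻¹
  | .zero => (√j)⁻¹ * (√(j + 1))⁻¹
  | .pos => (√(j + 1))⁻¹ * (√(2 * j + 1))⁻¹

/-- The factor `q_{j₀,ε}`, as a function of `j` and `m₂`. -/
def coeffq (j m₂ : ℝ) (j₀ : SignType) (ε : ℤˣ) : ℝ :=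
  match j₀ with
  | .neg => if ε = -1 then √((j + m₂ - 1) * (j + m₂)) else √((j - m₂ - 1) * (j - m₂))
  | .zero => if ε = -1 then √((j + m₂) * (j - m₂ + 1)) else √((j - m₂) * (j + m₂ + 1))
  | .pos => if ε = -1 then √((j - m₂ + 1) * (j - m₂ + 2)) else √((j + m₂ + 1) * (j + m₂ + 2))

/-- The factor `κ_{+,j₀,ε}(j, n, m₂; λ)`, with `ρ(H₁) = 2` and `ρ(H₂) = 1`. -/
def kappaPos (j n m₂ : ℝ) (lam₁ lam₂ : ℂ) (j₀ : SignType) (ε : ℤˣ) : ℂ :=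
  match j₀ with
  | .neg => if ε = -1 then n - m₂ + (lam₂ + 1) else -2 - 2 * j + n - m₂ + (lam₁ + 2)
  | .zero => if ε = -1 then n - m₂ + (lam₂ + 1) else 2 - n + m₂ - (lam₁ + 2)
  | .pos => if ε = -1 then n - m₂ + (lam₂ + 1) else 2 * j + n - m₂ + (lam₁ + 2)

/-- The factor `κ_{-,j₀,ε}(j, n, m₂; λ)`, with `ρ(H₁) = 2` and `ρ(H₂) = 1`. -/
def kappaNeg (j n m₂ : ℝ) (lam₁ lam₂ : ℂ) (j₀ : SignType) (ε : ℤˣ) : ℂ :=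
  match j₀ with
  | .neg => if ε = -1 then -2 - 2 * j - n + m₂ + (lam₁ + 2) else -n + m₂ + (lam₂ + 1)
  | .zero => if ε = -1 then -2 - n + m₂ + (lam₁ + 2) else n - m₂ - (lam₂ + 1)
  | .pos => if ε = -1 then 2 * j - n + m₂ + (lam₁ + 2) else -n + m₂ + (lam₂ + 1)

/-- The factor `κ_{±,j₀,ε}(j, n, m₂; λ)`. -/
def kappa (s : ℤˣ) (j n m₂ : ℝ) (lam₁ lam₂ : ℂ) (j₀ : SignType) (ε : ℤˣ) : ℂ :=
  if s = 1 then kappaPos j n m₂ lam₁ lam₂ j₀ ε else kappaNeg j n m₂ lam₁ lam₂ j₀ ε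

end Sp4

end

/-!
The proof makes the extension of a Wigner function to `G` explicit and differentiates it.

An element `g` of `G` with upper left block `A` and lower left block `C` has the complex frame
`A - iC`, an invertible `2 × 2` matrix (`cMat`). Left multiplication by `K` acts on frames through
`U(2)`, and right multiplication by `M A N` multiplies them by real upper triangular matrices
(`cMat_mul_parabolic`). The two columns have a real inner product, because `g` is symplectic, so that
Gram–Schmidt orthonormalization with real coefficients is the Iwasawa decomposition
(`exists_iwasawa`), with components `gsU`, `gsT₁`, `gsT₂` that are smooth in the entries of `g`.
Hence a function on `K` with the right parity under `M` extends to `I(χ_{δ,λ})` in exactly one way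
(`wExt_mem_principalSeries`, `principalSeries_ext`).

With `p = j - m₂`, `q = j + m₂`, `y = j + m₁`, `l = j + n`, the Wigner function at `κ ∈ U(2)` is, up to
a ratio of norms, `det κ ^ (-l)` times the coefficient `wCoeff κ p q y` of `X ^ y` in
`(κ₁₁ + κ₂₁ X) ^ p (κ₁₂ + κ₂₂ X) ^ q` (`W_eq_wCoeff`).

The noncompact part of the complexified Lie algebra consists of the block matrices `[P, Q; Q, -P]`
with `P`, `Q` symmetric. At `k ∈ K` with frame `κ` such an element moves the frame by `κ Y`, where
`Y = -κᴴ (P - iQ) conj κ`. The real upper triangular part of `Y` moves the `A N`-component and brings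
in `λ + ρ`; the rest is skew-hermitian and moves the Wigner function (`hasDerivAt_gsU`, `dl_wExt`).
For a noncompact root vector one of `P - iQ`, `P + iQ` vanishes and the other one is, up to a scalar,
a diagonal matrix unit or the symmetric sum of the two off-diagonal ones. The derivative is therefore a quadratic form in the entries of `κ` times
coefficients `wCoeff` (`wDeriv_pos`, `wDeriv_neg`).

It remains to expand such products. Multiplication of `wCoeff` by a single entry of `κ` has two
terms, of degree `2j + 1` and `2j - 1`, by elementary identities between polynomials and their
derivatives (`wCoeff_mul_entry_one_one` and the three similar ones). Doing this twice gives three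
terms, of degree `2j + 2`, `2j`, `2j - 2` (`wCoeff_mul_one_one_sq` and the similar ones). They match
the products of Clebsch–Gordan coefficients with `C_{j+j₀}` and `q_{j₀,ε}` after the norms of the
weight vectors are taken into account (`coeff_mul_W`), and this is the asserted formula
(`wDeriv_symbol_pos`, `wDeriv_symbol_neg`).
-/

open scoped ContDiff

noncomputable section

namespace Sp4

open Matrix

/-! ### Coefficients of products of linear forms -/

/-- The dehomogenized linear form `κ₁ₐ + κ₂ₐ X` given by a column of `κ`. -/
def colPoly (κ : Matrix (Fin 2) (Fin 2) ℂ) (a : Fin 2) : Polynomial ℂ :=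
  Polynomial.C (κ 0 a) + Polynomial.C (κ 1 a) * Polynomial.X

/-- The product of powers of the two column forms of `κ`. -/
def wPoly (κ : Matrix (Fin 2) (Fin 2) ℂ) (p q : ℕ) : Polynomial ℂ :=
  colPoly κ 0 ^ p * colPoly κ 1 ^ q

/-- The coefficient of `X ^ y` in `(κ₁₁ + κ₂₁ X) ^ p * (κ₁₂ + κ₂₂ X) ^ q`, for integral `p, q, y`;
it is zero if one of them is negative. -/
def wCoeff (κ : Matrix (Fin 2) (Fin 2) ℂ) (p q y : ℤ) : ℂ :=
  if 0 ≤ p ∧ 0 ≤ q ∧ 0 ≤ y then (wPoly κ p.toNat q.toNat).coeff y.toNat else 0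

theorem wCoeff_natCast (κ : Matrix (Fin 2) (Fin 2) ℂ) (p q y : ℕ) :
    wCoeff κ p q y = (wPoly κ p q).coeff y := by
  simp [wCoeff]

theorem wCoeff_of_neg_left (κ : Matrix (Fin 2) (Fin 2) ℂ) {p : ℤ} (q y : ℤ) (h : p < 0) :
    wCoeff κ p q y = 0 := if_neg (by omega)

theorem wCoeff_of_neg_right (κ : Matrix (Fin 2) (Fin 2) ℂ) (p : ℤ) {q : ℤ} (y : ℤ) (h : q < 0) :
    wCoeff κ p q y = 0 := if_neg (by omega)

theorem wCoeff_of_index_neg (κ : Matrix (Fin 2) (Fin 2) ℂ) (p q : ℤ) {y : ℤ} (h : y < 0) :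
    wCoeff κ p q y = 0 := if_neg (by omega)

theorem natDegree_colPoly_le (κ : Matrix (Fin 2) (Fin 2) ℂ) (a : Fin 2) :
    (colPoly κ a).natDegree ≤ 1 := by
  unfold colPoly
  compute_degree

theorem natDegree_wPoly_le (κ : Matrix (Fin 2) (Fin 2) ℂ) (p q : ℕ) :
    (wPoly κ p q).natDegree ≤ p + q := by
  unfold wPoly
  refine Polynomial.natDegree_mul_le_of_le ?_ ?_
  · simpa using Polynomial.natDegree_pow_le_of_le p (natDegree_colPoly_le κ 0)
  · simpa using Polynomial.natDegree_pow_le_of_le q (natDegree_colPoly_le κ 1)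

theorem wCoeff_of_degree_lt (κ : Matrix (Fin 2) (Fin 2) ℂ) {p q y : ℤ} (h : p + q < y) :
    wCoeff κ p q y = 0 := by
  unfold wCoeff
  split_ifs with h0
  · exact Polynomial.coeff_eq_zero_of_natDegree_lt
      ((natDegree_wPoly_le κ _ _).trans_lt (by omega))
  · rfl

/-! ### Multiplication by an entry of `κ` -/

theorem derivative_colPoly (κ : Matrix (Fin 2) (Fin 2) ℂ) (a : Fin 2) :
    Polynomial.derivative (colPoly κ a) = Polynomial.C (κ 1 a) := by
  simp [colPoly]

theorem det_eq_colPoly (κ : Matrix (Fin 2) (Fin 2) ℂ) :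
    Polynomial.C κ.det =
      Polynomial.C (κ 1 1) * colPoly κ 0 - Polynomial.C (κ 1 0) * colPoly κ 1 := by
  simp only [colPoly, det_fin_two, map_sub, map_mul]
  ring

/-! The next four identities multiply a product of powers of two column forms by an entry of `κ`:
the result is a combination of products of total degree one higher and one lower. This is the
tensor product with the standard representation. -/

theorem wPoly_mul_entry_one_one (κ : Matrix (Fin 2) (Fin 2) ℂ) (p q : ℕ) :
    Polynomial.C ((p + q + 1 : ℂ) * κ 1 1) * wPoly κ p q =
      Polynomial.derivative (wPoly κ p (q + 1)) +
        Polynomial.C ((p : ℂ) * κ.det) * wPoly κ (p - 1) q := by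
  rcases p with _ | p
  · simp [wPoly, derivative_colPoly, Polynomial.derivative_pow]
    ring
  · simp [wPoly, derivative_colPoly, Polynomial.derivative_pow, det_eq_colPoly]
    ring

theorem wPoly_mul_entry_one_zero (κ : Matrix (Fin 2) (Fin 2) ℂ) (p q : ℕ) :
    Polynomial.C ((p + q + 1 : ℂ) * κ 1 0) * wPoly κ p q =
      Polynomial.derivative (wPoly κ (p + 1) q) -
        Polynomial.C ((q : ℂ) * κ.det) * wPoly κ p (q - 1) := by
  rcases q with _ | q
  · simp [wPoly, derivative_colPoly, Polynomial.derivative_pow]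
    ring
  · simp [wPoly, derivative_colPoly, Polynomial.derivative_pow, det_eq_colPoly]
    ring

theorem wPoly_mul_entry_zero_one (κ : Matrix (Fin 2) (Fin 2) ℂ) (p q : ℕ) :
    Polynomial.C ((p + q + 1 : ℂ) * κ 0 1) * wPoly κ p q =
      Polynomial.C (p + q + 1 : ℂ) * wPoly κ p (q + 1) -
        Polynomial.X * Polynomial.derivative (wPoly κ p (q + 1)) -
        Polynomial.C ((p : ℂ) * κ.det) * (Polynomial.X * wPoly κ (p - 1) q) := by
  have h : Polynomial.C (κ 0 1) = colPoly κ 1 - Polynomial.C (κ 1 1) * Polynomial.X := by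
    simp [colPoly]
  have h11 := wPoly_mul_entry_one_one κ p q
  have h2 : wPoly κ p (q + 1) = wPoly κ p q * colPoly κ 1 := by simp only [wPoly]; ring
  rw [map_mul, map_mul] at h11
  rw [map_mul, map_mul, h]
  linear_combination (-Polynomial.X) * h11 - Polynomial.C (p + q + 1 : ℂ) * h2

theorem wPoly_mul_entry_zero_zero (κ : Matrix (Fin 2) (Fin 2) ℂ) (p q : ℕ) :
    Polynomial.C ((p + q + 1 : ℂ) * κ 0 0) * wPoly κ p q =
      Polynomial.C (p + q + 1 : ℂ) * wPoly κ (p + 1) q -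
        Polynomial.X * Polynomial.derivative (wPoly κ (p + 1) q) +
        Polynomial.C ((q : ℂ) * κ.det) * (Polynomial.X * wPoly κ p (q - 1)) := by
  have h : Polynomial.C (κ 0 0) = colPoly κ 0 - Polynomial.C (κ 1 0) * Polynomial.X := by
    simp [colPoly]
  have h11 := wPoly_mul_entry_one_zero κ p q
  have h2 : wPoly κ (p + 1) q = wPoly κ p q * colPoly κ 0 := by simp only [wPoly]; ring
  rw [map_mul, map_mul] at h11
  rw [map_mul, map_mul, h]
  linear_combination (-Polynomial.X) * h11 - Polynomial.C (p + q + 1 : ℂ) * h2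

theorem mul_wCoeff_pred_left (κ : Matrix (Fin 2) (Fin 2) ℂ) (p q y : ℕ) :
    (p : ℂ) * wCoeff κ ((p : ℤ) - 1) q y = p * (wPoly κ (p - 1) q).coeff y := by
  rcases p with _ | p
  · simp
  · rw [← wCoeff_natCast]
    simp

theorem mul_wCoeff_pred_right (κ : Matrix (Fin 2) (Fin 2) ℂ) (p q y : ℕ) :
    (q : ℂ) * wCoeff κ p ((q : ℤ) - 1) y = q * (wPoly κ p (q - 1)).coeff y := by
  rcases q with _ | q
  · simp
  · rw [← wCoeff_natCast]
    simp

theorem wCoeff_mul_entry_one_one (κ : Matrix (Fin 2) (Fin 2) ℂ) (p : ℤ) {q : ℤ}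
    (hq : 0 ≤ q) (y : ℤ) :
    (p + q + 1 : ℂ) * κ 1 1 * wCoeff κ p q y =
      (y + 1) * wCoeff κ p (q + 1) (y + 1) + p * κ.det * wCoeff κ (p - 1) q y := by
  rcases lt_or_ge p 0 with hp | hp
  · simp [wCoeff_of_neg_left κ _ _ hp, wCoeff_of_neg_left κ _ _ (show p - 1 < 0 by omega)]
  lift p to ℕ using hp
  lift q to ℕ using hq
  rcases lt_or_ge y 0 with hy | hy
  · rw [wCoeff_of_index_neg κ _ _ hy, wCoeff_of_index_neg κ _ _ hy]
    rcases eq_or_ne y (-1) with rfl | h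
    · simp
    · rw [wCoeff_of_index_neg κ _ _ (by omega)]
      simp
  · lift y to ℕ using hy
    have h := congrArg (Polynomial.coeff · y) (wPoly_mul_entry_one_one κ p q)
    simp only [Polynomial.coeff_C_mul, Polynomial.coeff_add, Polynomial.coeff_derivative] at h
    have h1 := mul_wCoeff_pred_left κ p q y
    have h2 := wCoeff_natCast κ p (q + 1) (y + 1)
    have h3 := wCoeff_natCast κ p q y
    push_cast at h1 h2 h3 ⊢
    rw [h2, h3]
    linear_combination h - κ.det * h1

theorem wCoeff_mul_entry_one_zero (κ : Matrix (Fin 2) (Fin 2) ℂ) {p : ℤ} (hp : 0 ≤ p)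
    (q y : ℤ) :
    (p + q + 1 : ℂ) * κ 1 0 * wCoeff κ p q y =
      (y + 1) * wCoeff κ (p + 1) q (y + 1) - q * κ.det * wCoeff κ p (q - 1) y := by
  rcases lt_or_ge q 0 with hq | hq
  · simp [wCoeff_of_neg_right κ _ _ hq, wCoeff_of_neg_right κ _ _ (show q - 1 < 0 by omega)]
  lift p to ℕ using hp
  lift q to ℕ using hq
  rcases lt_or_ge y 0 with hy | hy
  · rw [wCoeff_of_index_neg κ _ _ hy, wCoeff_of_index_neg κ _ _ hy]
    rcases eq_or_ne y (-1) with rfl | h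
    · simp
    · rw [wCoeff_of_index_neg κ _ _ (by omega)]
      simp
  · lift y to ℕ using hy
    have h := congrArg (Polynomial.coeff · y) (wPoly_mul_entry_one_zero κ p q)
    simp only [Polynomial.coeff_C_mul, Polynomial.coeff_sub, Polynomial.coeff_derivative] at h
    have h1 := mul_wCoeff_pred_right κ p q y
    have h2 := wCoeff_natCast κ (p + 1) q (y + 1)
    have h3 := wCoeff_natCast κ p q y
    push_cast at h1 h2 h3 ⊢
    rw [h2, h3]
    linear_combination h + κ.det * h1

theorem wCoeff_mul_entry_zero_one (κ : Matrix (Fin 2) (Fin 2) ℂ) (p : ℤ) {q : ℤ}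
    (hq : 0 ≤ q) (y : ℤ) :
    (p + q + 1 : ℂ) * κ 0 1 * wCoeff κ p q y =
      (p + q + 1 - y) * wCoeff κ p (q + 1) y - p * κ.det * wCoeff κ (p - 1) q (y - 1) := by
  rcases lt_or_ge p 0 with hp | hp
  · simp [wCoeff_of_neg_left κ _ _ hp, wCoeff_of_neg_left κ _ _ (show p - 1 < 0 by omega)]
  lift p to ℕ using hp
  lift q to ℕ using hq
  rcases lt_or_ge y 0 with hy | hy
  · rw [wCoeff_of_index_neg κ _ _ hy, wCoeff_of_index_neg κ _ _ hy,
      wCoeff_of_index_neg κ _ _ (by omega)]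
    simp
  · lift y to ℕ using hy
    have h := congrArg (Polynomial.coeff · y) (wPoly_mul_entry_zero_one κ p q)
    rcases y with _ | y
    · rw [wCoeff_of_index_neg κ (p - 1) q (y := ((0 : ℕ) : ℤ) - 1) (by simp)]
      simp only [Polynomial.coeff_sub, Polynomial.coeff_C_zero,
        Polynomial.mul_coeff_zero, Polynomial.coeff_X_zero] at h
      have h2 := wCoeff_natCast κ p (q + 1) 0
      have h3 := wCoeff_natCast κ p q 0
      push_cast at h2 h3 ⊢
      rw [h2, h3]
      linear_combination h
    · simp only [Polynomial.coeff_C_mul, Polynomial.coeff_sub, Polynomial.coeff_derivative,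
        Polynomial.coeff_X_mul] at h
      have h1 := mul_wCoeff_pred_left κ p q y
      have h2 := wCoeff_natCast κ p (q + 1) (y + 1)
      have h3 := wCoeff_natCast κ p q (y + 1)
      push_cast at h1 h2 h3 ⊢
      rw [h2, h3, add_sub_cancel_right]
      linear_combination h + κ.det * h1

theorem wCoeff_mul_entry_zero_zero (κ : Matrix (Fin 2) (Fin 2) ℂ) {p : ℤ} (hp : 0 ≤ p)
    (q y : ℤ) :
    (p + q + 1 : ℂ) * κ 0 0 * wCoeff κ p q y =
      (p + q + 1 - y) * wCoeff κ (p + 1) q y + q * κ.det * wCoeff κ p (q - 1) (y - 1) := by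
  rcases lt_or_ge q 0 with hq | hq
  · simp [wCoeff_of_neg_right κ _ _ hq, wCoeff_of_neg_right κ _ _ (show q - 1 < 0 by omega)]
  lift p to ℕ using hp
  lift q to ℕ using hq
  rcases lt_or_ge y 0 with hy | hy
  · rw [wCoeff_of_index_neg κ _ _ hy, wCoeff_of_index_neg κ _ _ hy,
      wCoeff_of_index_neg κ _ _ (by omega)]
    simp
  · lift y to ℕ using hy
    have h := congrArg (Polynomial.coeff · y) (wPoly_mul_entry_zero_zero κ p q)
    rcases y with _ | y
    · rw [wCoeff_of_index_neg κ p (q - 1) (y := ((0 : ℕ) : ℤ) - 1) (by simp)]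
      simp only [Polynomial.coeff_sub, Polynomial.coeff_add, Polynomial.coeff_C_zero,
        Polynomial.mul_coeff_zero, Polynomial.coeff_X_zero] at h
      have h2 := wCoeff_natCast κ (p + 1) q 0
      have h3 := wCoeff_natCast κ p q 0
      push_cast at h2 h3 ⊢
      rw [h2, h3]
      linear_combination h
    · simp only [Polynomial.coeff_C_mul, Polynomial.coeff_sub, Polynomial.coeff_add,
        Polynomial.coeff_derivative, Polynomial.coeff_X_mul] at h
      have h1 := mul_wCoeff_pred_right κ p q y
      have h2 := wCoeff_natCast κ (p + 1) q (y + 1)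
      have h3 := wCoeff_natCast κ p q (y + 1)
      push_cast at h1 h2 h3 ⊢
      rw [h2, h3, add_sub_cancel_right]
      linear_combination h - κ.det * h1

/-! ### Products with two entries of `κ` -/

/-- The shape of the expansion of a product with a quadratic form in `κ`: three terms, belonging to
the constituents of degree `N + 2`, `N`, `N - 2`. For `N = 0` division by zero removes the last
two. -/
theorem eq_three_terms {N : ℤ} (hN : 0 ≤ N) {Z A B C : ℂ}
    (h : N ≠ 0 → (N * (N + 1) * (N + 2) : ℂ) * Z = N * A + (N + 1) * B + (N + 2) * C)
    (h0 : N = 0 → 2 * Z = A) :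
    Z = A / ((N + 1) * (N + 2)) + B / (N * (N + 2)) + C / (N * (N + 1)) := by
  rcases eq_or_ne N 0 with rfl | hN0
  · rw [← h0 rfl]
    simp
  · have e0 : (N : ℂ) ≠ 0 := by exact_mod_cast hN0
    have e1 : (N + 1 : ℂ) ≠ 0 := by exact_mod_cast (by omega : N + 1 ≠ 0)
    have e2 : (N + 2 : ℂ) ≠ 0 := by exact_mod_cast (by omega : N + 2 ≠ 0)
    have h' := h hN0
    field_simp
    linear_combination h'

variable (κ : Matrix (Fin 2) (Fin 2) ℂ) {p q : ℤ} (y : ℤ)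

/-! Applying the identities for a single entry twice decomposes the product of `wCoeff` with a
quadratic monomial in the entries of `κ`. This is the tensor product with the adjoint representation,
and its three terms are the Clebsch–Gordan constituents. -/

theorem wCoeff_mul_one_one_sq (hp : 0 ≤ p) (hq : 0 ≤ q) {N : ℤ} (hN : N = p + q) :
    κ 1 1 * κ 1 1 * wCoeff κ p q y =
      (y + 1) * (y + 2) * wCoeff κ p (q + 2) (y + 2) / ((N + 1) * (N + 2)) +
      2 * p * (y + 1) * (κ.det * wCoeff κ (p - 1) (q + 1) (y + 1)) / (N * (N + 2)) +
      p * (p - 1) * (κ.det ^ 2 * wCoeff κ (p - 2) q y) / (N * (N + 1)) := by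
  have h1 := wCoeff_mul_entry_one_one κ p hq y
  have h2 := wCoeff_mul_entry_one_one κ p (show 0 ≤ q + 1 by omega) (y + 1)
  have h3 := wCoeff_mul_entry_one_one κ (p - 1) hq y
  rw [show q + 1 + 1 = q + 2 by ring, show y + 1 + 1 = y + 2 by ring] at h2
  rw [show p - 1 - 1 = p - 2 by ring] at h3
  push_cast at h1 h2 h3
  refine eq_three_terms (by omega) (fun _ => ?_) (fun h => ?_)
  · rw [hN]
    push_cast
    linear_combination (p + q) * (p + q + 2) * κ 1 1 * h1 + (y + 1) * (p + q) * h2 +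
      p * (p + q + 2) * κ.det * h3
  · obtain rfl : p = 0 := by omega
    obtain rfl : q = 0 := by omega
    push_cast at h1 h2 ⊢
    linear_combination 2 * κ 1 1 * h1 + (y + 1) * h2

theorem wCoeff_mul_one_zero_sq (hp : 0 ≤ p) (hq : 0 ≤ q) {N : ℤ} (hN : N = p + q) :
    κ 1 0 * κ 1 0 * wCoeff κ p q y =
      (y + 1) * (y + 2) * wCoeff κ (p + 2) q (y + 2) / ((N + 1) * (N + 2)) +
      -2 * q * (y + 1) * (κ.det * wCoeff κ (p + 1) (q - 1) (y + 1)) / (N * (N + 2)) +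
      q * (q - 1) * (κ.det ^ 2 * wCoeff κ p (q - 2) y) / (N * (N + 1)) := by
  have h1 := wCoeff_mul_entry_one_zero κ hp q y
  have h2 := wCoeff_mul_entry_one_zero κ (show 0 ≤ p + 1 by omega) q (y + 1)
  have h3 := wCoeff_mul_entry_one_zero κ hp (q - 1) y
  rw [show p + 1 + 1 = p + 2 by ring, show y + 1 + 1 = y + 2 by ring] at h2
  rw [show q - 1 - 1 = q - 2 by ring] at h3
  push_cast at h1 h2 h3
  refine eq_three_terms (by omega) (fun _ => ?_) (fun h => ?_)
  · rw [hN]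
    push_cast
    linear_combination (p + q) * (p + q + 2) * κ 1 0 * h1 + (y + 1) * (p + q) * h2 -
      q * (p + q + 2) * κ.det * h3
  · obtain rfl : p = 0 := by omega
    obtain rfl : q = 0 := by omega
    push_cast at h1 h2 ⊢
    linear_combination 2 * κ 1 0 * h1 + (y + 1) * h2

theorem wCoeff_mul_zero_one_sq (hp : 0 ≤ p) (hq : 0 ≤ q) {N : ℤ} (hN : N = p + q) :
    κ 0 1 * κ 0 1 * wCoeff κ p q y =
      (N - y + 1) * (N - y + 2) * wCoeff κ p (q + 2) y / ((N + 1) * (N + 2)) +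
      -2 * p * (N - y + 1) * (κ.det * wCoeff κ (p - 1) (q + 1) (y - 1)) / (N * (N + 2)) +
      p * (p - 1) * (κ.det ^ 2 * wCoeff κ (p - 2) q (y - 2)) / (N * (N + 1)) := by
  have h1 := wCoeff_mul_entry_zero_one κ p hq y
  have h2 := wCoeff_mul_entry_zero_one κ p (show 0 ≤ q + 1 by omega) y
  have h3 := wCoeff_mul_entry_zero_one κ (p - 1) hq (y - 1)
  rw [show q + 1 + 1 = q + 2 by ring] at h2
  rw [show p - 1 - 1 = p - 2 by ring, show y - 1 - 1 = y - 2 by ring] at h3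
  push_cast at h1 h2 h3
  refine eq_three_terms (by omega) (fun _ => ?_) (fun h => ?_)
  · rw [hN]
    push_cast
    linear_combination (p + q) * (p + q + 2) * κ 0 1 * h1 + (p + q + 1 - y) * (p + q) * h2 -
      p * (p + q + 2) * κ.det * h3
  · obtain rfl : p = 0 := by omega
    obtain rfl : q = 0 := by omega
    rw [hN]
    push_cast at h1 h2 ⊢
    linear_combination 2 * κ 0 1 * h1 + (1 - y) * h2

theorem wCoeff_mul_zero_zero_sq (hp : 0 ≤ p) (hq : 0 ≤ q) {N : ℤ} (hN : N = p + q) :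
    κ 0 0 * κ 0 0 * wCoeff κ p q y =
      (N - y + 1) * (N - y + 2) * wCoeff κ (p + 2) q y / ((N + 1) * (N + 2)) +
      2 * q * (N - y + 1) * (κ.det * wCoeff κ (p + 1) (q - 1) (y - 1)) / (N * (N + 2)) +
      q * (q - 1) * (κ.det ^ 2 * wCoeff κ p (q - 2) (y - 2)) / (N * (N + 1)) := by
  have h1 := wCoeff_mul_entry_zero_zero κ hp q y
  have h2 := wCoeff_mul_entry_zero_zero κ (show 0 ≤ p + 1 by omega) q y
  have h3 := wCoeff_mul_entry_zero_zero κ hp (q - 1) (y - 1)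
  rw [show p + 1 + 1 = p + 2 by ring] at h2
  rw [show q - 1 - 1 = q - 2 by ring, show y - 1 - 1 = y - 2 by ring] at h3
  push_cast at h1 h2 h3
  refine eq_three_terms (by omega) (fun _ => ?_) (fun h => ?_)
  · rw [hN]
    push_cast
    linear_combination (p + q) * (p + q + 2) * κ 0 0 * h1 + (p + q + 1 - y) * (p + q) * h2 +
      q * (p + q + 2) * κ.det * h3
  · obtain rfl : p = 0 := by omega
    obtain rfl : q = 0 := by omega
    rw [hN]
    push_cast at h1 h2 ⊢
    linear_combination 2 * κ 0 0 * h1 + (1 - y) * h2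

theorem wCoeff_mul_zero_one_one_one (hp : 0 ≤ p) (hq : 0 ≤ q) {N : ℤ} (hN : N = p + q) :
    κ 0 1 * κ 1 1 * wCoeff κ p q y =
      (N - y + 1) * (y + 1) * wCoeff κ p (q + 2) (y + 1) / ((N + 1) * (N + 2)) +
      p * (N - 2 * y) * (κ.det * wCoeff κ (p - 1) (q + 1) y) / (N * (N + 2)) +
      -(p * (p - 1)) * (κ.det ^ 2 * wCoeff κ (p - 2) q (y - 1)) / (N * (N + 1)) := by
  have h1 := wCoeff_mul_entry_one_one κ p hq y
  have h2 := wCoeff_mul_entry_zero_one κ p (show 0 ≤ q + 1 by omega) (y + 1)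
  have h3 := wCoeff_mul_entry_zero_one κ (p - 1) hq y
  rw [show q + 1 + 1 = q + 2 by ring, show y + 1 - 1 = y by ring] at h2
  rw [show p - 1 - 1 = p - 2 by ring] at h3
  push_cast at h1 h2 h3
  refine eq_three_terms (by omega) (fun _ => ?_) (fun h => ?_)
  · rw [hN]
    push_cast
    linear_combination (p + q) * (p + q + 2) * κ 0 1 * h1 + (y + 1) * (p + q) * h2 +
      p * (p + q + 2) * κ.det * h3
  · obtain rfl : p = 0 := by omega
    obtain rfl : q = 0 := by omega
    rw [hN]
    push_cast at h1 h2 ⊢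
    linear_combination 2 * κ 0 1 * h1 + (y + 1) * h2

theorem wCoeff_mul_zero_zero_one_zero (hp : 0 ≤ p) (hq : 0 ≤ q) {N : ℤ} (hN : N = p + q) :
    κ 0 0 * κ 1 0 * wCoeff κ p q y =
      (N - y + 1) * (y + 1) * wCoeff κ (p + 2) q (y + 1) / ((N + 1) * (N + 2)) +
      -q * (N - 2 * y) * (κ.det * wCoeff κ (p + 1) (q - 1) y) / (N * (N + 2)) +
      -(q * (q - 1)) * (κ.det ^ 2 * wCoeff κ p (q - 2) (y - 1)) / (N * (N + 1)) := by
  have h1 := wCoeff_mul_entry_one_zero κ hp q y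
  have h2 := wCoeff_mul_entry_zero_zero κ (show 0 ≤ p + 1 by omega) q (y + 1)
  have h3 := wCoeff_mul_entry_zero_zero κ hp (q - 1) y
  rw [show p + 1 + 1 = p + 2 by ring, show y + 1 - 1 = y by ring] at h2
  rw [show q - 1 - 1 = q - 2 by ring] at h3
  push_cast at h1 h2 h3
  refine eq_three_terms (by omega) (fun _ => ?_) (fun h => ?_)
  · rw [hN]
    push_cast
    linear_combination (p + q) * (p + q + 2) * κ 0 0 * h1 + (y + 1) * (p + q) * h2 -
      q * (p + q + 2) * κ.det * h3
  · obtain rfl : p = 0 := by omega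
    obtain rfl : q = 0 := by omega
    rw [hN]
    push_cast at h1 h2 ⊢
    linear_combination 2 * κ 0 0 * h1 + (y + 1) * h2

theorem wCoeff_mul_one_zero_one_one (hp : 0 ≤ p) (hq : 0 ≤ q) (hpq : 1 ≤ p + q) {N : ℤ}
    (hN : N = p + q) :
    κ 1 0 * κ 1 1 * wCoeff κ p q y =
      (y + 1) * (y + 2) * wCoeff κ (p + 1) (q + 1) (y + 2) / ((N + 1) * (N + 2)) +
      (p - q) * (y + 1) * (κ.det * wCoeff κ p q (y + 1)) / (N * (N + 2)) +
      -(p * q) * (κ.det ^ 2 * wCoeff κ (p - 1) (q - 1) y) / (N * (N + 1)) := by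
  have h1 := wCoeff_mul_entry_one_one κ p hq y
  have h2 := wCoeff_mul_entry_one_zero κ hp (q + 1) (y + 1)
  have h3 : p * ((p + q) * κ 1 0 * wCoeff κ (p - 1) q y) =
      p * ((y + 1) * wCoeff κ p q (y + 1) - q * κ.det * wCoeff κ (p - 1) (q - 1) y) := by
    rcases hp.eq_or_lt with rfl | hp
    · simp
    · have h3 := wCoeff_mul_entry_one_zero κ (show 0 ≤ p - 1 by omega) q y
      rw [show p - 1 + 1 = p by ring] at h3
      push_cast at h3
      linear_combination p * h3
  rw [show q + 1 - 1 = q by ring, show y + 1 + 1 = y + 2 by ring] at h2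
  push_cast at h1 h2
  refine eq_three_terms (by omega) (fun _ => ?_) (fun h => by omega)
  rw [hN]
  push_cast
  linear_combination (p + q) * (p + q + 2) * κ 1 0 * h1 + (y + 1) * (p + q) * h2 +
    (p + q + 2) * κ.det * h3

theorem wCoeff_mul_zero_zero_zero_one (hp : 0 ≤ p) (hq : 0 ≤ q) (hpq : 1 ≤ p + q) {N : ℤ}
    (hN : N = p + q) :
    κ 0 0 * κ 0 1 * wCoeff κ p q y =
      (N - y + 1) * (N - y + 2) * wCoeff κ (p + 1) (q + 1) y / ((N + 1) * (N + 2)) +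
      (q - p) * (N - y + 1) * (κ.det * wCoeff κ p q (y - 1)) / (N * (N + 2)) +
      -(p * q) * (κ.det ^ 2 * wCoeff κ (p - 1) (q - 1) (y - 2)) / (N * (N + 1)) := by
  have h1 := wCoeff_mul_entry_zero_one κ p hq y
  have h2 := wCoeff_mul_entry_zero_zero κ hp (q + 1) y
  have h3 : p * ((p + q) * κ 0 0 * wCoeff κ (p - 1) q (y - 1)) =
      p * ((p + q - y + 1) * wCoeff κ p q (y - 1) +
        q * κ.det * wCoeff κ (p - 1) (q - 1) (y - 2)) := by
    rcases hp.eq_or_lt with rfl | hp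
    · simp
    · have h3 := wCoeff_mul_entry_zero_zero κ (show 0 ≤ p - 1 by omega) q (y - 1)
      rw [show p - 1 + 1 = p by ring, show y - 1 - 1 = y - 2 by ring] at h3
      push_cast at h3
      linear_combination p * h3
  rw [show q + 1 - 1 = q by ring] at h2
  push_cast at h1 h2
  refine eq_three_terms (by omega) (fun _ => ?_) (fun h => by omega)
  rw [hN]
  push_cast
  linear_combination (p + q) * (p + q + 2) * κ 0 0 * h1 + (p + q + 1 - y) * (p + q) * h2 -
    (p + q + 2) * κ.det * h3

theorem wCoeff_mul_permanent (hp : 0 ≤ p) (hq : 0 ≤ q) (hpq : 1 ≤ p + q) {N : ℤ}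
    (hN : N = p + q) :
    (κ 0 0 * κ 1 1 + κ 0 1 * κ 1 0) * wCoeff κ p q y =
      2 * (N - y + 1) * (y + 1) * wCoeff κ (p + 1) (q + 1) (y + 1) / ((N + 1) * (N + 2)) +
      (p - q) * (N - 2 * y) * (κ.det * wCoeff κ p q y) / (N * (N + 2)) +
      2 * p * q * (κ.det ^ 2 * wCoeff κ (p - 1) (q - 1) (y - 1)) / (N * (N + 1)) := by
  have h1 := wCoeff_mul_entry_one_one κ p hq y
  have h2 := wCoeff_mul_entry_zero_zero κ hp (q + 1) (y + 1)
  have h3 : p * ((p + q) * κ 0 0 * wCoeff κ (p - 1) q y) =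
      p * ((p + q - y) * wCoeff κ p q y + q * κ.det * wCoeff κ (p - 1) (q - 1) (y - 1)) := by
    rcases hp.eq_or_lt with rfl | hp
    · simp
    · have h3 := wCoeff_mul_entry_zero_zero κ (show 0 ≤ p - 1 by omega) q y
      rw [show p - 1 + 1 = p by ring] at h3
      push_cast at h3
      linear_combination p * h3
  rw [show q + 1 - 1 = q by ring, show y + 1 - 1 = y by ring] at h2
  push_cast at h1 h2
  have hdet := det_fin_two κ
  refine eq_three_terms (by omega) (fun _ => ?_) (fun h => by omega)
  rw [hN]
  push_cast
  linear_combination 2 * (p + q) * (p + q + 2) * κ 0 0 * h1 + 2 * (y + 1) * (p + q) * h2 +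
    2 * (p + q + 2) * κ.det * h3 + (p + q) * (p + q + 1) * (p + q + 2) * wCoeff κ p q y * hdet

/-! ### The action of `G` on Lagrangian frames -/

/-- The complex `2 × 2` matrix `A - iC` formed from the blocks `A, C` in the first two columns of a
real `4 × 4` matrix. -/
def cMat (x : Matrix (Fin 2 ⊕ Fin 2) (Fin 2 ⊕ Fin 2) ℝ) : Matrix (Fin 2) (Fin 2) ℂ :=
  fun a b => (x (.inl a) (.inl b) : ℂ) - Complex.I * (x (.inr a) (.inl b) : ℂ)

theorem toBlocks_of_mem_K (k : K) :
    k.1.1.toBlocks₂₁ = -k.1.1.toBlocks₁₂ ∧ k.1.1.toBlocks₂₂ = k.1.1.toBlocks₁₁ := by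
  have h : k.1.1 * J (Fin 2) ℝ = J (Fin 2) ℝ * k.1.1 := by
    have h1 : k.1.1ᵀ * k.1.1 = 1 := mul_eq_one_comm.1 k.2
    have h2 := SymplecticGroup.mem_iff.1 k.1.2
    calc k.1.1 * J (Fin 2) ℝ = k.1.1 * J (Fin 2) ℝ * (k.1.1ᵀ * k.1.1) := by rw [h1, mul_one]
      _ = J (Fin 2) ℝ * k.1.1 := by rw [← mul_assoc, h2]
  rw [← fromBlocks_toBlocks k.1.1, J, fromBlocks_multiply, fromBlocks_multiply] at h
  simp only [fromBlocks_inj, mul_zero, mul_one, zero_add, add_zero, zero_mul, neg_mul, one_mul,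
    mul_neg] at h
  exact ⟨by rw [h.1, neg_neg], h.2.2.1⟩

theorem K_inr_inl (k : K) (a b : Fin 2) : k.1.1 (.inr a) (.inl b) = -k.1.1 (.inl a) (.inr b) :=
  congrFun (congrFun (toBlocks_of_mem_K k).1 a) b

theorem K_inr_inr (k : K) (a b : Fin 2) : k.1.1 (.inr a) (.inr b) = k.1.1 (.inl a) (.inl b) :=
  congrFun (congrFun (toBlocks_of_mem_K k).2 a) b

/-- On `K` the frame is the image under `K ≅ U(2)`, since there `C = -B`. -/
theorem toU2_eq_cMat (k : K) : toU2 k = cMat k.1.1 := by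
  ext a b
  simp [toU2, cMat, K_inr_inl, toBlocks₁₁, toBlocks₁₂]

theorem cMat_K_unitary (k : K) : (cMat k.1.1)ᴴ * cMat k.1.1 = 1 := by
  have h1 : k.1.1ᵀ * k.1.1 = 1 := mul_eq_one_comm.1 k.2
  ext a b
  have e1 := congrFun (congrFun h1 (.inl a)) (.inl b)
  have e2 := congrFun (congrFun h1 (.inr a)) (.inl b)
  simp only [mul_apply, Fintype.sum_sum_type, Fin.sum_univ_two, transpose_apply, K_inr_inl,
    K_inr_inr, Matrix.one_apply, Sum.inl.injEq, reduceCtorEq, if_false] at e1 e2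
  simp only [mul_apply, Fin.sum_univ_two, conjTranspose_apply, cMat, K_inr_inl, Matrix.one_apply]
  apply Complex.ext
  · simp
    split_ifs at e1 ⊢ <;> simp <;> linarith
  · simp
    split_ifs <;> simp <;> linarith

theorem cMat_K_inv (k : K) : (cMat k.1.1)⁻¹ = (cMat k.1.1)ᴴ :=
  inv_eq_left_inv (cMat_K_unitary k)

theorem det_mul_conj_det_of_unitary {κ : Matrix (Fin 2) (Fin 2) ℂ} (h : κᴴ * κ = 1) :
    κ.det * starRingEnd ℂ κ.det = 1 := by
  have := congrArg det h
  rw [det_mul, det_conjTranspose, det_one] at this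
  rw [mul_comm]
  exact this

/-! ### The Wigner functions as coefficients -/

/-- A homogeneous polynomial in `z₁, z₂` has the coefficients of its value at `(1, X)`. -/
theorem coeff_eq_coeff_dehomogenize {F : MvPolynomial (Fin 2) ℂ} {x y : ℕ}
    (hF : F.IsHomogeneous (x + y)) :
    F.coeff (Finsupp.single 0 x + Finsupp.single 1 y) =
      (MvPolynomial.aeval ![1, Polynomial.X] F : Polynomial ℂ).coeff y := by
  rw [MvPolynomial.aeval_def, MvPolynomial.eval₂_eq', Polynomial.finsetSum_coeff,
    Finset.sum_eq_single (Finsupp.single 0 x + Finsupp.single 1 y)]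
  · simp [Polynomial.coeff_C_mul, Fin.prod_univ_two]
  · intro d hd hne
    simp only [Fin.prod_univ_two, Matrix.cons_val_zero, Matrix.cons_val_one, one_pow, one_mul,
      Polynomial.algebraMap_eq, Polynomial.coeff_C_mul, Polynomial.coeff_X_pow]
    split_ifs with h
    · exfalso
      refine hne ?_
      have hdeg : Finsupp.degree d = x + y := by
        by_contra hcon
        exact (MvPolynomial.mem_support_iff.1 hd) (hF.coeff_eq_zero hcon)
      rw [Finsupp.degree_eq_sum, Fin.sum_univ_two] at hdeg
      ext i
      fin_cases i
      · simp; omega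
      · simp; omega
    · simp
  · intro h
    rw [MvPolynomial.notMem_support_iff.1 h]
    simp

theorem mem_weights_iff {j m : ℝ} {x y : ℤ} (hx : j - m = x) (hy : j + m = y) :
    m ∈ weights j ↔ 0 ≤ x ∧ 0 ≤ y := by
  constructor
  · rintro ⟨p, hp, hm⟩
    constructor
    · have : (0 : ℝ) ≤ x := by linarith
      exact_mod_cast this
    · have : (0 : ℝ) ≤ y := by
        rw [← hy, hp]
        simp
      exact_mod_cast this
  · rintro ⟨h1, h2⟩
    refine ⟨y.toNat, ?_, ?_⟩
    · have : ((y.toNat : ℤ) : ℝ) = y := by rw [Int.toNat_of_nonneg h2]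
      push_cast at this
      rw [this]
      linarith
    · have : (0 : ℝ) ≤ x := by exact_mod_cast h1
      linarith

/-- The Wigner function in terms of the coefficients of products of column forms. The formula also
covers the conventional zeros outside `{-j, …, j}`. -/
theorem W_eq_wCoeff {j n m₁ m₂ : ℝ} {p q x y l : ℤ} (hp : j - m₂ = p) (hq : j + m₂ = q)
    (hx : j - m₁ = x) (hy : j + m₁ = y) (hl : j + n = l) (k : K) :
    W j n m₁ m₂ k = (cNorm j m₁ : ℂ) / cNorm j m₂ *
      ((cMat k.1.1).det ^ (-l) * wCoeff (cMat k.1.1) p q y) := by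
  have hsum : p + q = x + y := by
    have : (p + q : ℝ) = x + y := by rw [← hp, ← hq, ← hx, ← hy]; ring
    exact_mod_cast this
  unfold W
  rw [mem_weights_iff hx hy, mem_weights_iff hp hq]
  split_ifs with h
  · obtain ⟨⟨h1, h2⟩, h3, h4⟩ := h
    lift p to ℕ using h3
    lift q to ℕ using h4
    lift x to ℕ using h1
    lift y to ℕ using h2
    have hdet := det_mul_conj_det_of_unitary (cMat_K_unitary k)
    have e1 : weightExponent j m₁ = Finsupp.single 0 x + Finsupp.single 1 y := by
      rw [weightExponent, hx, hy]
      simp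
    have e2 : weightExponent j m₂ = Finsupp.single 0 p + Finsupp.single 1 q := by
      rw [weightExponent, hp, hq]
      simp
    rw [toU2_eq_cMat, wignerRep, weightVector, e1, e2, hl, Int.floor_intCast, wCoeff_natCast,
      MvPolynomial.aeval_monomial, MvPolynomial.coeff_smul, MvPolynomial.algebraMap_eq,
      MvPolynomial.coeff_C_mul, Finsupp.prod_add_index' (by simp) (by intros; rw [pow_add]),
      Finsupp.prod_single_index (by simp), Finsupp.prod_single_index (by simp),
      coeff_eq_coeff_dehomogenize]
    · have e3 : (wPoly (cMat k.1.1) p q) = Polynomial.map (starRingEnd ℂ)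
          (MvPolynomial.aeval ![1, Polynomial.X]
            ((∑ b, MvPolynomial.C ((cMat k.1.1)⁻¹ 0 b) * MvPolynomial.X b) ^ p *
            (∑ b, MvPolynomial.C ((cMat k.1.1)⁻¹ 1 b) * MvPolynomial.X b) ^ q)) := by
        rw [cMat_K_inv]
        simp [wPoly, colPoly, Fin.sum_univ_two]
      rw [e3, Polynomial.coeff_map, map_mul, smul_eq_mul, map_mul, map_mul, map_zpow₀, map_inv₀,
        Complex.conj_ofReal, Complex.conj_ofReal, eq_inv_of_mul_eq_one_right hdet, _root_.inv_zpow',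
        div_eq_mul_inv]
      ring
    · have hN : x + y = 1 * p + 1 * q := by omega
      rw [hN]
      refine MvPolynomial.IsHomogeneous.mul ?_ ?_ <;> refine MvPolynomial.IsHomogeneous.pow ?_ _ <;>
        exact MvPolynomial.IsHomogeneous.sum _ _ _
          fun b _ => MvPolynomial.isHomogeneous_C_mul_X _ _
  · have : wCoeff (cMat k.1.1) p q y = 0 := by
      by_cases hp0 : p < 0
      · exact wCoeff_of_neg_left _ _ _ hp0
      by_cases hq0 : q < 0
      · exact wCoeff_of_neg_right _ _ _ hq0
      by_cases hy0 : y < 0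
      · exact wCoeff_of_index_neg _ _ _ hy0
      · exact wCoeff_of_degree_lt _ (by omega)
    rw [this, mul_zero, mul_zero]

/-! ### Rational form of the coefficients -/

theorem cNorm_eq {j m : ℝ} {x y : ℕ} (hx : j - m = x) (hy : j + m = y) :
    cNorm j m = √((y.factorial : ℝ) * x.factorial) := by
  simp [cNorm, hx, hy]

/-- The product of the Clebsch–Gordan coefficient, `C_{j+j₀}` and the ratio of the norms
`c^{j+j₀}_{m+μ} / c^j_m`, in terms of `x = j - m` and `y = j + m`. -/
def rowCoeff (x y : ℝ) : SignType → SignType → ℝ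
  | .neg, .neg => √2 / ((x + y) * (x + y + 1))
  | .neg, .zero => -2 / ((x + y) * (x + y + 1))
  | .neg, .pos => √2 / ((x + y) * (x + y + 1))
  | .zero, .neg => √2 * (2 * (x + 1)) / ((x + y) * (x + y + 2))
  | .zero, .zero => 2 * (y - x) / ((x + y) * (x + y + 2))
  | .zero, .pos => -√2 * (2 * (y + 1)) / ((x + y) * (x + y + 2))
  | .pos, .neg => √2 * ((x + 1) * (x + 2)) / ((x + y + 1) * (x + y + 2))
  | .pos, .zero => 2 * (x + 1) * (y + 1) / ((x + y + 1) * (x + y + 2))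
  | .pos, .pos => √2 * ((y + 1) * (y + 2)) / ((x + y + 1) * (x + y + 2))

/-- The product of `q_{j₀,ε}` and the ratio of the norms `c^j_m / c^{j+j₀}_{m+ε}`, in terms of
`p = j - m` and `q = j + m`. -/
def colCoeff (p q : ℝ) : SignType → ℤˣ → ℝ
  | .neg, ε => if ε = -1 then q * (q - 1) else p * (p - 1)
  | .zero, ε => if ε = -1 then q else p
  | .pos, _ => 1

/-- The common shape of the nine identities in `clebschGordan_mul_coeffC_mul_cNorm`: an equation
between products of square roots, from the equation between the squares. -/
theorem sqrt_mul_inv_sqrt_mul_sqrt {a u v e f c r : ℝ} (ha : 0 ≤ a) (hu : 0 < u) (hv : 0 < v)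
    (hc : 0 ≤ c) (hf : 0 ≤ f) (hr : 0 ≤ r) (h : a * e = c * r ^ 2 * f * (u * v)) :
    √a * ((√u)⁻¹ * (√v)⁻¹) * √e = √c * r * √f := by
  have h1 : √a * √e = √c * r * √f * (√u * √v) := by
    rw [← Real.sqrt_mul ha, h, Real.sqrt_mul (by positivity), Real.sqrt_mul (by positivity),
      Real.sqrt_mul hc, Real.sqrt_sq hr, Real.sqrt_mul hu.le]
  have hu' := (Real.sqrt_pos.2 hu).ne'
  have hv' := (Real.sqrt_pos.2 hv).ne'
  field_simp
  linear_combination h1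

theorem clebschGordan_mul_coeffC_mul_cNorm {j m : ℝ} {x y : ℕ} (hx : j - m = x) (hy : j + m = y)
    (j₀ μ : SignType) (hx' : 0 ≤ (x + j₀ - μ : ℤ)) (hy' : 0 ≤ (y + j₀ + μ : ℤ)) :
    clebschGordan j m j₀ μ * coeffC j j₀ * cNorm (j + j₀) (m + μ) =
      rowCoeff x y j₀ μ * cNorm j m := by
  have hj : j = (x + y) / 2 := by linarith
  have hm : m = (y - x) / 2 := by linarith
  rcases j₀ with _ | _ | _ <;> rcases μ with _ | _ | _ <;>
    simp only [SignType.zero_eq_zero, SignType.neg_eq_neg_one, SignType.pos_eq_one,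
      SignType.coe_zero, SignType.coe_neg_one, SignType.coe_one] at hx' hy'
  all_goals simp only [clebschGordan, coeffC, rowCoeff, SignType.zero_eq_zero,
      SignType.neg_eq_neg_one, SignType.pos_eq_one, SignType.coe_zero, SignType.coe_neg_one,
      SignType.coe_one, hx, hy]
  · -- `j₀ = 0`, `μ = 0`
    rw [add_zero, add_zero]
    rcases Nat.eq_zero_or_pos (x + y) with h | h
    · obtain ⟨rfl, rfl⟩ : x = 0 ∧ y = 0 := by omega
      simp [hm]
    · have h' : (0 : ℝ) < x + y := by exact_mod_cast h
      rw [hj, Real.sqrt_mul (by positivity)]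
      have e1 := Real.mul_self_sqrt (show (0 : ℝ) ≤ (x + y) / 2 by positivity)
      have e2 := Real.mul_self_sqrt (show (0 : ℝ) ≤ (x + y) / 2 + 1 by positivity)
      have e3 := (Real.sqrt_pos.2 (show (0 : ℝ) < (x + y) / 2 by positivity)).ne'
      have e4 := (Real.sqrt_pos.2 (show (0 : ℝ) < (x + y) / 2 + 1 by positivity)).ne'
      rw [hm]
      generalize √(((x : ℝ) + y) / 2) = s at *
      generalize √(((x : ℝ) + y) / 2 + 1) = t at *
      have e5 : (x + y : ℝ) = 2 * (s * s) := by linarith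
      have e6 : (x + y + 2 : ℝ) = 2 * (t * t) := by linarith
      rw [e6, e5]
      field_simp
  · -- `j₀ = 0`, `μ = -1`
    obtain ⟨y, rfl⟩ : ∃ w, y = w + 1 := ⟨y - 1, by omega⟩
    rw [cNorm_eq hx hy, cNorm_eq (x := x + 1) (y := y) (by push_cast at hx hy ⊢; linarith)
      (by push_cast at hx hy ⊢; linarith), hj]
    have key := sqrt_mul_inv_sqrt_mul_sqrt
      (a := (y + 1) * (x + 1) / (2 * (((x : ℝ) + (y + 1)) / 2) * ((x + (y + 1)) / 2 + 1)))
      (u := ((x : ℝ) + (y + 1)) / 2) (v := ((x : ℝ) + (y + 1)) / 2 + 1) (c := 2)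
      (r := 2 * ((x : ℝ) + 1) / ((x + y + 1) * (x + y + 3)))
      (e := (y.factorial : ℝ) * (x + 1).factorial) (f := ((y + 1).factorial : ℝ) * x.factorial)
      (by positivity) (by positivity) (by positivity) (by positivity) (by positivity)
      (by positivity) (by simp only [Nat.factorial_succ]; push_cast; field_simp; ring)
    convert key using 1
    · push_cast
      congr 4
    · push_cast
      ring
  · -- `j₀ = 0`, `μ = 1`
    obtain ⟨x, rfl⟩ : ∃ w, x = w + 1 := ⟨x - 1, by omega⟩
    rw [cNorm_eq hx hy, cNorm_eq (x := x) (y := y + 1) (by push_cast at hx hy ⊢; linarith)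
      (by push_cast at hx hy ⊢; linarith), hj]
    have key := sqrt_mul_inv_sqrt_mul_sqrt
      (a := (x + 1) * (y + 1) / (2 * (((x : ℝ) + 1 + y) / 2) * ((x + 1 + y) / 2 + 1)))
      (u := ((x : ℝ) + 1 + y) / 2) (v := ((x : ℝ) + 1 + y) / 2 + 1) (c := 2)
      (r := 2 * ((y : ℝ) + 1) / ((x + y + 1) * (x + y + 3)))
      (e := ((y + 1).factorial : ℝ) * x.factorial) (f := (y.factorial : ℝ) * (x + 1).factorial)
      (by positivity) (by positivity) (by positivity) (by positivity) (by positivity)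
      (by positivity) (by simp only [Nat.factorial_succ]; push_cast; field_simp; ring)
    convert congrArg Neg.neg key using 1
    · push_cast
      simp only [neg_mul]
    · push_cast
      ring
  · -- `j₀ = -1`, `μ = 0`
    obtain ⟨x, rfl⟩ : ∃ w, x = w + 1 := ⟨x - 1, by omega⟩
    obtain ⟨y, rfl⟩ : ∃ w, y = w + 1 := ⟨y - 1, by omega⟩
    rw [cNorm_eq hx hy, cNorm_eq (x := x) (y := y) (by push_cast at hx hy ⊢; linarith)
      (by push_cast at hx hy ⊢; linarith), hj]
    have key := sqrt_mul_inv_sqrt_mul_sqrt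
      (a := (x + 1) * (y + 1) / (((x : ℝ) + 1 + (y + 1)) / 2 * (2 * ((x + 1 + (y + 1)) / 2) + 1)))
      (u := ((x : ℝ) + 1 + (y + 1)) / 2) (v := 2 * (((x : ℝ) + 1 + (y + 1)) / 2) + 1) (c := 1)
      (r := 2 / (((x : ℝ) + y + 2) * (x + y + 3)))
      (e := (y.factorial : ℝ) * x.factorial) (f := ((y + 1).factorial : ℝ) * (x + 1).factorial)
      (by positivity) (by positivity) (by positivity) (by positivity) (by positivity)
      (by positivity) (by simp only [Nat.factorial_succ]; push_cast; field_simp; ring)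
    convert congrArg Neg.neg key using 1
    · push_cast
      simp only [neg_mul]
    · push_cast
      ring
  · -- `j₀ = -1`, `μ = -1`
    obtain ⟨y, rfl⟩ : ∃ w, y = w + 2 := ⟨y - 2, by omega⟩
    rw [cNorm_eq hx hy, cNorm_eq (x := x) (y := y) (by push_cast at hx hy ⊢; linarith)
      (by push_cast at hx hy ⊢; linarith), hj]
    have key := sqrt_mul_inv_sqrt_mul_sqrt
      (a := (y + 2) * (y + 1) / (2 * (((x : ℝ) + (y + 2)) / 2) * (2 * ((x + (y + 2)) / 2) + 1)))
      (u := ((x : ℝ) + (y + 2)) / 2) (v := 2 * (((x : ℝ) + (y + 2)) / 2) + 1) (c := 2)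
      (r := 1 / (((x : ℝ) + y + 2) * (x + y + 3)))
      (e := (y.factorial : ℝ) * x.factorial) (f := ((y + 2).factorial : ℝ) * x.factorial)
      (by positivity) (by positivity) (by positivity) (by positivity) (by positivity)
      (by positivity) (by simp only [Nat.factorial_succ]; push_cast; field_simp; ring)
    convert key using 1
    · push_cast
      congr 4
      ring
    · push_cast
      ring
  · -- `j₀ = -1`, `μ = 1`
    obtain ⟨x, rfl⟩ : ∃ w, x = w + 2 := ⟨x - 2, by omega⟩
    rw [cNorm_eq hx hy, cNorm_eq (x := x) (y := y) (by push_cast at hx hy ⊢; linarith)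
      (by push_cast at hx hy ⊢; linarith), hj]
    have key := sqrt_mul_inv_sqrt_mul_sqrt
      (a := (x + 2) * (x + 1) / (2 * (((x : ℝ) + 2 + y) / 2) * (2 * ((x + 2 + y) / 2) + 1)))
      (u := ((x : ℝ) + 2 + y) / 2) (v := 2 * (((x : ℝ) + 2 + y) / 2) + 1) (c := 2)
      (r := 1 / (((x : ℝ) + y + 2) * (x + y + 3)))
      (e := (y.factorial : ℝ) * x.factorial) (f := (y.factorial : ℝ) * (x + 2).factorial)
      (by positivity) (by positivity) (by positivity) (by positivity) (by positivity)
      (by positivity) (by simp only [Nat.factorial_succ]; push_cast; field_simp; ring)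
    convert key using 1
    · push_cast
      congr 4
      ring
    · push_cast
      ring
  · -- `j₀ = 1`, `μ = 0`
    rw [cNorm_eq hx hy, cNorm_eq (x := x + 1) (y := y + 1) (by push_cast at hx hy ⊢; linarith)
      (by push_cast at hx hy ⊢; linarith), hj]
    have key := sqrt_mul_inv_sqrt_mul_sqrt
      (a := (x + 1) * (y + 1) / ((((x : ℝ) + y) / 2 + 1) * (2 * ((x + y) / 2) + 1)))
      (u := ((x : ℝ) + y) / 2 + 1) (v := 2 * (((x : ℝ) + y) / 2) + 1) (c := 1)
      (r := 2 * ((x : ℝ) + 1) * (y + 1) / ((x + y + 1) * (x + y + 2)))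
      (e := ((y + 1).factorial : ℝ) * (x + 1).factorial) (f := (y.factorial : ℝ) * x.factorial)
      (by positivity) (by positivity) (by positivity) (by positivity) (by positivity)
      (by positivity) (by simp only [Nat.factorial_succ]; push_cast; field_simp)
    convert key using 1
    ring
  · -- `j₀ = 1`, `μ = -1`
    rw [cNorm_eq hx hy, cNorm_eq (x := x + 2) (y := y) (by push_cast at hx hy ⊢; linarith)
      (by linarith), hj]
    have key := sqrt_mul_inv_sqrt_mul_sqrt
      (a := (x + 1) * (x + 2) / ((2 * (((x : ℝ) + y) / 2) + 2) * (2 * ((x + y) / 2) + 1)))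
      (u := ((x : ℝ) + y) / 2 + 1) (v := 2 * (((x : ℝ) + y) / 2) + 1) (c := 2)
      (r := ((x : ℝ) + 1) * (x + 2) / ((x + y + 1) * (x + y + 2)))
      (e := (y.factorial : ℝ) * (x + 2).factorial) (f := (y.factorial : ℝ) * x.factorial)
      (by positivity) (by positivity) (by positivity) (by positivity) (by positivity)
      (by positivity) (by simp only [Nat.factorial_succ]; push_cast; field_simp; ring)
    convert key using 1
    ring
  · -- `j₀ = 1`, `μ = 1`
    rw [cNorm_eq hx hy, cNorm_eq (x := x) (y := y + 2) (by linarith)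
      (by push_cast at hx hy ⊢; linarith), hj]
    have key := sqrt_mul_inv_sqrt_mul_sqrt
      (a := (y + 1) * (y + 2) / ((2 * (((x : ℝ) + y) / 2) + 2) * (2 * ((x + y) / 2) + 1)))
      (u := ((x : ℝ) + y) / 2 + 1) (v := 2 * (((x : ℝ) + y) / 2) + 1) (c := 2)
      (r := ((y : ℝ) + 1) * (y + 2) / ((x + y + 1) * (x + y + 2)))
      (e := ((y + 2).factorial : ℝ) * x.factorial) (f := (y.factorial : ℝ) * x.factorial)
      (by positivity) (by positivity) (by positivity) (by positivity) (by positivity)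
      (by positivity) (by simp only [Nat.factorial_succ]; push_cast; field_simp; ring)
    convert key using 1
    ring

theorem coeffq_div_cNorm {j m : ℝ} {p q : ℕ} (hp : j - m = p) (hq : j + m = q)
    (j₀ : SignType) (ε : ℤˣ) (hp' : 0 ≤ (p + j₀ - ε : ℤ)) (hq' : 0 ≤ (q + j₀ + ε : ℤ)) :
    coeffq j m j₀ ε / cNorm (j + j₀) (m + (ε : ℤ)) = colCoeff p q j₀ ε / cNorm j m := by
  have aux : ∀ {a f e c : ℝ}, 0 < e → 0 < f → 0 ≤ a → 0 ≤ c → a * f = c ^ 2 * e →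
      √a / √e = c / √f := by
    intro a f e c he hf ha hc h
    rw [div_eq_div_iff (Real.sqrt_pos.2 he).ne' (Real.sqrt_pos.2 hf).ne', ← Real.sqrt_mul ha, h,
      Real.sqrt_mul (by positivity), Real.sqrt_sq hc]
  have hneg : (-1 : ℤˣ) ≠ 1 := by decide
  rcases j₀ with _ | _ | _ <;> rcases Int.units_eq_one_or ε with rfl | rfl <;>
    simp only [SignType.zero_eq_zero, SignType.neg_eq_neg_one, SignType.pos_eq_one,
      SignType.coe_zero, SignType.coe_neg_one, SignType.coe_one, Units.val_one, Units.val_neg]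
      at hp' hq'
  all_goals simp only [coeffq, colCoeff, SignType.zero_eq_zero, SignType.neg_eq_neg_one,
    SignType.pos_eq_one, SignType.coe_zero, SignType.coe_neg_one, SignType.coe_one, hp, hq,
    Units.val_one, Units.val_neg, hneg.symm, if_true, if_false]
  · -- `j₀ = 0`, `ε = 1`
    obtain ⟨p, rfl⟩ : ∃ w, p = w + 1 := ⟨p - 1, by omega⟩
    rw [cNorm_eq hp hq, cNorm_eq (x := p) (y := q + 1) (by push_cast at hp hq ⊢; linarith)
      (by push_cast at hp hq ⊢; linarith)]
    refine aux (by positivity) (by positivity) (by positivity) (by positivity) ?_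
    simp only [Nat.factorial_succ]
    push_cast
    ring
  · -- `j₀ = 0`, `ε = -1`
    obtain ⟨q, rfl⟩ : ∃ w, q = w + 1 := ⟨q - 1, by omega⟩
    rw [cNorm_eq hp hq, cNorm_eq (x := p + 1) (y := q) (by push_cast at hp hq ⊢; linarith)
      (by push_cast at hp hq ⊢; linarith)]
    refine aux (by positivity) (by positivity) (by positivity) (by positivity) ?_
    simp only [Nat.factorial_succ]
    push_cast
    ring
  · -- `j₀ = -1`, `ε = 1`
    obtain ⟨p, rfl⟩ : ∃ w, p = w + 2 := ⟨p - 2, by omega⟩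
    have e1 : j - m - 1 = p + 1 := by rw [hp]; push_cast; ring
    have e2 : ((p + 2 : ℕ) : ℝ) * ((p + 2 : ℕ) - 1) = (p + 2) * (p + 1) := by push_cast; ring
    rw [cNorm_eq hp hq, cNorm_eq (x := p) (y := q) (by push_cast at hp hq ⊢; linarith)
      (by push_cast at hp hq ⊢; linarith), e2, ← hp, e1, hp]
    refine aux (by positivity) (by positivity) (by positivity) (by positivity) ?_
    simp only [Nat.factorial_succ]
    push_cast
    ring
  · -- `j₀ = -1`, `ε = -1`
    obtain ⟨q, rfl⟩ : ∃ w, q = w + 2 := ⟨q - 2, by omega⟩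
    have e1 : j + m - 1 = q + 1 := by rw [hq]; push_cast; ring
    have e2 : ((q + 2 : ℕ) : ℝ) * ((q + 2 : ℕ) - 1) = (q + 2) * (q + 1) := by push_cast; ring
    rw [cNorm_eq hp hq, cNorm_eq (x := p) (y := q) (by push_cast at hp hq ⊢; linarith)
      (by push_cast at hp hq ⊢; linarith), e2, ← hq, e1, hq]
    refine aux (by positivity) (by positivity) (by positivity) (by positivity) ?_
    simp only [Nat.factorial_succ]
    push_cast
    ring
  · -- `j₀ = 1`, `ε = 1`
    rw [cNorm_eq hp hq, cNorm_eq (x := p) (y := q + 2) (by push_cast at hp hq ⊢; linarith)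
      (by push_cast at hp hq ⊢; linarith)]
    refine aux (by positivity) (by positivity) (by positivity) (by positivity) ?_
    simp only [Nat.factorial_succ]
    push_cast
    ring
  · -- `j₀ = 1`, `ε = -1`
    rw [cNorm_eq hp hq, cNorm_eq (x := p + 2) (y := q) (by push_cast at hp hq ⊢; linarith)
      (by push_cast at hp hq ⊢; linarith)]
    refine aux (by positivity) (by positivity) (by positivity) (by positivity) ?_
    simp only [Nat.factorial_succ]
    push_cast
    ring

/-- Each summand of the formula for `dl (u_β) f`, freed of square roots other than the common ratio
of norms and the `√2` in the normalization of `u_β`. -/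
theorem coeff_mul_W {j n m₁ m₂ : ℝ} {p q x y : ℕ} {l : ℤ} (hp : j - m₂ = p) (hq : j + m₂ = q)
    (hx : j - m₁ = x) (hy : j + m₁ = y) (hl : j + n = l) (k : K) (s : ℤ) (j₀ μ : SignType)
    (ε : ℤˣ) :
    (clebschGordan j m₁ j₀ μ : ℂ) * (coeffC j j₀ : ℂ) * (coeffq j m₂ j₀ ε : ℂ) *
        W (j + j₀) (n + s) (m₁ + μ) (m₂ + (ε : ℤ)) k =
      (cNorm j m₁ : ℂ) / cNorm j m₂ * ((rowCoeff x y j₀ μ : ℂ) * (colCoeff p q j₀ ε : ℂ) *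
        ((cMat k.1.1).det ^ (-(l + j₀ + s)) *
          wCoeff (cMat k.1.1) (p + j₀ - ε) (q + j₀ + ε) (y + j₀ + μ))) := by
  have hsum : (p + q : ℤ) = x + y := by
    have : (p + q : ℝ) = x + y := by rw [← hp, ← hq, ← hx, ← hy]; ring
    exact_mod_cast this
  rw [W_eq_wCoeff (p := p + j₀ - ε) (q := q + j₀ + ε) (x := x + j₀ - μ) (y := y + j₀ + μ)
    (l := l + j₀ + s)]
  rotate_left
  · push_cast [SignType.intCast_cast]
    linarith
  · push_cast [SignType.intCast_cast]
    linarith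
  · push_cast [SignType.intCast_cast]
    linarith
  · push_cast [SignType.intCast_cast]
    linarith
  · push_cast [SignType.intCast_cast]
    linarith
  by_cases h : 0 ≤ (p + j₀ - ε : ℤ) ∧ 0 ≤ (q + j₀ + ε : ℤ) ∧ 0 ≤ (x + j₀ - μ : ℤ) ∧
      0 ≤ (y + j₀ + μ : ℤ)
  · obtain ⟨h1, h2, h3, h4⟩ := h
    have e1 := clebschGordan_mul_coeffC_mul_cNorm hx hy j₀ μ h3 h4
    have e2 := coeffq_div_cNorm hp hq j₀ ε h1 h2
    have e3 : (clebschGordan j m₁ j₀ μ : ℂ) * coeffC j j₀ * cNorm (j + j₀) (m₁ + μ) =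
        rowCoeff x y j₀ μ * cNorm j m₁ := by exact_mod_cast e1
    have e4 : (coeffq j m₂ j₀ ε : ℂ) / cNorm (j + j₀) (m₂ + (ε : ℤ)) =
        colCoeff p q j₀ ε / cNorm j m₂ := by exact_mod_cast e2
    generalize (cMat k.1.1).det ^ (-(l + j₀ + s)) *
      wCoeff (cMat k.1.1) (p + j₀ - ε) (q + j₀ + ε) (y + j₀ + μ) = E
    have e5 := congrArg₂ (· * ·) e3 e4
    linear_combination E * e5
  · have : wCoeff (cMat k.1.1) (p + j₀ - ε) (q + j₀ + ε) (y + j₀ + μ) = 0 := by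
      by_cases h1 : (p + j₀ - ε : ℤ) < 0
      · exact wCoeff_of_neg_left _ _ _ h1
      by_cases h2 : (q + j₀ + ε : ℤ) < 0
      · exact wCoeff_of_neg_right _ _ _ h2
      by_cases h3 : (y + j₀ + μ : ℤ) < 0
      · exact wCoeff_of_index_neg _ _ _ h3
      · exact wCoeff_of_degree_lt _ (by omega)
    simp [this]

/-! ### Gram–Schmidt orthogonalization -/

/-- The squared norm of the first column. -/
def gsR (c : Matrix (Fin 2) (Fin 2) ℂ) : ℝ := Complex.normSq (c 0 0) + Complex.normSq (c 1 0)

/-- The real part of the inner product of the two columns. For `c = cMat g` with `g ∈ G` the inner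
product is real. -/
def gsX (c : Matrix (Fin 2) (Fin 2) ℂ) : ℝ :=
  (starRingEnd ℂ (c 0 0) * c 0 1 + starRingEnd ℂ (c 1 0) * c 1 1).re

/-- The logarithm of the norm of the first column: the first coordinate of the `A`-component. -/
def gsT₁ (c : Matrix (Fin 2) (Fin 2) ℂ) : ℝ := Real.log (gsR c) / 2

/-- The logarithm of the distance of the second column from the line of the first one: the second
coordinate of the `A`-component. -/
def gsT₂ (c : Matrix (Fin 2) (Fin 2) ℂ) : ℝ :=
  (Real.log (Complex.normSq c.det) - Real.log (gsR c)) / 2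

/-- The matrix with the orthonormalized columns: the `K`-component. -/
def gsU (c : Matrix (Fin 2) (Fin 2) ℂ) : Matrix (Fin 2) (Fin 2) ℂ :=
  Matrix.of fun a => ![(Real.exp (-gsT₁ c) : ℂ) * c a 0,
    (Real.exp (-gsT₂ c) : ℂ) * (c a 1 - (gsX c / gsR c : ℝ) * c a 0)]

theorem gsU_zero (c : Matrix (Fin 2) (Fin 2) ℂ) (a : Fin 2) :
    gsU c a 0 = (Real.exp (-gsT₁ c) : ℂ) * c a 0 := rfl

theorem gsU_one (c : Matrix (Fin 2) (Fin 2) ℂ) (a : Fin 2) :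
    gsU c a 1 = (Real.exp (-gsT₂ c) : ℂ) * (c a 1 - (gsX c / gsR c : ℝ) * c a 0) := rfl

theorem gsR_pos {c : Matrix (Fin 2) (Fin 2) ℂ} (hc : c.det ≠ 0) : 0 < gsR c := by
  unfold gsR
  have h0 := Complex.normSq_nonneg (c 0 0)
  have h1 := Complex.normSq_nonneg (c 1 0)
  rcases h0.eq_or_lt with e0 | e0
  · rcases h1.eq_or_lt with e1 | e1
    · refine absurd ?_ hc
      rw [det_fin_two, Complex.normSq_eq_zero.1 e0.symm, Complex.normSq_eq_zero.1 e1.symm]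
      ring
    · linarith
  · linarith

theorem det_gsU (c : Matrix (Fin 2) (Fin 2) ℂ) :
    (gsU c).det = (Real.exp (-gsT₁ c) : ℂ) * (Real.exp (-gsT₂ c) : ℂ) * c.det := by
  rw [det_fin_two, det_fin_two, gsU_zero, gsU_zero, gsU_one, gsU_one]
  ring

theorem det_gsU_ne_zero {c : Matrix (Fin 2) (Fin 2) ℂ} (hc : c.det ≠ 0) : (gsU c).det ≠ 0 := by
  rw [det_gsU]
  refine mul_ne_zero (mul_ne_zero ?_ ?_) hc <;> exact_mod_cast (Real.exp_pos _).ne'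

/-- The effect of Gram–Schmidt on `c * R` with `R` real upper triangular, the diagonal entries of
`R` being written as sign times exponential. -/
theorem gs_mul_upper {c : Matrix (Fin 2) (Fin 2) ℂ} (hc : c.det ≠ 0) {ε₁ ε₂ : ℝ}
    (h₁ : ε₁ * ε₁ = 1) (h₂ : ε₂ * ε₂ = 1) (s₁ s₂ w : ℝ) {c' : Matrix (Fin 2) (Fin 2) ℂ}
    (h : c' = c * !![((ε₁ * Real.exp s₁ : ℝ) : ℂ), (w : ℂ); 0, ((ε₂ * Real.exp s₂ : ℝ) : ℂ)]) :
    gsT₁ c' = gsT₁ c + s₁ ∧ gsT₂ c' = gsT₂ c + s₂ ∧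
      gsU c' = gsU c * diagonal ![(ε₁ : ℂ), (ε₂ : ℂ)] := by
  have hr := gsR_pos hc
  have hd : 0 < Complex.normSq c.det := Complex.normSq_pos.2 hc
  have hcol0 : ∀ a, c' a 0 = ((ε₁ * Real.exp s₁ : ℝ) : ℂ) * c a 0 := by
    intro a
    simp [h, mul_apply, Fin.sum_univ_two, mul_comm]
  have hcol1 : ∀ a, c' a 1 = (w : ℂ) * c a 0 + ((ε₂ * Real.exp s₂ : ℝ) : ℂ) * c a 1 := by
    intro a
    simp [h, mul_apply, Fin.sum_univ_two, mul_comm]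
  have hR : gsR c' = Real.exp s₁ ^ 2 * gsR c := by
    simp only [gsR, hcol0, Complex.normSq_mul, Complex.normSq_ofReal]
    linear_combination (Real.exp s₁ ^ 2 * (Complex.normSq (c 0 0) + Complex.normSq (c 1 0))) * h₁
  have hX : gsX c' = ε₁ * Real.exp s₁ * (w * gsR c + ε₂ * Real.exp s₂ * gsX c) := by
    simp only [gsX, gsR, hcol0, hcol1, Complex.normSq_apply]
    simp [-Complex.ofReal_exp]
    ring
  have hD : Complex.normSq c'.det = Real.exp s₁ ^ 2 * Real.exp s₂ ^ 2 * Complex.normSq c.det := by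
    have : c'.det = ((ε₁ * Real.exp s₁ * (ε₂ * Real.exp s₂) : ℝ) : ℂ) * c.det := by
      rw [det_fin_two, det_fin_two, hcol0, hcol0, hcol1, hcol1]
      push_cast
      ring
    rw [this, Complex.normSq_mul, Complex.normSq_ofReal]
    linear_combination (Real.exp s₁ ^ 2 * Real.exp s₂ ^ 2 * Complex.normSq c.det) *
      (ε₂ * ε₂ * h₁ + h₂)
  have hT₁ : gsT₁ c' = gsT₁ c + s₁ := by
    unfold gsT₁
    rw [hR, Real.log_mul (by positivity) hr.ne', Real.log_pow, Real.log_exp]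
    push_cast
    ring
  have hT₂ : gsT₂ c' = gsT₂ c + s₂ := by
    unfold gsT₂
    rw [hR, hD, Real.log_mul (by positivity) hd.ne', Real.log_mul (by positivity) (by positivity),
      Real.log_mul (by positivity) hr.ne', Real.log_pow, Real.log_exp, Real.log_pow, Real.log_exp]
    push_cast
    ring
  refine ⟨hT₁, hT₂, ?_⟩
  have e₁ : (Real.exp (-(gsT₁ c + s₁)) : ℂ) * Real.exp s₁ = Real.exp (-gsT₁ c) := by
    rw [← Complex.ofReal_mul, ← Real.exp_add]
    congr 2
    ring
  have e₂ : (Real.exp (-(gsT₂ c + s₂)) : ℂ) * Real.exp s₂ = Real.exp (-gsT₂ c) := by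
    rw [← Complex.ofReal_mul, ← Real.exp_add]
    congr 2
    ring
  have hq : gsX c' / gsR c' * (ε₁ * Real.exp s₁) = w + ε₂ * Real.exp s₂ * (gsX c / gsR c) := by
    rw [hX, hR]
    have := (Real.exp_pos s₁).ne'
    field_simp
    linear_combination (w * gsR c + ε₂ * Real.exp s₂ * gsX c) * h₁
  have hq' : ((gsX c' / gsR c' : ℝ) : ℂ) * (ε₁ * Real.exp s₁) =
      w + ε₂ * Real.exp s₂ * (gsX c / gsR c : ℝ) := by exact_mod_cast hq
  ext a b
  rw [mul_diagonal]
  fin_cases b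
  · change gsU c' a 0 = gsU c a 0 * ε₁
    rw [gsU_zero, gsU_zero, hcol0, hT₁, ← e₁]
    push_cast
    ring
  · change gsU c' a 1 = gsU c a 1 * ε₂
    rw [gsU_one, gsU_one, hcol0, hcol1, hT₂, ← e₂]
    push_cast at hq' ⊢
    linear_combination (-(Complex.exp (-(gsT₂ c + s₂))) * c a 0) * hq'

theorem gs_of_unitary {c : Matrix (Fin 2) (Fin 2) ℂ} (hc : cᴴ * c = 1) :
    gsR c = 1 ∧ gsX c = 0 ∧ Complex.normSq c.det = 1 ∧ gsT₁ c = 0 ∧ gsT₂ c = 0 ∧ gsU c = c := by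
  have h00 := congrFun (congrFun hc 0) 0
  have h01 := congrFun (congrFun hc 0) 1
  simp only [mul_apply, Fin.sum_univ_two, conjTranspose_apply, one_apply_eq] at h00 h01
  have hR : gsR c = 1 := by
    have := congrArg Complex.re h00
    simp at this
    simp only [gsR, Complex.normSq_apply]
    linarith
  have hX : gsX c = 0 := by
    have := congrArg Complex.re h01
    simpa [gsX] using this
  have hD : Complex.normSq c.det = 1 := by
    have := det_mul_conj_det_of_unitary hc
    rw [Complex.mul_conj] at this
    exact_mod_cast this
  have hT₁ : gsT₁ c = 0 := by simp [gsT₁, hR]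
  have hT₂ : gsT₂ c = 0 := by simp [gsT₂, hR, hD]
  refine ⟨hR, hX, hD, hT₁, hT₂, ?_⟩
  ext a b
  fin_cases b
  · simp [gsU, hT₁]
  · simp [gsU, hT₂, hX]

/-! ### Complex frames of elements of `G` -/

/-- Right multiplication by an element of the Siegel parabolic changes the real basis of the frame. -/
theorem cMat_mul_of_block_zero (g h : Matrix (Fin 2 ⊕ Fin 2) (Fin 2 ⊕ Fin 2) ℝ)
    (hh : h.toBlocks₂₁ = 0) : cMat (g * h) = cMat g * h.toBlocks₁₁.map Complex.ofReal := by
  have hz : ∀ a b, h (.inr a) (.inl b) = 0 := fun a b => congrFun (congrFun hh a) b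
  ext a b
  simp [cMat, mul_apply, Fintype.sum_sum_type, Fin.sum_univ_two, hz, toBlocks₁₁]
  ring

/-- Left multiplication by `k ∈ K` acts on frames as left multiplication by the unitary matrix of
`k`. -/
theorem cMat_K_mul (k : K) (g : Matrix (Fin 2 ⊕ Fin 2) (Fin 2 ⊕ Fin 2) ℝ) :
    cMat (k.1.1 * g) = cMat k.1.1 * cMat g := by
  ext a b
  simp [cMat, mul_apply, Fintype.sum_sum_type, Fin.sum_univ_two, K_inr_inl, K_inr_inr]
  linear_combination ((k.1.1 (.inl a) (.inr 0) * g (.inr 0) (.inl b) : ℂ) +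
    k.1.1 (.inl a) (.inr 1) * g (.inr 1) (.inl b)) * Complex.I_sq

theorem cMat_injOn_blocks {g : Matrix (Fin 2 ⊕ Fin 2) (Fin 2 ⊕ Fin 2) ℝ}
    {T : Matrix (Fin 2) (Fin 2) ℝ} (h : cMat g = T.map Complex.ofReal) :
    g.toBlocks₁₁ = T ∧ g.toBlocks₂₁ = 0 := by
  constructor <;> ext a b
  · have := congrArg Complex.re (congrFun (congrFun h a) b)
    simpa [cMat, toBlocks₁₁] using this
  · have := congrArg Complex.im (congrFun (congrFun h a) b)
    simpa [cMat, toBlocks₂₁] using this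

/-- The columns of the frame of an element of `G` span a Lagrangian subspace. -/
theorem G_lagrangian (g : G) :
    (starRingEnd ℂ (cMat g.1 0 0) * cMat g.1 0 1 +
      starRingEnd ℂ (cMat g.1 1 0) * cMat g.1 1 1).im = 0 := by
  have h := congrFun (congrFun (SymplecticGroup.mem_iff'.1 g.2) (.inl 0)) (.inl 1)
  simp [mul_apply, Fintype.sum_sum_type, Fin.sum_univ_two, J] at h
  simp [cMat]
  linarith

/-- The Gram determinant of the two columns. -/
theorem normSq_det_eq (c : Matrix (Fin 2) (Fin 2) ℂ) :
    Complex.normSq c.det = gsR c * (Complex.normSq (c 0 1) + Complex.normSq (c 1 1)) -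
      Complex.normSq (starRingEnd ℂ (c 0 0) * c 0 1 + starRingEnd ℂ (c 1 0) * c 1 1) := by
  rw [det_fin_two, gsR]
  simp only [Complex.normSq_apply]
  simp
  ring

theorem cMat_G_columns_independent (g : G) {v w : ℝ}
    (h : ∀ a, (v : ℂ) * cMat g.1 a 0 + (w : ℂ) * cMat g.1 a 1 = 0) : v = 0 ∧ w = 0 := by
  have hdet : g.1.det ≠ 0 := (SymplecticGroup.symplectic_det g.2).ne_zero
  have hz : g.1 *ᵥ Sum.elim ![v, w] 0 = 0 := by
    ext (a | a)
    · have := congrArg Complex.re (h a)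
      simp [cMat] at this
      simp [mulVec, dotProduct, Fintype.sum_sum_type, Fin.sum_univ_two]
      linarith
    · have := congrArg Complex.im (h a)
      simp [cMat] at this
      simp [mulVec, dotProduct, Fintype.sum_sum_type, Fin.sum_univ_two]
      linarith
  have h0 := Matrix.eq_zero_of_mulVec_eq_zero hdet hz
  exact ⟨congrFun h0 (.inl 0), congrFun h0 (.inl 1)⟩

/-- If `det (A - iC) = 0`, the Gram determinant of the first two columns of `g` vanishes, as the
hermitian products of the columns of `A - iC` are the euclidean products of those of `g`. -/
theorem cMat_G_det_ne_zero (g : G) : (cMat g.1).det ≠ 0 := by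
  intro h
  have h1 := normSq_det_eq (cMat g.1)
  have h2 := G_lagrangian g
  rw [h, map_zero, Complex.normSq_apply (_ + _), h2] at h1
  change _ = _ - (gsX (cMat g.1) * gsX (cMat g.1) + 0 * 0) at h1
  have hX : (starRingEnd ℂ (cMat g.1 0 0) * cMat g.1 0 1 +
      starRingEnd ℂ (cMat g.1 1 0) * cMat g.1 1 1).re = gsX (cMat g.1) := rfl
  have hR : gsR (cMat g.1) = Complex.normSq (cMat g.1 0 0) + Complex.normSq (cMat g.1 1 0) := rfl
  generalize gsX (cMat g.1) = X at *
  generalize gsR (cMat g.1) = R at *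
  have key : ∀ a, ((-X : ℝ) : ℂ) * cMat g.1 a 0 + (R : ℂ) * cMat g.1 a 1 = 0 := by
    have hsum : ∑ a, Complex.normSq
        (((-X : ℝ) : ℂ) * cMat g.1 a 0 + (R : ℂ) * cMat g.1 a 1) = 0 := by
      simp only [Complex.normSq_apply, Fin.sum_univ_two] at h1 hR ⊢
      simp at hX ⊢
      linear_combination (-R) * h1 - X ^ 2 * hR - 2 * R * X * hX
    intro a
    exact Complex.normSq_eq_zero.1 ((Finset.sum_eq_zero_iff_of_nonneg
      (fun a _ => Complex.normSq_nonneg _)).1 hsum a (Finset.mem_univ a))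
  obtain ⟨-, rfl⟩ := cMat_G_columns_independent g key
  have e0 := Complex.normSq_nonneg (cMat g.1 0 0)
  have e1 := Complex.normSq_nonneg (cMat g.1 1 0)
  have f0 : cMat g.1 0 0 = 0 := Complex.normSq_eq_zero.1 (by linarith)
  have f1 : cMat g.1 1 0 = 0 := Complex.normSq_eq_zero.1 (by linarith)
  have := cMat_G_columns_independent g (v := 1) (w := 0) (by
    intro a
    fin_cases a <;> simp [f0, f1])
  exact one_ne_zero this.1

/-- Gram–Schmidt with real coefficients orthonormalizes the frame of an element of `G`, as the
hermitian product of its columns is real. -/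
theorem gsU_unitary (g : G) : (gsU (cMat g.1))ᴴ * gsU (cMat g.1) = 1 := by
  have hd := cMat_G_det_ne_zero g
  have hI := G_lagrangian g
  generalize cMat g.1 = c at *
  have hr := gsR_pos hd
  have hD : 0 < Complex.normSq c.det := Complex.normSq_pos.2 hd
  have hN := normSq_det_eq c
  have hX : starRingEnd ℂ (c 0 0) * c 0 1 + starRingEnd ℂ (c 1 0) * c 1 1 = gsX c :=
    Complex.ext rfl hI
  have hX' : starRingEnd ℂ (c 0 1) * c 0 0 + starRingEnd ℂ (c 1 1) * c 1 0 = gsX c := by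
    have := congrArg (starRingEnd ℂ) hX
    simp only [map_add, map_mul, Complex.conj_conj, Complex.conj_ofReal] at this
    linear_combination this
  have hR : starRingEnd ℂ (c 0 0) * c 0 0 + starRingEnd ℂ (c 1 0) * c 1 0 = gsR c := by
    rw [← Complex.normSq_eq_conj_mul_self, ← Complex.normSq_eq_conj_mul_self, gsR]
    push_cast
    rfl
  have hS : starRingEnd ℂ (c 0 1) * c 0 1 + starRingEnd ℂ (c 1 1) * c 1 1 =
      ((Complex.normSq (c 0 1) + Complex.normSq (c 1 1) : ℝ) : ℂ) := by
    rw [← Complex.normSq_eq_conj_mul_self, ← Complex.normSq_eq_conj_mul_self]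
    push_cast
    rfl
  rw [hX, Complex.normSq_ofReal] at hN
  have hE₁ : Real.exp (-gsT₁ c) * Real.exp (-gsT₁ c) * gsR c = 1 := by
    rw [← Real.exp_add, gsT₁, ← neg_add, add_halves, Real.exp_neg, Real.exp_log hr]
    exact inv_mul_cancel₀ hr.ne'
  have hE₂ : Real.exp (-gsT₂ c) * Real.exp (-gsT₂ c) * Complex.normSq c.det = gsR c := by
    rw [← Real.exp_add, gsT₂, ← neg_add, add_halves, neg_sub, Real.exp_sub, Real.exp_log hr,
      Real.exp_log hD]
    exact div_mul_cancel₀ _ hD.ne'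
  have hR0 : (gsR c : ℂ) ≠ 0 := by exact_mod_cast hr.ne'
  have hq : ((gsX c / gsR c : ℝ) : ℂ) * gsR c = gsX c := by
    push_cast
    exact div_mul_cancel₀ _ hR0
  have hE₁' : (Real.exp (-gsT₁ c) : ℂ) * Real.exp (-gsT₁ c) * gsR c = 1 := by exact_mod_cast hE₁
  have hE₂' : (Real.exp (-gsT₂ c) : ℂ) * Real.exp (-gsT₂ c) *
      ((Complex.normSq (c 0 1) + Complex.normSq (c 1 1) : ℝ) -
        ((gsX c / gsR c : ℝ) : ℂ) * gsX c) = 1 := by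
    have : Real.exp (-gsT₂ c) * Real.exp (-gsT₂ c) *
        ((Complex.normSq (c 0 1) + Complex.normSq (c 1 1) : ℝ) - gsX c / gsR c * gsX c) = 1 := by
      rw [hN] at hE₂
      have := hr.ne'
      field_simp
      linear_combination hE₂
    exact_mod_cast this
  obtain ⟨ξ, hξ⟩ : ∃ ξ : ℂ, ((gsX c / gsR c : ℝ) : ℂ) = ξ := ⟨_, rfl⟩
  have hξ' : starRingEnd ℂ ξ = ξ := by rw [← hξ, Complex.conj_ofReal]
  rw [hξ] at hq hE₂'
  ext a b
  simp only [mul_apply, Fin.sum_univ_two, conjTranspose_apply, ← starRingEnd_apply]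
  fin_cases a <;> fin_cases b
  · simp only [Fin.zero_eta, gsU_zero, map_mul, Complex.conj_ofReal, one_apply_eq]
    linear_combination hE₁' + (Real.exp (-gsT₁ c) : ℂ) * Real.exp (-gsT₁ c) * hR
  · simp only [Fin.zero_eta, Fin.mk_one, gsU_zero, gsU_one, map_mul, hξ, Complex.conj_ofReal]
    rw [one_apply_ne (by decide)]
    linear_combination (Real.exp (-gsT₁ c) : ℂ) * Real.exp (-gsT₂ c) * (hX - ξ * hR - hq)
  · simp only [Fin.zero_eta, Fin.mk_one, gsU_zero, gsU_one, map_mul, map_sub, hξ, hξ',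
      Complex.conj_ofReal]
    rw [one_apply_ne (by decide)]
    linear_combination (Real.exp (-gsT₁ c) : ℂ) * Real.exp (-gsT₂ c) * (hX' - ξ * hR - hq)
  · simp only [Fin.mk_one, gsU_one, map_mul, map_sub, hξ, hξ', Complex.conj_ofReal, one_apply_eq]
    linear_combination hE₂' + (Real.exp (-gsT₂ c) : ℂ) * Real.exp (-gsT₂ c) *
      (hS - ξ * hX - ξ * hX' + ξ ^ 2 * hR + ξ * hq)

/-! ### The Iwasawa decomposition -/

theorem fromBlocks_re_im_mem {κ : Matrix (Fin 2) (Fin 2) ℂ} (hκ : κᴴ * κ = 1) :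
    fromBlocks (κ.map Complex.re) (κ.map Complex.im) (-κ.map Complex.im) (κ.map Complex.re) ∈
      symplecticGroup (Fin 2) ℝ ∧
    fromBlocks (κ.map Complex.re) (κ.map Complex.im) (-κ.map Complex.im) (κ.map Complex.re) *
      (fromBlocks (κ.map Complex.re) (κ.map Complex.im) (-κ.map Complex.im)
        (κ.map Complex.re))ᵀ = 1 := by
  have h' : κ * κᴴ = 1 := mul_eq_one_comm.1 hκ
  have k1 : κ.map Complex.re * (κ.map Complex.re)ᵀ +
      κ.map Complex.im * (κ.map Complex.im)ᵀ = 1 := by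
    ext a b
    have h1 := congrArg Complex.re (congrFun (congrFun h' a) b)
    simp [mul_apply, Fin.sum_univ_two, one_apply] at h1 ⊢
    split_ifs at h1 ⊢ <;> simp at h1 <;> linarith
  have k2 : κ.map Complex.im * (κ.map Complex.re)ᵀ -
      κ.map Complex.re * (κ.map Complex.im)ᵀ = 0 := by
    ext a b
    have h2 := congrArg Complex.im (congrFun (congrFun h' a) b)
    simp [mul_apply, Fin.sum_univ_two, one_apply] at h2 ⊢
    split_ifs at h2 <;> simp at h2 <;> linarith
  constructor
  · rw [SymplecticGroup.mem_iff, J, fromBlocks_transpose, fromBlocks_multiply, fromBlocks_multiply]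
    congr 1
    · simp only [mul_zero, mul_one, zero_add, mul_neg, add_zero, neg_mul, ← sub_eq_add_neg]
      exact k2
    · simp only [mul_zero, mul_one, zero_add, mul_neg, add_zero, neg_mul, transpose_neg]
      rw [← k1]
      abel
    · simp only [mul_zero, mul_one, zero_add, mul_neg, add_zero, neg_neg]
      rw [← k1]
    · simp only [mul_zero, mul_one, zero_add, mul_neg, add_zero, neg_neg, transpose_neg]
      rw [← k2]
      abel
  · rw [fromBlocks_transpose, fromBlocks_multiply, ← fromBlocks_one]
    congr 1
    · simp only [mul_neg, transpose_neg]
      rw [← k2]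
      abel
    · simp only [neg_mul]
      rw [← neg_zero, ← k2]
      abel
    · simp only [neg_mul, mul_neg, transpose_neg, neg_neg]
      rw [← k1]
      abel

/-- The element of `K` with complex frame `κ`, for unitary `κ`. -/
def ofUnitary (κ : Matrix (Fin 2) (Fin 2) ℂ) (hκ : κᴴ * κ = 1) : K :=
  ⟨⟨_, (fromBlocks_re_im_mem hκ).1⟩, (fromBlocks_re_im_mem hκ).2⟩

theorem cMat_ofUnitary (κ : Matrix (Fin 2) (Fin 2) ℂ) (hκ : κᴴ * κ = 1) :
    cMat (ofUnitary κ hκ).1.1 = κ := by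
  ext a b
  apply Complex.ext <;> simp [cMat, ofUnitary]

theorem torus_mul (a b a' b' : ℝˣ) : torus a b * torus a' b' = torus (a * a') (b * b') := by
  apply Subtype.ext
  simp only [Submonoid.coe_mul, torus, fromBlocks_multiply, diagonal_mul_diagonal, mul_zero,
    zero_mul, add_zero, zero_add]
  congr 1 <;> · congr 1; ext i; fin_cases i <;> simp [mul_comm]

theorem torus_one : torus 1 1 = 1 := by
  apply Subtype.ext
  simp only [torus]
  rw [OneMemClass.coe_one, ← fromBlocks_one]
  congr 1 <;> · rw [← diagonal_one]; congr 1; ext i; fin_cases i <;> simp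

theorem torus_pow (a b : ℝˣ) (e : ℕ) : torus a b ^ e = torus (a ^ e) (b ^ e) := by
  induction e with
  | zero => simp [torus_one]
  | succ e ih => rw [pow_succ, ih, torus_mul, pow_succ, pow_succ]

/-- The elements of `M`. -/
theorem gamma_pow_mul (e₁ e₂ : ℕ) :
    γα₂ ^ e₁ * γ2α₁α₂ ^ e₂ = torus ((-1) ^ e₂) ((-1) ^ e₁) := by
  rw [γα₂, γ2α₁α₂, torus_pow, torus_pow, torus_mul, one_pow, one_pow, one_mul, mul_one]

theorem expA_mul_expA_neg (t₁ t₂ : ℝ) : expA t₁ t₂ * expA (-t₁) (-t₂) = 1 := by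
  rw [expA, expA, torus_mul, ← torus_one]
  congr 1 <;> · ext; simp [← Real.exp_add]

/-- Right translation by `m a ν` multiplies the complex frame by a real upper triangular matrix. -/
theorem cMat_mul_parabolic (g : G) (e₁ e₂ : ℕ) (t₁ t₂ : ℝ) {ν : G} (hν : ν ∈ N₀) :
    ∃ w : ℝ, cMat (g * (γα₂ ^ e₁ * γ2α₁α₂ ^ e₂) * expA t₁ t₂ * ν).1 = cMat g.1 *
      !![(((-1) ^ e₂ * Real.exp t₁ : ℝ) : ℂ), (w : ℂ); 0,
        (((-1) ^ e₁ * Real.exp t₂ : ℝ) : ℂ)] := by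
  obtain ⟨h21, x, h11⟩ := hν
  refine ⟨(-1) ^ e₂ * Real.exp t₁ * x, ?_⟩
  rw [gamma_pow_mul, expA, mul_assoc g, torus_mul, mul_assoc g]
  set R := torus ((-1) ^ e₂ * Units.mk0 _ (Real.exp_ne_zero t₁))
    ((-1) ^ e₁ * Units.mk0 _ (Real.exp_ne_zero t₂)) * ν with hR
  have e21 : R.1.toBlocks₂₁ = 0 := by
    rw [hR, Submonoid.coe_mul, ← fromBlocks_toBlocks ν.1, h21, torus, fromBlocks_multiply]
    simp
  have e11 : R.1.toBlocks₁₁ = !![(-1) ^ e₂ * Real.exp t₁, (-1) ^ e₂ * Real.exp t₁ * x; 0,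
      (-1) ^ e₁ * Real.exp t₂] := by
    rw [hR, Submonoid.coe_mul, ← fromBlocks_toBlocks ν.1, h11, torus, fromBlocks_multiply]
    ext i j
    fin_cases i <;> fin_cases j <;> simp
  rw [Submonoid.coe_mul, cMat_mul_of_block_zero _ _ e21, e11]
  congr 1
  ext i j
  fin_cases i <;> fin_cases j <;> simp

/-- The frame is its orthonormalization times a real upper triangular matrix. -/
theorem eq_gsU_mul (c : Matrix (Fin 2) (Fin 2) ℂ) :
    c = gsU c * !![(Real.exp (gsT₁ c) : ℂ), (gsX c / gsR c * Real.exp (gsT₁ c) : ℝ); 0,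
      (Real.exp (gsT₂ c) : ℂ)] := by
  have e : ∀ t : ℝ, (Real.exp (-t) : ℂ) * Real.exp t = 1 := by
    intro t
    rw [← Complex.ofReal_mul, ← Real.exp_add, neg_add_cancel, Real.exp_zero, Complex.ofReal_one]
  have e1 := e (gsT₁ c)
  have e2 := e (gsT₂ c)
  ext a b
  rw [mul_apply, Fin.sum_univ_two, gsU_zero, gsU_one]
  generalize (Real.exp (-gsT₁ c) : ℂ) = E₁ at *
  generalize (Real.exp (-gsT₂ c) : ℂ) = E₂ at *
  fin_cases b
  · simp only [of_apply, cons_val', cons_val_zero, cons_val_fin_one, cons_val_one, Fin.zero_eta]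
    linear_combination (-c a 0) * e1
  · simp only [of_apply, cons_val', cons_val_zero, cons_val_fin_one, cons_val_one, Fin.mk_one,
      Complex.ofReal_mul]
    linear_combination (-(gsX c / gsR c : ℝ) * c a 0) * e1 -
      (c a 1 - (gsX c / gsR c : ℝ) * c a 0) * e2

/-- The Iwasawa decomposition `G = K A N`. -/
theorem exists_iwasawa (g : G) :
    ∃ (k : K) (t₁ t₂ : ℝ), ∃ ν ∈ N₀, g = k.1 * expA t₁ t₂ * ν := by
  have hd := cMat_G_det_ne_zero g
  have hU := gsU_unitary g
  set c := cMat g.1 with hc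
  set k := ofUnitary _ hU with hk
  have hcK : cMat (k.1⁻¹ * g).1 = (!![Real.exp (gsT₁ c), gsX c / gsR c * Real.exp (gsT₁ c); 0,
      Real.exp (gsT₂ c)] : Matrix (Fin 2) (Fin 2) ℝ).map Complex.ofReal := by
    have h1 : cMat g.1 = cMat k.1.1 * cMat (k.1⁻¹ * g).1 := by
      rw [← cMat_K_mul, ← Submonoid.coe_mul, mul_inv_cancel_left]
    have h2 := congrArg ((cMat k.1.1)ᴴ * ·) h1
    simp only [← mul_assoc, cMat_K_unitary, one_mul] at h2
    rw [← h2, ← hc, eq_gsU_mul c, hk, cMat_ofUnitary, ← mul_assoc, ← eq_gsU_mul c, hU, one_mul]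
    ext i j
    fin_cases i <;> fin_cases j <;> simp
  obtain ⟨h11, h21⟩ := cMat_injOn_blocks hcK
  refine ⟨k, gsT₁ c, gsT₂ c, expA (-gsT₁ c) (-gsT₂ c) * (k.1⁻¹ * g), ⟨?_, ?_⟩, ?_⟩
  · rw [Submonoid.coe_mul, ← fromBlocks_toBlocks (k.1⁻¹ * g).1, h21, expA, torus,
      fromBlocks_multiply]
    simp
  · refine ⟨Real.exp (-gsT₁ c) * (gsX c / gsR c * Real.exp (gsT₁ c)), ?_⟩
    rw [Submonoid.coe_mul, ← fromBlocks_toBlocks (k.1⁻¹ * g).1, h11, expA, torus,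
      fromBlocks_multiply]
    ext i j
    fin_cases i <;> fin_cases j <;> simp [← Real.exp_add]
  · simp only [mul_assoc]
    rw [← mul_assoc (expA _ _), expA_mul_expA_neg, one_mul, mul_inv_cancel_left]

/-! ### Smoothness -/

section

variable {E : Type*} [NormedAddCommGroup E] [NormedSpace ℝ E] {s : Set E}

theorem contDiffOn_coeff_mul {P Q : E → Polynomial ℂ}
    (hP : ∀ i, ContDiffOn ℝ ∞ (fun x => (P x).coeff i) s)
    (hQ : ∀ i, ContDiffOn ℝ ∞ (fun x => (Q x).coeff i) s) (i : ℕ) :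
    ContDiffOn ℝ ∞ (fun x => (P x * Q x).coeff i) s := by
  simp only [Polynomial.coeff_mul]
  exact ContDiffOn.sum fun a _ => (hP a.1).mul (hQ a.2)

theorem contDiffOn_coeff_pow {P : E → Polynomial ℂ}
    (hP : ∀ i, ContDiffOn ℝ ∞ (fun x => (P x).coeff i) s) (e i : ℕ) :
    ContDiffOn ℝ ∞ (fun x => (P x ^ e).coeff i) s := by
  induction e generalizing i with
  | zero =>
    simp only [pow_zero]
    exact contDiffOn_const
  | succ e ih =>
    simp only [pow_succ]
    exact contDiffOn_coeff_mul ih hP i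

theorem contDiffOn_wCoeff {κ : E → Matrix (Fin 2) (Fin 2) ℂ}
    (hκ : ∀ a b, ContDiffOn ℝ ∞ (fun x => κ x a b) s) (p q y : ℤ) :
    ContDiffOn ℝ ∞ (fun x => wCoeff (κ x) p q y) s := by
  unfold wCoeff
  split_ifs
  · have hcol : ∀ a i, ContDiffOn ℝ ∞ (fun x => (colPoly (κ x) a).coeff i) s := by
      intro a i
      rcases i with _ | _ | i
      · simpa [colPoly] using hκ 0 a
      · simpa [colPoly, Polynomial.coeff_C] using hκ 1 a
      · simpa [colPoly, Polynomial.coeff_C, Polynomial.coeff_X] using contDiffOn_const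
    exact contDiffOn_coeff_mul (contDiffOn_coeff_pow (hcol 0) _)
      (contDiffOn_coeff_pow (hcol 1) _) _
  · exact contDiffOn_const

theorem contDiffOn_det {κ : E → Matrix (Fin 2) (Fin 2) ℂ}
    (hκ : ∀ a b, ContDiffOn ℝ ∞ (fun x => κ x a b) s) :
    ContDiffOn ℝ ∞ (fun x => (κ x).det) s := by
  simp only [det_fin_two]
  exact ((hκ 0 0).mul (hκ 1 1)).sub ((hκ 0 1).mul (hκ 1 0))

theorem contDiffOn_zpow {f : E → ℂ} (hf : ContDiffOn ℝ ∞ f s) (h0 : ∀ x ∈ s, f x ≠ 0) (l : ℤ) :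
    ContDiffOn ℝ ∞ (fun x => f x ^ l) s := by
  rcases l with l | l
  · simpa using hf.pow l
  · simp only [zpow_negSucc]
    exact (hf.pow (l + 1)).inv fun x hx => pow_ne_zero _ (h0 x hx)

theorem contDiffOn_normSq {f : E → ℂ} (hf : ContDiffOn ℝ ∞ f s) :
    ContDiffOn ℝ ∞ (fun x => Complex.normSq (f x)) s := by
  simp only [Complex.normSq_apply]
  have hre := Complex.reCLM.contDiff.comp_contDiffOn hf
  have him := Complex.imCLM.contDiff.comp_contDiffOn hf
  exact (hre.mul hre).add (him.mul him)

theorem contDiffOn_gsR {c : E → Matrix (Fin 2) (Fin 2) ℂ}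
    (hc : ∀ a b, ContDiffOn ℝ ∞ (fun x => c x a b) s) :
    ContDiffOn ℝ ∞ (fun x => gsR (c x)) s :=
  (contDiffOn_normSq (hc 0 0)).add (contDiffOn_normSq (hc 1 0))

theorem contDiffOn_gsX {c : E → Matrix (Fin 2) (Fin 2) ℂ}
    (hc : ∀ a b, ContDiffOn ℝ ∞ (fun x => c x a b) s) :
    ContDiffOn ℝ ∞ (fun x => gsX (c x)) s := by
  have hconj : ∀ a b, ContDiffOn ℝ ∞ (fun x => starRingEnd ℂ (c x a b)) s := fun a b =>
    Complex.conjCLE.contDiff.comp_contDiffOn (hc a b)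
  exact Complex.reCLM.contDiff.comp_contDiffOn
    (((hconj 0 0).mul (hc 0 1)).add ((hconj 1 0).mul (hc 1 1)))

theorem contDiffOn_gsT₁ {c : E → Matrix (Fin 2) (Fin 2) ℂ}
    (hc : ∀ a b, ContDiffOn ℝ ∞ (fun x => c x a b) s) (h0 : ∀ x ∈ s, (c x).det ≠ 0) :
    ContDiffOn ℝ ∞ (fun x => gsT₁ (c x)) s :=
  ((contDiffOn_gsR hc).log fun x hx => (gsR_pos (h0 x hx)).ne').div_const 2

theorem contDiffOn_gsT₂ {c : E → Matrix (Fin 2) (Fin 2) ℂ}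
    (hc : ∀ a b, ContDiffOn ℝ ∞ (fun x => c x a b) s) (h0 : ∀ x ∈ s, (c x).det ≠ 0) :
    ContDiffOn ℝ ∞ (fun x => gsT₂ (c x)) s :=
  (((contDiffOn_normSq (contDiffOn_det hc)).log
    fun x hx => (Complex.normSq_pos.2 (h0 x hx)).ne').sub
    ((contDiffOn_gsR hc).log fun x hx => (gsR_pos (h0 x hx)).ne')).div_const 2

theorem contDiffOn_ofReal {f : E → ℝ} (hf : ContDiffOn ℝ ∞ f s) :
    ContDiffOn ℝ ∞ (fun x => (f x : ℂ)) s :=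
  Complex.ofRealCLM.contDiff.comp_contDiffOn hf

theorem contDiffOn_gsU {c : E → Matrix (Fin 2) (Fin 2) ℂ}
    (hc : ∀ a b, ContDiffOn ℝ ∞ (fun x => c x a b) s) (h0 : ∀ x ∈ s, (c x).det ≠ 0)
    (a b : Fin 2) : ContDiffOn ℝ ∞ (fun x => gsU (c x) a b) s := by
  have h1 := contDiffOn_ofReal (contDiffOn_gsT₁ hc h0).neg.exp
  have h2 := contDiffOn_ofReal (contDiffOn_gsT₂ hc h0).neg.exp
  have h3 := contDiffOn_ofReal ((contDiffOn_gsX hc).div (contDiffOn_gsR hc)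
    fun x hx => (gsR_pos (h0 x hx)).ne')
  fin_cases b
  · exact h1.mul (hc a 0)
  · exact h2.mul ((hc a 1).sub (h3.mul (hc a 0)))

end

/-! ### The extension of a Wigner function to `G` -/

/-- The function `det κ ^ (-l) * wCoeff κ p q y` on frames: an unnormalized Wigner function. -/
def wFun (l p q y : ℤ) (κ : Matrix (Fin 2) (Fin 2) ℂ) : ℂ := κ.det ^ (-l) * wCoeff κ p q y

/-- The extension of an unnormalized Wigner function to frames, in terms of the Iwasawa
components. -/
def wExt (lam₁ lam₂ : ℂ) (l p q y : ℤ) (c : Matrix (Fin 2) (Fin 2) ℂ) : ℂ :=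
  Complex.exp (-((lam₁ + 2) * gsT₁ c + (lam₂ + 1) * gsT₂ c)) * wFun l p q y (gsU c)

theorem wExt_of_unitary (lam₁ lam₂ : ℂ) (l p q y : ℤ) {c : Matrix (Fin 2) (Fin 2) ℂ}
    (hc : cᴴ * c = 1) : wExt lam₁ lam₂ l p q y c = wFun l p q y c := by
  obtain ⟨-, -, -, h1, h2, h3⟩ := gs_of_unitary hc
  simp [wExt, h1, h2, h3]

theorem contDiffOn_cMat (s : Set (Fin 2 ⊕ Fin 2 → Fin 2 ⊕ Fin 2 → ℝ)) (a b : Fin 2) :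
    ContDiffOn ℝ ∞ (fun x => cMat (Matrix.of x) a b) s := by
  have h : ∀ i j, ContDiffOn ℝ ∞
      (fun x : Fin 2 ⊕ Fin 2 → Fin 2 ⊕ Fin 2 → ℝ => (x i j : ℂ)) s := fun i j =>
    contDiffOn_ofReal (contDiff_apply_apply ℝ ℝ i j).contDiffOn
  exact (h _ _).sub (contDiffOn_const.mul (h _ _))

theorem isOpen_det_cMat_ne_zero :
    IsOpen {x : Fin 2 ⊕ Fin 2 → Fin 2 ⊕ Fin 2 → ℝ | (cMat (Matrix.of x)).det ≠ 0} := by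
  refine isOpen_ne_fun ?_ continuous_const
  exact (contDiffOn_univ.1 (contDiffOn_det fun a b => contDiffOn_cMat _ a b)).continuous

theorem isSmooth_wExt (lam₁ lam₂ : ℂ) (l p q y : ℤ) (r : ℂ) :
    IsSmooth (fun g : G => g.1) fun g => r * wExt lam₁ lam₂ l p q y (cMat g.1) := by
  refine ⟨{x | (cMat (Matrix.of x)).det ≠ 0},
    fun x => r * wExt lam₁ lam₂ l p q y (cMat (Matrix.of x)), isOpen_det_cMat_ne_zero, ?_,
    fun g => ⟨cMat_G_det_ne_zero g, rfl⟩⟩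
  set s := {x : Fin 2 ⊕ Fin 2 → Fin 2 ⊕ Fin 2 → ℝ | (cMat (Matrix.of x)).det ≠ 0}
  have hc := contDiffOn_cMat s
  have h0 : ∀ x ∈ s, (cMat (Matrix.of x)).det ≠ 0 := fun x hx => hx
  have hU := contDiffOn_gsU hc h0
  have hT₁ := contDiffOn_ofReal (contDiffOn_gsT₁ hc h0)
  have hT₂ := contDiffOn_ofReal (contDiffOn_gsT₂ hc h0)
  refine contDiffOn_const.mul (ContDiffOn.mul ?_ (ContDiffOn.mul ?_ ?_))
  · exact ((contDiffOn_const.mul hT₁).add (contDiffOn_const.mul hT₂)).neg.cexp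
  · exact contDiffOn_zpow (contDiffOn_det hU) (fun x hx => det_gsU_ne_zero (h0 x hx)) _
  · exact contDiffOn_wCoeff hU _ _ _

theorem wCoeff_mul_diagonal (κ : Matrix (Fin 2) (Fin 2) ℂ) (ε₁ ε₂ : ℂ) (p q : ℕ) (y : ℤ) :
    wCoeff (κ * diagonal ![ε₁, ε₂]) p q y = ε₁ ^ p * ε₂ ^ q * wCoeff κ p q y := by
  rcases lt_or_ge y 0 with hy | hy
  · rw [wCoeff_of_index_neg _ _ _ hy, wCoeff_of_index_neg _ _ _ hy, mul_zero]
  · lift y to ℕ using hy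
    rw [wCoeff_natCast, wCoeff_natCast, ← Polynomial.coeff_C_mul]
    congr 1
    have h0 : colPoly (κ * diagonal ![ε₁, ε₂]) 0 = Polynomial.C ε₁ * colPoly κ 0 := by
      simp [colPoly]
      ring
    have h1 : colPoly (κ * diagonal ![ε₁, ε₂]) 1 = Polynomial.C ε₂ * colPoly κ 1 := by
      simp [colPoly]
      ring
    rw [wPoly, wPoly, h0, h1, mul_pow, mul_pow, map_mul, map_pow, map_pow]
    ring

theorem zpow_eq_zpow_of_modEq_two {ε : ℂ} (hε : ε * ε = 1) {a b : ℤ} (h : a ≡ b [ZMOD 2]) :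
    ε ^ a = ε ^ b := by
  have h0 : ε ≠ 0 := left_ne_zero_of_mul_eq_one hε
  obtain ⟨z, hz⟩ := h.symm.dvd
  rw [show a = b + 2 * z by omega, zpow_add₀ h0, _root_.zpow_mul, zpow_two, hε,
    _root_.one_zpow, mul_one]

/-- The parity conditions on `q - l` and `p - l` are the equivariance of the Wigner function under
`M`. -/
theorem wFun_mul_diagonal (κ : Matrix (Fin 2) (Fin 2) ℂ) {l y : ℤ} {p q : ℕ} {δ₁ δ₂ : ℕ}
    (h₁ : q - l ≡ δ₁ [ZMOD 2]) (h₂ : p - l ≡ δ₂ [ZMOD 2]) (e₁ e₂ : ℕ) :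
    wFun l p q y (κ * diagonal ![(-1) ^ e₂, (-1) ^ e₁]) =
      (-1) ^ (δ₁ * e₁ + δ₂ * e₂) * wFun l p q y κ := by
  have hsq : ∀ e : ℕ, ((-1 : ℂ) ^ e) * (-1) ^ e = 1 := fun e => by
    rw [← mul_pow]
    simp
  have hne : ∀ e : ℕ, ((-1 : ℂ) ^ e) ≠ 0 := fun e => left_ne_zero_of_mul_eq_one (hsq e)
  have e1 := zpow_eq_zpow_of_modEq_two (hsq e₁) h₁
  have e2 := zpow_eq_zpow_of_modEq_two (hsq e₂) h₂
  rw [sub_eq_add_neg, zpow_add₀ (hne _), zpow_natCast, zpow_natCast] at e1 e2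
  rw [wFun, wFun, wCoeff_mul_diagonal, det_mul, det_diagonal, Fin.prod_univ_two, mul_zpow]
  simp only [cons_val_zero, cons_val_one, mul_zpow]
  rw [pow_add, mul_comm δ₁, mul_comm δ₂, pow_mul, pow_mul, ← e1, ← e2]
  ring

theorem wExt_mem_principalSeries (lam₁ lam₂ : ℂ) {δ₁ δ₂ : Fin 2} {l y : ℤ} {p q : ℕ}
    (h₁ : q - l ≡ (δ₁ : ℕ) [ZMOD 2]) (h₂ : p - l ≡ (δ₂ : ℕ) [ZMOD 2]) (r : ℂ) :
    (fun g : G => r * wExt lam₁ lam₂ l p q y (cMat g.1)) ∈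
      principalSeries δ₁ δ₂ lam₁ lam₂ := by
  refine ⟨isSmooth_wExt _ _ _ _ _ _ _, fun g e₁ e₂ t₁ t₂ ν hν => ?_⟩
  obtain ⟨w, hw⟩ := cMat_mul_parabolic g e₁ e₂ t₁ t₂ hν
  have hsq : ∀ e : ℕ, ((-1 : ℝ) ^ e) * (-1) ^ e = 1 := fun e => by
    rw [← mul_pow]
    simp
  obtain ⟨hT₁, hT₂, hU⟩ := gs_mul_upper (cMat_G_det_ne_zero g) (hsq e₂) (hsq e₁) t₁ t₂ w hw
  simp only
  rw [wExt, hT₁, hT₂, hU]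
  push_cast
  rw [wFun_mul_diagonal _ h₁ h₂, wExt, mul_inv, ← Complex.exp_neg, ← inv_pow, inv_neg, inv_one]
  rw [show -((lam₁ + 2) * (gsT₁ (cMat g.1) + t₁) + (lam₂ + 1) * (gsT₂ (cMat g.1) + t₂) : ℂ) =
    -((lam₁ + 2) * t₁ + (lam₂ + 1) * t₂) +
      -((lam₁ + 2) * gsT₁ (cMat g.1) + (lam₂ + 1) * gsT₂ (cMat g.1)) by ring, Complex.exp_add]
  ring

/-- By the Iwasawa decomposition, an element of the principal series is determined on `K`. -/
theorem principalSeries_ext {δ₁ δ₂ : Fin 2} {lam₁ lam₂ : ℂ} {f f' : G → ℂ}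
    (hf : f ∈ principalSeries δ₁ δ₂ lam₁ lam₂) (hf' : f' ∈ principalSeries δ₁ δ₂ lam₁ lam₂)
    (h : ∀ k : K, f k = f' k) : f = f' := by
  ext g
  obtain ⟨k, t₁, t₂, ν, hν, rfl⟩ := exists_iwasawa g
  have e := hf.2 k 0 0 t₁ t₂ ν hν
  have e' := hf'.2 k 0 0 t₁ t₂ ν hν
  simp only [pow_zero, mul_one] at e e'
  rw [e, e', h]

theorem mem_CδK_of_mem_principalSeries {δ₁ δ₂ : Fin 2} {lam₁ lam₂ : ℂ} {f : G → ℂ}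
    (hf : f ∈ principalSeries δ₁ δ₂ lam₁ lam₂) : (fun k : K => f k) ∈ CδK δ₁ δ₂ := by
  obtain ⟨⟨U, F, hU, hF, h⟩, hf⟩ := hf
  refine ⟨⟨U, F, hU, hF, fun k => h k⟩, fun k k' e₁ e₂ hk => ?_⟩
  have h1 : (1 : G) ∈ N₀ := by
    refine ⟨by ext i j; simp [toBlocks₂₁], 0, ?_⟩
    ext i j
    fin_cases i <;> fin_cases j <;> simp [toBlocks₁₁]
  have := hf k e₁ e₂ 0 0 1 h1
  have hA : expA 0 0 = 1 := by
    rw [expA, ← torus_one]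
    congr 1 <;> · ext; simp
  simp only
  rw [hk]
  simpa [hA] using this

/-! ### The differential of the left regular action -/

theorem coe_expG_inv_mul (X : gR) (t : ℝ) (h : G) :
    ((expG (t • X))⁻¹ * h).1 = NormedSpace.exp ((-t) • X.1) * h.1 := by
  rw [Submonoid.coe_mul, SymplecticGroup.coe_inv', neg_smul, Matrix.exp_neg]
  rfl

theorem hasDerivAt_expG_inv_mul (X : gR) (h : G) (a b : Fin 2 ⊕ Fin 2) :
    HasDerivAt (fun t : ℝ => ((expG (t • X))⁻¹ * h).1 a b) (-(X.1 * h.1) a b) 0 := by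
  let _ : NormedRing (Matrix (Fin 2 ⊕ Fin 2) (Fin 2 ⊕ Fin 2) ℝ) := Matrix.linftyOpNormedRing
  let _ : NormedAlgebra ℝ (Matrix (Fin 2 ⊕ Fin 2) (Fin 2 ⊕ Fin 2) ℝ) :=
    Matrix.linftyOpNormedAlgebra
  have h1 := hasDerivAt_exp_smul_const (𝕂 := ℝ) X.1 (-0)
  have h2 := (h1.scomp (0 : ℝ) (hasDerivAt_neg (0 : ℝ))).mul_const h.1
  have h3 := ((Matrix.entryLinearMap ℝ ℝ a b).toContinuousLinearMap.hasFDerivAt).comp_hasDerivAt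
    (0 : ℝ) h2
  refine (h3.congr_deriv ?_).congr_of_eventuallyEq (Filter.Eventually.of_forall fun t => ?_)
  · simp
    rfl
  · change _ = (NormedSpace.exp ((-t) • X.1) * h.1) a b
    rw [← coe_expG_inv_mul]

/-- The smooth extension of a function on `G` computes its derivatives. -/
theorem dlReal_eq_fderiv {f : G → ℂ} {U : Set (Fin 2 ⊕ Fin 2 → Fin 2 ⊕ Fin 2 → ℝ)}
    {F : (Fin 2 ⊕ Fin 2 → Fin 2 ⊕ Fin 2 → ℝ) → ℂ} (hU : IsOpen U) (hF : ContDiffOn ℝ ∞ F U)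
    (h : ∀ x : G, (fun a b => x.1 a b) ∈ U ∧ f x = F (fun a b => x.1 a b)) (X : gR) (g : G) :
    dlReal X f g = fderiv ℝ F (fun a b => g.1 a b) (fun a b => -(X.1 * g.1) a b) := by
  have h0 : (fun a b => ((expG ((0 : ℝ) • X))⁻¹ * g).1 a b) = fun a b => g.1 a b := by
    rw [coe_expG_inv_mul]
    simp
  have hd : HasDerivAt (fun t : ℝ => (fun a b => ((expG (t • X))⁻¹ * g).1 a b))
      (fun a b => -(X.1 * g.1) a b) 0 :=
    hasDerivAt_pi.2 fun a => hasDerivAt_pi.2 fun b => hasDerivAt_expG_inv_mul X g a b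
  have hF' : HasFDerivAt F (fderiv ℝ F (fun a b => g.1 a b))
      (fun a b => ((expG ((0 : ℝ) • X))⁻¹ * g).1 a b) := by
    rw [h0]
    exact ((hF.differentiableOn (by simp)).differentiableAt (hU.mem_nhds (h g).1)).hasFDerivAt
  rw [dlReal, ← (hF'.comp_hasDerivAt 0 hd).deriv]
  congr 1
  ext t
  exact (h _).2

/-- The left derivative commutes with right translations, so it preserves the transformation law. -/
theorem dl_mem_principalSeries {δ₁ δ₂ : Fin 2} {lam₁ lam₂ : ℂ} {f : G → ℂ}
    (hf : f ∈ principalSeries δ₁ δ₂ lam₁ lam₂) (Z : gC) :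
    dl Z f ∈ principalSeries δ₁ δ₂ lam₁ lam₂ := by
  obtain ⟨⟨U, F, hU, hF, h⟩, hf⟩ := hf
  refine ⟨⟨U, fun x => fderiv ℝ F x (fun a b => -((reG Z).1 * Matrix.of x) a b) +
    Complex.I * fderiv ℝ F x (fun a b => -((imG Z).1 * Matrix.of x) a b), hU, ?_,
    fun g => ⟨(h g).1, ?_⟩⟩, ?_⟩
  · have hF' : ContDiffOn ℝ ∞ (fderiv ℝ F) U := hF.fderiv_of_isOpen hU (by simp)
    have hX : ∀ X : Matrix (Fin 2 ⊕ Fin 2) (Fin 2 ⊕ Fin 2) ℝ,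
        ContDiffOn ℝ ∞ (fun x : Fin 2 ⊕ Fin 2 → Fin 2 ⊕ Fin 2 → ℝ =>
          (fun a b => -(X * Matrix.of x) a b : Fin 2 ⊕ Fin 2 → Fin 2 ⊕ Fin 2 → ℝ)) U := by
      intro X
      refine contDiffOn_pi.2 fun a => contDiffOn_pi.2 fun b => ContDiffOn.neg ?_
      simp only [mul_apply]
      exact ContDiffOn.sum fun i _ => contDiffOn_const.mul
        (contDiff_apply_apply ℝ ℝ i b).contDiffOn
    exact (hF'.clm_apply (hX _)).add (contDiffOn_const.mul (hF'.clm_apply (hX _)))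
  · rw [dl, dlReal_eq_fderiv hU hF h, dlReal_eq_fderiv hU hF h]
    rfl
  · intro g e₁ e₂ t₁ t₂ ν hν
    have key : ∀ X : gR, dlReal X f (g * (γα₂ ^ e₁ * γ2α₁α₂ ^ e₂) * expA t₁ t₂ * ν) =
        ((-1) ^ ((δ₁ : ℕ) * e₁ + (δ₂ : ℕ) * e₂) *
          Complex.exp ((lam₁ + 2) * t₁ + (lam₂ + 1) * t₂))⁻¹ * dlReal X f g := by
      intro X
      unfold dlReal
      rw [← deriv_const_mul_field]
      congr 1
      ext t
      rw [← hf _ e₁ e₂ t₁ t₂ ν hν]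
      simp only [mul_assoc]
    rw [dl, key, key, dl]
    ring

/-! ### Derivatives along curves of frames -/

theorem hasDerivAt_coeff_mul {P Q : ℝ → Polynomial ℂ} {P' Q' : Polynomial ℂ} {t : ℝ}
    (hP : ∀ i, HasDerivAt (fun t => (P t).coeff i) (P'.coeff i) t)
    (hQ : ∀ i, HasDerivAt (fun t => (Q t).coeff i) (Q'.coeff i) t) (i : ℕ) :
    HasDerivAt (fun t => (P t * Q t).coeff i) ((P' * Q t + P t * Q').coeff i) t := by
  simp only [Polynomial.coeff_mul, Polynomial.coeff_add, ← Finset.sum_add_distrib]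
  exact HasDerivAt.fun_sum fun a _ => (hP a.1).mul (hQ a.2)

theorem hasDerivAt_coeff_pow {P : ℝ → Polynomial ℂ} {P' : Polynomial ℂ} {t : ℝ}
    (hP : ∀ i, HasDerivAt (fun t => (P t).coeff i) (P'.coeff i) t) (e i : ℕ) :
    HasDerivAt (fun t => (P t ^ e).coeff i) ((e * P t ^ (e - 1) * P').coeff i) t := by
  induction e generalizing i with
  | zero =>
    simp only [pow_zero, Nat.cast_zero, zero_mul, Polynomial.coeff_zero]
    exact hasDerivAt_const _ _
  | succ e ih =>
    simp only [pow_succ]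
    refine (hasDerivAt_coeff_mul ih hP i).congr_deriv ?_
    congr 1
    rcases e with _ | e
    · simp
    · simp only [Nat.add_sub_cancel, pow_succ]
      push_cast
      ring

/-- The derivative of `wCoeff κ p q y` in the direction `κ * Z`. -/
theorem hasDerivAt_wCoeff {κ : ℝ → Matrix (Fin 2) (Fin 2) ℂ} {Z : Matrix (Fin 2) (Fin 2) ℂ} {t : ℝ}
    (hκ : ∀ a b, HasDerivAt (fun t => κ t a b) ((κ t * Z) a b) t) (p q y : ℕ) :
    HasDerivAt (fun t => wCoeff (κ t) p q y)
      (p * (Z 0 0 * wCoeff (κ t) p q y + Z 1 0 * wCoeff (κ t) (p - 1) (q + 1) y) +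
        q * (Z 0 1 * wCoeff (κ t) (p + 1) (q - 1) y + Z 1 1 * wCoeff (κ t) p q y)) t := by
  have hcol : ∀ a i, HasDerivAt (fun t => (colPoly (κ t) a).coeff i)
      ((Polynomial.C (Z 0 a) * colPoly (κ t) 0 + Polynomial.C (Z 1 a) * colPoly (κ t) 1).coeff i)
      t := by
    intro a i
    have h0 := hκ 0 a
    have h1 := hκ 1 a
    rw [mul_apply, Fin.sum_univ_two] at h0 h1
    rcases i with _ | _ | i
    · simp only [colPoly, Polynomial.coeff_add, Polynomial.coeff_C_mul, Polynomial.coeff_C_zero,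
        Polynomial.coeff_X_zero, mul_zero, add_zero]
      exact h0.congr_deriv (by ring)
    · simp only [colPoly, Polynomial.coeff_add, Polynomial.coeff_C_mul, Polynomial.coeff_C_succ,
        Polynomial.coeff_X_one, mul_one, zero_add]
      exact h1.congr_deriv (by ring)
    · simpa [colPoly, Polynomial.coeff_C, Polynomial.coeff_X] using hasDerivAt_const t (0 : ℂ)
  have h := hasDerivAt_coeff_mul (hasDerivAt_coeff_pow (hcol 0) p)
    (hasDerivAt_coeff_pow (hcol 1) q) y
  simp only [wCoeff_natCast]
  refine h.congr_deriv ?_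
  have e1 := mul_wCoeff_pred_left (κ t) p (q + 1) y
  have e2 := mul_wCoeff_pred_right (κ t) (p + 1) q y
  push_cast at e1 e2
  have e3 : (p : ℂ) * (Z 0 0 * (wPoly (κ t) p q).coeff y +
      Z 1 0 * wCoeff (κ t) (p - 1) (q + 1) y) +
      q * (Z 0 1 * wCoeff (κ t) (p + 1) (q - 1) y + Z 1 1 * (wPoly (κ t) p q).coeff y) =
      (Polynomial.C (p * Z 0 0 : ℂ) * wPoly (κ t) p q +
        Polynomial.C (p * Z 1 0 : ℂ) * wPoly (κ t) (p - 1) (q + 1) +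
        Polynomial.C (q * Z 0 1 : ℂ) * wPoly (κ t) (p + 1) (q - 1) +
        Polynomial.C (q * Z 1 1 : ℂ) * wPoly (κ t) p q).coeff y := by
    simp only [Polynomial.coeff_add, Polynomial.coeff_C_mul]
    linear_combination Z 1 0 * e1 + Z 0 1 * e2
  rw [e3]
  congr 1
  have hp : (p : Polynomial ℂ) * colPoly (κ t) 0 ^ (p - 1) * colPoly (κ t) 0 =
      p * colPoly (κ t) 0 ^ p := by
    rcases p with _ | p
    · simp
    · rw [Nat.add_sub_cancel, pow_succ]
      ring
  have hq : (q : Polynomial ℂ) * colPoly (κ t) 1 ^ (q - 1) * colPoly (κ t) 1 =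
      q * colPoly (κ t) 1 ^ q := by
    rcases q with _ | q
    · simp
    · rw [Nat.add_sub_cancel, pow_succ]
      ring
  simp only [wPoly, map_mul, map_natCast, pow_succ]
  linear_combination (Polynomial.C (Z 0 0) * colPoly (κ t) 1 ^ q) * hp +
    (Polynomial.C (Z 1 1) * colPoly (κ t) 0 ^ p) * hq

theorem hasDerivAt_det {κ : ℝ → Matrix (Fin 2) (Fin 2) ℂ} {Z : Matrix (Fin 2) (Fin 2) ℂ} {t : ℝ}
    (hκ : ∀ a b, HasDerivAt (fun t => κ t a b) ((κ t * Z) a b) t) :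
    HasDerivAt (fun t => (κ t).det) ((κ t).det * (Z 0 0 + Z 1 1)) t := by
  simp only [det_fin_two]
  refine (((hκ 0 0).mul (hκ 1 1)).sub ((hκ 0 1).mul (hκ 1 0))).congr_deriv ?_
  simp only [mul_apply, Fin.sum_univ_two]
  ring

/-- The derivative of `wFun l p q y κ` in the direction `κ * Z`. -/
theorem hasDerivAt_wFun {κ : ℝ → Matrix (Fin 2) (Fin 2) ℂ} {Z : Matrix (Fin 2) (Fin 2) ℂ} {t : ℝ}
    (hκ : ∀ a b, HasDerivAt (fun t => κ t a b) ((κ t * Z) a b) t) (h0 : (κ t).det ≠ 0) (l : ℤ)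
    (p q y : ℕ) :
    HasDerivAt (fun t => wFun l p q y (κ t))
      ((κ t).det ^ (-l) * (-l * (Z 0 0 + Z 1 1) * wCoeff (κ t) p q y +
        p * (Z 0 0 * wCoeff (κ t) p q y + Z 1 0 * wCoeff (κ t) (p - 1) (q + 1) y) +
        q * (Z 0 1 * wCoeff (κ t) (p + 1) (q - 1) y + Z 1 1 * wCoeff (κ t) p q y))) t := by
  have h1 := ((hasDerivAt_zpow (-l) (κ t).det (Or.inl h0)).comp t (hasDerivAt_det hκ)).mul
    (hasDerivAt_wCoeff hκ p q y)
  refine h1.congr_deriv ?_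
  have e : (κ t).det ^ (-l - 1) * (κ t).det = (κ t).det ^ (-l) := by
    rw [← zpow_add_one₀ h0, sub_add_cancel]
  simp only [Function.comp_apply]
  push_cast
  linear_combination (-l * (Z 0 0 + Z 1 1) * wCoeff (κ t) p q y) * e

theorem hasDerivAt_re {f : ℝ → ℂ} {f' : ℂ} {t : ℝ} (hf : HasDerivAt f f' t) :
    HasDerivAt (fun t => (f t).re) f'.re t :=
  (Complex.reCLM.hasFDerivAt.comp_hasDerivAt t hf :)

theorem hasDerivAt_conj {f : ℝ → ℂ} {f' : ℂ} {t : ℝ} (hf : HasDerivAt f f' t) :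
    HasDerivAt (fun t => starRingEnd ℂ (f t)) (starRingEnd ℂ f') t :=
  ((Complex.conjCLE : ℂ →L[ℝ] ℂ).hasFDerivAt.comp_hasDerivAt t hf :)

theorem hasDerivAt_normSq {f : ℝ → ℂ} {f' : ℂ} {t : ℝ} (hf : HasDerivAt f f' t) :
    HasDerivAt (fun t => Complex.normSq (f t)) (2 * (starRingEnd ℂ (f t) * f').re) t := by
  have h := hasDerivAt_re ((hasDerivAt_conj hf).mul hf)
  refine (h.congr_deriv ?_).congr_of_eventuallyEq (Filter.Eventually.of_forall fun t => ?_)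
  · simp
    ring
  · simp [Complex.normSq_apply]

section

variable {c : ℝ → Matrix (Fin 2) (Fin 2) ℂ} {Y : Matrix (Fin 2) (Fin 2) ℂ} {t : ℝ}

theorem hasDerivAt_gsR (hu : (c t)ᴴ * c t = 1)
    (hc : ∀ a b, HasDerivAt (fun t => c t a b) ((c t * Y) a b) t) :
    HasDerivAt (fun t => gsR (c t)) (2 * (Y 0 0).re) t := by
  refine ((hasDerivAt_normSq (hc 0 0)).add (hasDerivAt_normSq (hc 1 0))).congr_deriv ?_
  have h : ((c t)ᴴ * (c t * Y)) 0 0 = Y 0 0 := by rw [← mul_assoc, hu, one_mul]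
  rw [mul_apply, Fin.sum_univ_two] at h
  rw [← h, ← mul_add, ← Complex.add_re]
  rfl

theorem hasDerivAt_gsX (hu : (c t)ᴴ * c t = 1)
    (hc : ∀ a b, HasDerivAt (fun t => c t a b) ((c t * Y) a b) t) :
    HasDerivAt (fun t => gsX (c t)) (starRingEnd ℂ (Y 1 0) + Y 0 1).re t := by
  refine (hasDerivAt_re (((hasDerivAt_conj (hc 0 0)).mul (hc 0 1)).add
    ((hasDerivAt_conj (hc 1 0)).mul (hc 1 1)))).congr_deriv ?_
  have h1 : ((c t)ᴴ * (c t * Y)) 1 0 = Y 1 0 := by rw [← mul_assoc, hu, one_mul]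
  have h2 : ((c t)ᴴ * (c t * Y)) 0 1 = Y 0 1 := by rw [← mul_assoc, hu, one_mul]
  rw [mul_apply, Fin.sum_univ_two] at h1 h2
  rw [← h1, ← h2]
  simp only [conjTranspose_apply, ← starRingEnd_apply, map_add, map_mul, Complex.conj_conj]
  congr 1
  ring

theorem hasDerivAt_normSq_det (hu : (c t)ᴴ * c t = 1)
    (hc : ∀ a b, HasDerivAt (fun t => c t a b) ((c t * Y) a b) t) :
    HasDerivAt (fun t => Complex.normSq (c t).det) (2 * ((Y 0 0).re + (Y 1 1).re)) t := by
  refine (hasDerivAt_normSq (hasDerivAt_det hc)).congr_deriv ?_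
  rw [← mul_assoc, mul_comm (starRingEnd ℂ _), det_mul_conj_det_of_unitary hu, one_mul,
    Complex.add_re]

theorem hasDerivAt_gsT₁ (hu : (c t)ᴴ * c t = 1)
    (hc : ∀ a b, HasDerivAt (fun t => c t a b) ((c t * Y) a b) t) :
    HasDerivAt (fun t => gsT₁ (c t)) (Y 0 0).re t := by
  obtain ⟨hR, -⟩ := gs_of_unitary hu
  refine (((hasDerivAt_gsR hu hc).log (by rw [hR]; exact one_ne_zero)).div_const 2).congr_deriv ?_
  rw [hR]
  ring

theorem hasDerivAt_gsT₂ (hu : (c t)ᴴ * c t = 1)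
    (hc : ∀ a b, HasDerivAt (fun t => c t a b) ((c t * Y) a b) t) :
    HasDerivAt (fun t => gsT₂ (c t)) (Y 1 1).re t := by
  obtain ⟨hR, -, hD, -⟩ := gs_of_unitary hu
  refine ((((hasDerivAt_normSq_det hu hc).log (by rw [hD]; exact one_ne_zero)).sub
    ((hasDerivAt_gsR hu hc).log (by rw [hR]; exact one_ne_zero))).div_const 2).congr_deriv ?_
  rw [hR, hD]
  ring

/-- The direction in which `gsU` moves at a unitary matrix when the frame moves in the symmetric
direction `Y`: subtracting the real upper triangular part leaves a skew-hermitian matrix. -/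
def skewPart (Y : Matrix (Fin 2) (Fin 2) ℂ) : Matrix (Fin 2) (Fin 2) ℂ :=
  !![Y 0 0 - (Y 0 0).re, -starRingEnd ℂ (Y 0 1); Y 0 1, Y 1 1 - (Y 1 1).re]

/-- In the second column the shear coefficient `Re (Y 1 0 + Y 0 1)` of Gram–Schmidt combines with the
symmetry of `Y` to the entry `-conj (Y 0 1)`. -/
theorem hasDerivAt_gsU (hu : (c t)ᴴ * c t = 1)
    (hc : ∀ a b, HasDerivAt (fun t => c t a b) ((c t * Y) a b) t) (hY : Y 1 0 = Y 0 1)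
    (a b : Fin 2) :
    HasDerivAt (fun t => gsU (c t) a b) ((gsU (c t) * skewPart Y) a b) t := by
  obtain ⟨hR, hX, -, hT₁, hT₂, hU⟩ := gs_of_unitary hu
  rw [hU, mul_apply, Fin.sum_univ_two]
  have d1 := (hasDerivAt_gsT₁ hu hc).neg.exp.ofReal_comp
  have d2 := (hasDerivAt_gsT₂ hu hc).neg.exp.ofReal_comp
  have d3 := ((hasDerivAt_gsX hu hc).div (hasDerivAt_gsR hu hc)
    (by rw [hR]; exact one_ne_zero)).ofReal_comp
  have hXY : ((Y 1 0).re : ℂ) + (Y 0 1).re = starRingEnd ℂ (Y 0 1) + Y 0 1 := by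
    rw [hY]
    apply Complex.ext <;> simp
  have e0 := hc a 0
  have e1 := hc a 1
  rw [mul_apply, Fin.sum_univ_two] at e0 e1
  fin_cases b
  · refine (d1.mul e0).congr_deriv ?_
    simp [hT₁, skewPart, hY]
    ring
  · refine (d2.mul (e1.sub (d3.mul e0))).congr_deriv ?_
    simp only [Pi.div_apply, hX, hR, zero_div]
    simp [skewPart, hT₂, hX, hR]
    linear_combination (-c t a 0) * hXY

end

/-- The derivative of `wExt` at a unitary frame `κ` in the symmetric direction `κ * Y`, extended to a
complex linear function of the pair `(Y, Y')`; for a real direction, `Y'` is the conjugate of `Y`. -/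
def wDeriv (lam₁ lam₂ : ℂ) (l : ℤ) (p q y : ℕ) (κ Y Y' : Matrix (Fin 2) (Fin 2) ℂ) : ℂ :=
  κ.det ^ (-l) * (-((lam₁ + 2) * ((Y 0 0 + Y' 0 0) / 2) + (lam₂ + 1) * ((Y 1 1 + Y' 1 1) / 2)) *
      wCoeff κ p q y +
    (-l * ((Y 0 0 - Y' 0 0) / 2 + (Y 1 1 - Y' 1 1) / 2) * wCoeff κ p q y +
      p * ((Y 0 0 - Y' 0 0) / 2 * wCoeff κ p q y + Y 0 1 * wCoeff κ (p - 1) (q + 1) y) +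
      q * (-Y' 0 1 * wCoeff κ (p + 1) (q - 1) y + (Y 1 1 - Y' 1 1) / 2 * wCoeff κ p q y)))

theorem hasDerivAt_wExt (lam₁ lam₂ : ℂ) (l : ℤ) (p q y : ℕ)
    {c : ℝ → Matrix (Fin 2) (Fin 2) ℂ} {Y : Matrix (Fin 2) (Fin 2) ℂ} {t : ℝ}
    (hu : (c t)ᴴ * c t = 1) (hc : ∀ a b, HasDerivAt (fun t => c t a b) ((c t * Y) a b) t)
    (hY : Y 1 0 = Y 0 1) :
    HasDerivAt (fun t => wExt lam₁ lam₂ l p q y (c t))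
      (wDeriv lam₁ lam₂ l p q y (c t) Y (Y.map (starRingEnd ℂ))) t := by
  obtain ⟨-, -, -, hT₁, hT₂, hU⟩ := gs_of_unitary hu
  have h0 : (c t).det ≠ 0 := left_ne_zero_of_mul_eq_one (det_mul_conj_det_of_unitary hu)
  have d1 := (((hasDerivAt_gsT₁ hu hc).ofReal_comp.const_mul (lam₁ + 2)).add
    ((hasDerivAt_gsT₂ hu hc).ofReal_comp.const_mul (lam₂ + 1))).neg.cexp
  have d2 := hasDerivAt_wFun (hasDerivAt_gsU hu hc hY) (by rwa [hU]) l p q y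
  refine (d1.mul d2).congr_deriv ?_
  have hre : ∀ z : ℂ, (z.re : ℂ) = (z + starRingEnd ℂ z) / 2 := fun z => by
    rw [Complex.add_conj]
    push_cast
    ring
  simp only [hU, wFun, wDeriv, Pi.neg_apply, Pi.add_apply, hT₁, hT₂, skewPart]
  simp [hre]
  ring

theorem wDeriv_add_I_mul (lam₁ lam₂ : ℂ) (l : ℤ) (p q y : ℕ)
    (κ Y₁ Y₁' Y₂ Y₂' : Matrix (Fin 2) (Fin 2) ℂ) :
    wDeriv lam₁ lam₂ l p q y κ Y₁ Y₁' + Complex.I * wDeriv lam₁ lam₂ l p q y κ Y₂ Y₂' =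
      wDeriv lam₁ lam₂ l p q y κ (Y₁ + Complex.I • Y₂) (Y₁' + Complex.I • Y₂') := by
  simp only [wDeriv, Matrix.add_apply, Matrix.smul_apply, smul_eq_mul]
  ring

/-- The derivative on `K` along a symmetric element of `𝔤`. -/
theorem dlReal_wExt (lam₁ lam₂ : ℂ) (l : ℤ) (p q y : ℕ) (r : ℂ) (X : gR)
    {P Q : Matrix (Fin 2) (Fin 2) ℝ} (hX : X.1 = fromBlocks P Q Q (-P)) (hP : Pᵀ = P)
    (hQ : Qᵀ = Q) (k : K) {κ Y : Matrix (Fin 2) (Fin 2) ℂ} (hκ : κ = cMat k.1.1)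
    (hY : Y = -(κᴴ * (P.map Complex.ofReal - Complex.I • Q.map Complex.ofReal) *
      κ.map (starRingEnd ℂ))) :
    dlReal X (fun g => r * wExt lam₁ lam₂ l p q y (cMat g.1)) k =
      r * wDeriv lam₁ lam₂ l p q y κ Y (Y.map (starRingEnd ℂ)) := by
  have h0 : cMat ((expG ((0 : ℝ) • X))⁻¹ * k.1).1 = κ := by
    rw [coe_expG_inv_mul, hκ]
    simp
  have hu : κᴴ * κ = 1 := by rw [hκ, cMat_K_unitary]
  have hu' : κ * κᴴ = 1 := mul_eq_one_comm.1 hu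
  have hsymm : Y 1 0 = Y 0 1 := by
    have : Yᵀ = Y := by
      rw [hY, transpose_neg, transpose_mul, transpose_mul, transpose_sub, transpose_smul,
        ← transpose_map, ← transpose_map, hP, ← transpose_map, hQ, mul_assoc]
      congr 2
    exact congrFun (congrFun this 0) 1
  have hcX : κ * Y = -cMat (X.1 * k.1.1) := by
    rw [hY, mul_neg, ← mul_assoc, ← mul_assoc, hu', one_mul, hX, hκ]
    congr 1
    ext a b
    simp [cMat, mul_apply, Fintype.sum_sum_type, Fin.sum_univ_two, K_inr_inl]
    linear_combination ((Q a 0 * k.1.1 (.inl 0) (.inr b) : ℂ) +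
      Q a 1 * k.1.1 (.inl 1) (.inr b)) * Complex.I_sq
  have hd : ∀ a b, HasDerivAt (fun t : ℝ => cMat ((expG (t • X))⁻¹ * k.1).1 a b)
      ((cMat ((expG ((0 : ℝ) • X))⁻¹ * k.1).1 * Y) a b) 0 := by
    intro a b
    rw [h0, hcX]
    have h1 := (hasDerivAt_expG_inv_mul X k.1 (.inl a) (.inl b)).ofReal_comp
    have h2 := (hasDerivAt_expG_inv_mul X k.1 (.inr a) (.inl b)).ofReal_comp.const_mul Complex.I
    refine (h1.sub h2).congr_deriv ?_
    simp [cMat]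
    ring
  have key := (hasDerivAt_wExt lam₁ lam₂ l p q y (by rw [h0, hu]) hd hsymm).const_mul r
  rw [h0] at key
  exact key.deriv

/-- The derivative on `K` along an element of `𝔭_ℂ`. -/
theorem dl_wExt (lam₁ lam₂ : ℂ) (l : ℤ) (p q y : ℕ) (r : ℂ) (Z : gC)
    {P Q : Matrix (Fin 2) (Fin 2) ℂ} (hZ : Z.1 = fromBlocks P Q Q (-P)) (hP : Pᵀ = P)
    (hQ : Qᵀ = Q) (k : K) {κ : Matrix (Fin 2) (Fin 2) ℂ} (hκ : κ = cMat k.1.1) :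
    dl Z (fun g => r * wExt lam₁ lam₂ l p q y (cMat g.1)) k =
      r * wDeriv lam₁ lam₂ l p q y κ
        (-(κᴴ * (P - Complex.I • Q) * κ.map (starRingEnd ℂ)))
        (-(κᵀ * (P + Complex.I • Q) * κ)) := by
  have hre : (reG Z).1 = fromBlocks (P.map Complex.re) (Q.map Complex.re) (Q.map Complex.re)
      (-P.map Complex.re) := by
    change Z.1.map Complex.re = _
    rw [hZ, fromBlocks_map]
    congr 1
  have him : (imG Z).1 = fromBlocks (P.map Complex.im) (Q.map Complex.im) (Q.map Complex.im)
      (-P.map Complex.im) := by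
    change Z.1.map Complex.im = _
    rw [hZ, fromBlocks_map]
    congr 1
  rw [dl, dlReal_wExt lam₁ lam₂ l p q y r (reG Z) hre (by rw [← transpose_map, hP])
    (by rw [← transpose_map, hQ]) k hκ rfl, dlReal_wExt lam₁ lam₂ l p q y r (imG Z) him
    (by rw [← transpose_map, hP]) (by rw [← transpose_map, hQ]) k hκ rfl, mul_left_comm, ← mul_add,
    wDeriv_add_I_mul]
  have hdec : ∀ R : Matrix (Fin 2) (Fin 2) ℂ, R = (R.map Complex.re).map Complex.ofReal +
      Complex.I • (R.map Complex.im).map Complex.ofReal := fun R => by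
    ext a b
    simp only [Matrix.add_apply, Matrix.smul_apply, map_apply, smul_eq_mul]
    rw [mul_comm]
    exact (Complex.re_add_im _).symm
  have hconj : ∀ A B : Matrix (Fin 2) (Fin 2) ℝ,
      (-(κᴴ * (A.map Complex.ofReal - Complex.I • B.map Complex.ofReal) *
        κ.map (starRingEnd ℂ))).map (starRingEnd ℂ) =
      -(κᵀ * (A.map Complex.ofReal + Complex.I • B.map Complex.ofReal) * κ) := fun A B => by
    ext a b
    simp [mul_apply, Fin.sum_univ_two]
  rw [hconj, hconj]
  conv_rhs => rw [hdec P, hdec Q]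
  congr 2
  · simp only [mul_add, mul_sub, add_mul, sub_mul, smul_add, Matrix.mul_smul, Matrix.smul_mul]
    module
  · simp only [mul_add, add_mul, smul_add, Matrix.mul_smul, Matrix.smul_mul]
    module

/-! ### The noncompact root vectors -/

theorem sum_signType_units (F : SignType → ℤˣ → ℂ) :
    ∑ j₀, ∑ ε, F j₀ ε = F .pos 1 + F .pos (-1) + (F .zero 1 + F .zero (-1)) +
      (F .neg 1 + F .neg (-1)) := by
  have hε : ∀ H : ℤˣ → ℂ, ∑ ε, H ε = H 1 + H (-1) := fun H => by
    rw [UnitsInt.univ, Finset.sum_pair (by decide)]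
  simp only [hε]
  rw [SignType.univ_eq, Finset.sum_insert (by decide), Finset.sum_pair (by decide)]
  simp only [SignType.zero_eq_zero, SignType.neg_eq_neg_one, SignType.pos_eq_one]
  ring

/-- For unitary `κ` the conjugate entries are the cofactors divided by `det κ`. -/
theorem conj_eq_of_unitary {κ : Matrix (Fin 2) (Fin 2) ℂ} (h : κᴴ * κ = 1) :
    κ.det * starRingEnd ℂ (κ 0 0) = κ 1 1 ∧ κ.det * starRingEnd ℂ (κ 0 1) = -κ 1 0 ∧
      κ.det * starRingEnd ℂ (κ 1 0) = -κ 0 1 ∧ κ.det * starRingEnd ℂ (κ 1 1) = κ 0 0 := by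
  have h1 : κᴴ * (κ * κ.adjugate) = κ.adjugate := by rw [← mul_assoc, h, one_mul]
  rw [mul_adjugate, Matrix.mul_smul, mul_one, adjugate_fin_two] at h1
  have e : ∀ a b, κ.det * starRingEnd ℂ (κ b a) = !![κ 1 1, -κ 0 1; -κ 1 0, κ 0 0] a b :=
    fun a b => congrFun (congrFun h1 a) b
  exact ⟨e 0 0, e 1 0, e 0 1, e 1 1⟩

/-- The symmetric matrix `P ∓ iQ` belonging to `u_{±β} = [P, Q; Q, -P]`; the other combination
`P ± iQ` vanishes. -/
def symbol (s : ℤˣ) : PosRoot → Matrix (Fin 2) (Fin 2) ℂ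
  | .β₂ => !![0, 0; 0, (√2 : ℝ) * Complex.I]
  | .β₁β₂ => !![0, -((s : ℤ) : ℂ) * Complex.I; -((s : ℤ) : ℂ) * Complex.I, 0]
  | .twoβ₁β₂ => !![(√2 : ℝ) * Complex.I, 0; 0, 0]

theorem exists_uMatrix_blocks (s : ℤˣ) (β : PosRoot) :
    ∃ P Q : Matrix (Fin 2) (Fin 2) ℂ, uMatrix s β = fromBlocks P Q Q (-P) ∧ Pᵀ = P ∧ Qᵀ = Q ∧
      P - Complex.I • Q = (if s = 1 then symbol s β else 0) ∧
      P + Complex.I • Q = (if s = 1 then 0 else symbol s β) := by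
  have hII := Complex.I_mul_I
  refine ⟨(uMatrix s β).toBlocks₁₁, (uMatrix s β).toBlocks₁₂, ?_, ?_, ?_, ?_, ?_⟩
  · ext (a | a) (b | b) <;> cases β <;> fin_cases a <;> fin_cases b <;>
      simp [uMatrix, H₁, H₂, Xα₁, Xα₂, Xα₁α₂, X2α₁α₂, toBlocks₁₁, toBlocks₁₂]
  · ext a b
    cases β <;> fin_cases a <;> fin_cases b <;>
      simp [uMatrix, H₁, H₂, Xα₁, Xα₂, Xα₁α₂, X2α₁α₂, toBlocks₁₁]
  · ext a b
    cases β <;> fin_cases a <;> fin_cases b <;>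
      simp [uMatrix, H₁, H₂, Xα₁, Xα₂, Xα₁α₂, X2α₁α₂, toBlocks₁₂]
  · rcases Int.units_eq_one_or s with rfl | rfl <;> ext a b <;>
      cases β <;> fin_cases a <;> fin_cases b <;>
      simp [uMatrix, H₁, H₂, Xα₁, Xα₂, Xα₁α₂, X2α₁α₂, toBlocks₁₁, toBlocks₁₂, symbol]
    all_goals
      first
      | linear_combination ((√2 : ℝ) * Complex.I / 2) * hII
      | linear_combination (-((√2 : ℝ) * Complex.I / 2)) * hII
      | ring
  · rcases Int.units_eq_one_or s with rfl | rfl <;> ext a b <;>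
      cases β <;> fin_cases a <;> fin_cases b <;>
      simp [uMatrix, H₁, H₂, Xα₁, Xα₂, Xα₁α₂, X2α₁α₂, toBlocks₁₁, toBlocks₁₂, symbol]
    all_goals
      first
      | linear_combination ((√2 : ℝ) * Complex.I / 2) * hII
      | linear_combination (-((√2 : ℝ) * Complex.I / 2)) * hII
      | ring

/-- `wDeriv` in a direction coming from `u_β` with `s = 1`, for the symmetric matrix
`!![σ, τ; τ, ρ]` in place of the symbol. -/
theorem wDeriv_pos (lam₁ lam₂ : ℂ) (l : ℤ) (p q y : ℕ) {κ : Matrix (Fin 2) (Fin 2) ℂ}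
    (hu : κᴴ * κ = 1) (σ τ ρ : ℂ) :
    wDeriv lam₁ lam₂ l p q y κ (-(κᴴ * !![σ, τ; τ, ρ] * κ.map (starRingEnd ℂ))) 0 =
      κ.det ^ (-(l + 2)) *
        ((lam₁ + 2 + l - p) / 2 * ((σ * (κ 1 1 * κ 1 1 * wCoeff κ p q y) -
            2 * τ * (κ 0 1 * κ 1 1 * wCoeff κ p q y) + ρ * (κ 0 1 * κ 0 1 * wCoeff κ p q y))) +
          (lam₂ + 1 + l - q) / 2 * ((σ * (κ 1 0 * κ 1 0 * wCoeff κ p q y) -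
            2 * τ * (κ 0 0 * κ 1 0 * wCoeff κ p q y) + ρ * (κ 0 0 * κ 0 0 * wCoeff κ p q y))) +
          (σ * (p * (κ 1 0 * κ 1 1 * wCoeff κ (p - 1) (q + 1) y)) -
            τ * (p * ((κ 0 0 * κ 1 1 + κ 0 1 * κ 1 0) * wCoeff κ (p - 1) (q + 1) y)) +
            ρ * (p * (κ 0 0 * κ 0 1 * wCoeff κ (p - 1) (q + 1) y)))) := by
  have h0 : κ.det ≠ 0 := left_ne_zero_of_mul_eq_one (det_mul_conj_det_of_unitary hu)
  obtain ⟨c00, c01, c10, c11⟩ := conj_eq_of_unitary hu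
  have hz : κ.det ^ (-l) = κ.det ^ (-(l + 2)) * (κ.det * κ.det) := by
    rw [← sq, ← zpow_natCast, ← zpow_add₀ h0]
    congr 1
    push_cast
    ring
  simp only [wDeriv, hz, Matrix.neg_apply, mul_apply, Fin.sum_univ_two, conjTranspose_apply,
    ← starRingEnd_apply, map_apply, Matrix.zero_apply, of_apply, cons_val', cons_val_zero,
    cons_val_one, cons_val_fin_one]
  generalize starRingEnd ℂ (κ 0 0) = u₀₀ at *
  generalize starRingEnd ℂ (κ 0 1) = u₀₁ at *
  generalize starRingEnd ℂ (κ 1 0) = u₁₀ at *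
  generalize starRingEnd ℂ (κ 1 1) = u₁₁ at *
  rw [← c00, ← c11, ← neg_eq_iff_eq_neg.2 c01, ← neg_eq_iff_eq_neg.2 c10]
  ring

/-- `wDeriv` in a direction coming from `u_β` with `s = -1`, for the symmetric matrix
`!![σ, τ; τ, ρ]` in place of the symbol. -/
theorem wDeriv_neg (lam₁ lam₂ : ℂ) (l : ℤ) (p q y : ℕ) (κ : Matrix (Fin 2) (Fin 2) ℂ)
    (σ τ ρ : ℂ) :
    wDeriv lam₁ lam₂ l p q y κ 0 (-(κᵀ * !![σ, τ; τ, ρ] * κ)) =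
      κ.det ^ (-l) *
        ((lam₁ + 2 - l + p) / 2 * ((σ * (κ 0 0 * κ 0 0 * wCoeff κ p q y) +
            2 * τ * (κ 0 0 * κ 1 0 * wCoeff κ p q y) + ρ * (κ 1 0 * κ 1 0 * wCoeff κ p q y))) +
          (lam₂ + 1 - l + q) / 2 * ((σ * (κ 0 1 * κ 0 1 * wCoeff κ p q y) +
            2 * τ * (κ 0 1 * κ 1 1 * wCoeff κ p q y) + ρ * (κ 1 1 * κ 1 1 * wCoeff κ p q y))) +
          (σ * (q * (κ 0 0 * κ 0 1 * wCoeff κ (p + 1) (q - 1) y)) +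
            τ * (q * ((κ 0 0 * κ 1 1 + κ 0 1 * κ 1 0) * wCoeff κ (p + 1) (q - 1) y)) +
            ρ * (q * (κ 1 0 * κ 1 1 * wCoeff κ (p + 1) (q - 1) y)))) := by
  simp only [wDeriv, Matrix.neg_apply, mul_apply, Fin.sum_univ_two, transpose_apply,
    Matrix.zero_apply, of_apply, cons_val', cons_val_zero, cons_val_one, cons_val_fin_one]
  ring

/-- The summand of the asserted formula, freed of the common ratio of norms. -/
def wTerm (s : ℤˣ) (lam₁ lam₂ : ℂ) (j n m₂ : ℝ) (l : ℤ) (p q x y : ℕ)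
    (κ : Matrix (Fin 2) (Fin 2) ℂ) (μ j₀ : SignType) (ε : ℤˣ) : ℂ :=
  (rowCoeff x y j₀ μ : ℂ) * (colCoeff p q j₀ ε : ℂ) * kappa s j n m₂ lam₁ lam₂ j₀ ε *
    (κ.det ^ (-(l + j₀ + (s : ℤ))) * wCoeff κ (p + j₀ - ε) (q + j₀ + ε) (y + j₀ + μ))

/-- The powers of `det κ` by which the terms of degree `j` and `j - 1` differ from the one of degree
`j + 1`. -/
theorem det_zpow_shift {κ : Matrix (Fin 2) (Fin 2) ℂ} (h0 : κ.det ≠ 0) (l : ℤ) :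
    κ.det ^ (-(l - 1)) = κ.det ^ (-l) * κ.det ∧
      κ.det ^ (-(l - 2)) = κ.det ^ (-l) * κ.det ^ 2 := by
  constructor
  · rw [← zpow_add_one₀ h0]
    congr 1
    ring
  · rw [← zpow_natCast, ← zpow_add₀ h0]
    congr 1
    push_cast
    ring

/-- The sum of the six summands for `s = 1`, grouped by the degree `2(j + j₀)`. -/
theorem sum_wTerm_pos (lam₁ lam₂ : ℂ) {j n m₂ : ℝ} {l : ℤ} {p q : ℕ} (hp : j - m₂ = p)
    (hq : j + m₂ = q) (hl : j + n = l) (x y : ℕ) {κ : Matrix (Fin 2) (Fin 2) ℂ}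
    (h0 : κ.det ≠ 0) (μ : SignType) :
    ∑ j₀, ∑ ε, wTerm 1 lam₁ lam₂ j n m₂ l p q x y κ μ j₀ ε = κ.det ^ (-(l + 2)) *
      (rowCoeff x y .pos μ * ((lam₁ + 2 + l + p) * wCoeff κ p (q + 2) (y + μ + 1) +
          (lam₂ + 1 + l - q) * wCoeff κ (p + 2) q (y + μ + 1)) +
        rowCoeff x y .zero μ * (p * (q - l - lam₁) * (κ.det * wCoeff κ (p - 1) (q + 1) (y + μ)) +
          q * (lam₂ + 1 + l - q) * (κ.det * wCoeff κ (p + 1) (q - 1) (y + μ))) +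
        rowCoeff x y .neg μ *
          (p * (p - 1) * (l - p - 2 * q + lam₁) * (κ.det ^ 2 * wCoeff κ (p - 2) q (y + μ - 1)) +
          q * (q - 1) * (lam₂ + 1 + l - q) * (κ.det ^ 2 * wCoeff κ p (q - 2) (y + μ - 1)))) := by
  obtain ⟨z1, z2⟩ := det_zpow_shift h0 (l + 2)
  obtain rfl : j = (p + q) / 2 := by linarith
  obtain rfl : m₂ = (q - p) / 2 := by linarith
  obtain rfl : n = l - (p + q) / 2 := by linarith
  have hε : (1 : ℤˣ) ≠ -1 := by decide
  rw [sum_signType_units]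
  simp only [wTerm, colCoeff, kappa, kappaPos, if_true, if_neg hε, SignType.zero_eq_zero,
    SignType.neg_eq_neg_one, SignType.pos_eq_one, SignType.coe_zero, SignType.coe_neg_one,
    SignType.coe_one, Units.val_one, Units.val_neg]
  rw [show l + 1 + 1 = l + 2 by ring, show l + 0 + 1 = l + 2 - 1 by ring,
    show l + -1 + 1 = l + 2 - 2 by ring, z1, z2, show (p : ℤ) + 1 - 1 = p by ring,
    show (q : ℤ) + 1 + 1 = q + 2 by ring, show (p : ℤ) + 1 - -1 = p + 2 by ring,
    show (q : ℤ) + 1 + -1 = q by ring, show (p : ℤ) + 0 - 1 = p - 1 by ring,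
    show (q : ℤ) + 0 + 1 = q + 1 by ring, show (p : ℤ) + 0 - -1 = p + 1 by ring,
    show (q : ℤ) + 0 + -1 = q - 1 by ring, show (p : ℤ) + -1 - 1 = p - 2 by ring,
    show (q : ℤ) + -1 + 1 = q by ring, show (p : ℤ) + -1 - -1 = p by ring,
    show (q : ℤ) + -1 + -1 = q - 2 by ring, show (y : ℤ) + 1 + μ = y + μ + 1 by ring,
    show (y : ℤ) + 0 + μ = y + μ by ring, show (y : ℤ) + -1 + μ = y + μ - 1 by ring]
  push_cast
  ring

/-- The sum of the six summands for `s = -1`, grouped by the degree `2(j + j₀)`. -/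
theorem sum_wTerm_neg (lam₁ lam₂ : ℂ) {j n m₂ : ℝ} {l : ℤ} {p q : ℕ} (hp : j - m₂ = p)
    (hq : j + m₂ = q) (hl : j + n = l) (x y : ℕ) {κ : Matrix (Fin 2) (Fin 2) ℂ}
    (h0 : κ.det ≠ 0) (μ : SignType) :
    ∑ j₀, ∑ ε, wTerm (-1) lam₁ lam₂ j n m₂ l p q x y κ μ j₀ ε = κ.det ^ (-l) *
      (rowCoeff x y .pos μ * ((lam₂ + 1 - l + q) * wCoeff κ p (q + 2) (y + μ + 1) +
          (lam₁ + 2 - l + p + 2 * q) * wCoeff κ (p + 2) q (y + μ + 1)) +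
        rowCoeff x y .zero μ *
          (p * (l - q - lam₂ - 1) * (κ.det * wCoeff κ (p - 1) (q + 1) (y + μ)) +
          q * (lam₁ - l + q) * (κ.det * wCoeff κ (p + 1) (q - 1) (y + μ))) +
        rowCoeff x y .neg μ *
          (p * (p - 1) * (lam₂ + 1 - l + q) * (κ.det ^ 2 * wCoeff κ (p - 2) q (y + μ - 1)) +
          q * (q - 1) * (lam₁ - l - p) * (κ.det ^ 2 * wCoeff κ p (q - 2) (y + μ - 1)))) := by
  obtain ⟨z1, z2⟩ := det_zpow_shift h0 l
  obtain rfl : j = (p + q) / 2 := by linarith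
  obtain rfl : m₂ = (q - p) / 2 := by linarith
  obtain rfl : n = l - (p + q) / 2 := by linarith
  have hε : (1 : ℤˣ) ≠ -1 := by decide
  rw [sum_signType_units]
  simp only [wTerm, colCoeff, kappa, kappaNeg, if_true, if_neg hε, if_neg hε.symm,
    SignType.zero_eq_zero, SignType.neg_eq_neg_one, SignType.pos_eq_one, SignType.coe_zero,
    SignType.coe_neg_one, SignType.coe_one, Units.val_one, Units.val_neg]
  rw [show l + 1 + -1 = l by ring, show l + 0 + -1 = l - 1 by ring,
    show l + -1 + -1 = l - 2 by ring, z1, z2, show (p : ℤ) + 1 - 1 = p by ring,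
    show (q : ℤ) + 1 + 1 = q + 2 by ring, show (p : ℤ) + 1 - -1 = p + 2 by ring,
    show (q : ℤ) + 1 + -1 = q by ring, show (p : ℤ) + 0 - 1 = p - 1 by ring,
    show (q : ℤ) + 0 + 1 = q + 1 by ring, show (p : ℤ) + 0 - -1 = p + 1 by ring,
    show (q : ℤ) + 0 + -1 = q - 1 by ring, show (p : ℤ) + -1 - 1 = p - 2 by ring,
    show (q : ℤ) + -1 + 1 = q by ring, show (p : ℤ) + -1 - -1 = p by ring,
    show (q : ℤ) + -1 + -1 = q - 2 by ring, show (y : ℤ) + 1 + μ = y + μ + 1 by ring,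
    show (y : ℤ) + 0 + μ = y + μ by ring, show (y : ℤ) + -1 + μ = y + μ - 1 by ring]
  push_cast
  ring

section

variable (κ : Matrix (Fin 2) (Fin 2) ℂ) (p q : ℕ) (y : ℤ) {N : ℤ}

/-! The factor `p` or `q` makes the expansions of the shifted coefficients valid for `p = 0` or
`q = 0` too. -/

theorem natCast_mul_wCoeff_pred_zero_zero_zero_one (hN : N = p + q) :
    (p : ℂ) * (κ 0 0 * κ 0 1 * wCoeff κ (p - 1) (q + 1) y) = p *
      ((N - y + 1) * (N - y + 2) * wCoeff κ p (q + 2) y / ((N + 1) * (N + 2)) +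
      (q - p + 2) * (N - y + 1) * (κ.det * wCoeff κ (p - 1) (q + 1) (y - 1)) / (N * (N + 2)) +
      -((p - 1) * (q + 1)) * (κ.det ^ 2 * wCoeff κ (p - 2) q (y - 2)) / (N * (N + 1))) := by
  rcases Nat.eq_zero_or_pos p with rfl | hpos
  · rw [Nat.cast_zero, zero_mul, zero_mul]
  · rw [wCoeff_mul_zero_zero_zero_one κ y (p := (p : ℤ) - 1) (q := q + 1) (by omega) (by omega)
      (by omega) (N := N) (by rw [hN]; ring), show (p : ℤ) - 1 + 1 = p by ring,
      show (q : ℤ) + 1 + 1 = q + 2 by ring, show (p : ℤ) - 1 - 1 = p - 2 by ring,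
      show (q : ℤ) + 1 - 1 = q by ring]
    push_cast
    ring

theorem natCast_mul_wCoeff_pred_one_zero_one_one (hN : N = p + q) :
    (p : ℂ) * (κ 1 0 * κ 1 1 * wCoeff κ (p - 1) (q + 1) y) = p *
      ((y + 1) * (y + 2) * wCoeff κ p (q + 2) (y + 2) / ((N + 1) * (N + 2)) +
      (p - q - 2) * (y + 1) * (κ.det * wCoeff κ (p - 1) (q + 1) (y + 1)) / (N * (N + 2)) +
      -((p - 1) * (q + 1)) * (κ.det ^ 2 * wCoeff κ (p - 2) q y) / (N * (N + 1))) := by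
  rcases Nat.eq_zero_or_pos p with rfl | hpos
  · rw [Nat.cast_zero, zero_mul, zero_mul]
  · rw [wCoeff_mul_one_zero_one_one κ y (p := (p : ℤ) - 1) (q := q + 1) (by omega) (by omega)
      (by omega) (N := N) (by rw [hN]; ring), show (p : ℤ) - 1 + 1 = p by ring,
      show (q : ℤ) + 1 + 1 = q + 2 by ring, show (p : ℤ) - 1 - 1 = p - 2 by ring,
      show (q : ℤ) + 1 - 1 = q by ring]
    push_cast
    ring

theorem natCast_mul_wCoeff_pred_permanent (hN : N = p + q) :
    (p : ℂ) * ((κ 0 0 * κ 1 1 + κ 0 1 * κ 1 0) * wCoeff κ (p - 1) (q + 1) y) = p *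
      (2 * (N - y + 1) * (y + 1) * wCoeff κ p (q + 2) (y + 1) / ((N + 1) * (N + 2)) +
      (p - q - 2) * (N - 2 * y) * (κ.det * wCoeff κ (p - 1) (q + 1) y) / (N * (N + 2)) +
      2 * (p - 1) * (q + 1) * (κ.det ^ 2 * wCoeff κ (p - 2) q (y - 1)) / (N * (N + 1))) := by
  rcases Nat.eq_zero_or_pos p with rfl | hpos
  · rw [Nat.cast_zero, zero_mul, zero_mul]
  · rw [wCoeff_mul_permanent κ y (p := (p : ℤ) - 1) (q := q + 1) (by omega) (by omega)
      (by omega) (N := N) (by rw [hN]; ring), show (p : ℤ) - 1 + 1 = p by ring,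
      show (q : ℤ) + 1 + 1 = q + 2 by ring, show (p : ℤ) - 1 - 1 = p - 2 by ring,
      show (q : ℤ) + 1 - 1 = q by ring]
    push_cast
    ring

theorem natCast_mul_wCoeff_succ_zero_zero_zero_one (hN : N = p + q) :
    (q : ℂ) * (κ 0 0 * κ 0 1 * wCoeff κ (p + 1) (q - 1) y) = q *
      ((N - y + 1) * (N - y + 2) * wCoeff κ (p + 2) q y / ((N + 1) * (N + 2)) +
      (q - p - 2) * (N - y + 1) * (κ.det * wCoeff κ (p + 1) (q - 1) (y - 1)) / (N * (N + 2)) +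
      -((p + 1) * (q - 1)) * (κ.det ^ 2 * wCoeff κ p (q - 2) (y - 2)) / (N * (N + 1))) := by
  rcases Nat.eq_zero_or_pos q with rfl | hpos
  · rw [Nat.cast_zero, zero_mul, zero_mul]
  · rw [wCoeff_mul_zero_zero_zero_one κ y (p := (p : ℤ) + 1) (q := q - 1) (by omega) (by omega)
      (by omega) (N := N) (by rw [hN]; ring), show (p : ℤ) + 1 + 1 = p + 2 by ring,
      show (q : ℤ) - 1 + 1 = q by ring, show (p : ℤ) + 1 - 1 = p by ring,
      show (q : ℤ) - 1 - 1 = q - 2 by ring]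
    push_cast
    ring

theorem natCast_mul_wCoeff_succ_one_zero_one_one (hN : N = p + q) :
    (q : ℂ) * (κ 1 0 * κ 1 1 * wCoeff κ (p + 1) (q - 1) y) = q *
      ((y + 1) * (y + 2) * wCoeff κ (p + 2) q (y + 2) / ((N + 1) * (N + 2)) +
      (p - q + 2) * (y + 1) * (κ.det * wCoeff κ (p + 1) (q - 1) (y + 1)) / (N * (N + 2)) +
      -((p + 1) * (q - 1)) * (κ.det ^ 2 * wCoeff κ p (q - 2) y) / (N * (N + 1))) := by
  rcases Nat.eq_zero_or_pos q with rfl | hpos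
  · rw [Nat.cast_zero, zero_mul, zero_mul]
  · rw [wCoeff_mul_one_zero_one_one κ y (p := (p : ℤ) + 1) (q := q - 1) (by omega) (by omega)
      (by omega) (N := N) (by rw [hN]; ring), show (p : ℤ) + 1 + 1 = p + 2 by ring,
      show (q : ℤ) - 1 + 1 = q by ring, show (p : ℤ) + 1 - 1 = p by ring,
      show (q : ℤ) - 1 - 1 = q - 2 by ring]
    push_cast
    ring

theorem natCast_mul_wCoeff_succ_permanent (hN : N = p + q) :
    (q : ℂ) * ((κ 0 0 * κ 1 1 + κ 0 1 * κ 1 0) * wCoeff κ (p + 1) (q - 1) y) = q *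
      (2 * (N - y + 1) * (y + 1) * wCoeff κ (p + 2) q (y + 1) / ((N + 1) * (N + 2)) +
      (p - q + 2) * (N - 2 * y) * (κ.det * wCoeff κ (p + 1) (q - 1) y) / (N * (N + 2)) +
      2 * (p + 1) * (q - 1) * (κ.det ^ 2 * wCoeff κ p (q - 2) (y - 1)) / (N * (N + 1))) := by
  rcases Nat.eq_zero_or_pos q with rfl | hpos
  · rw [Nat.cast_zero, zero_mul, zero_mul]
  · rw [wCoeff_mul_permanent κ y (p := (p : ℤ) + 1) (q := q - 1) (by omega) (by omega)
      (by omega) (N := N) (by rw [hN]; ring), show (p : ℤ) + 1 + 1 = p + 2 by ring,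
      show (q : ℤ) - 1 + 1 = q by ring, show (p : ℤ) + 1 - 1 = p by ring,
      show (q : ℤ) - 1 - 1 = q - 2 by ring]
    push_cast
    ring

end

/-! ### Comparison with the Clebsch–Gordan coefficients -/

/-- The derivative along `u_β` for `s = 1`. Here `wDeriv_pos` gives a quadratic form in `κ` times
`wCoeff`, and expanding its three products separates the constituents `j + 1`, `j`, `j - 1`. -/
theorem wDeriv_symbol_pos (lam₁ lam₂ : ℂ) {j n m₂ : ℝ} {l : ℤ} {p q x y : ℕ} (hp : j - m₂ = p)
    (hq : j + m₂ = q) (hl : j + n = l) (hsum : p + q = x + y) {κ : Matrix (Fin 2) (Fin 2) ℂ}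
    (hu : κᴴ * κ = 1) (β : PosRoot) :
    wDeriv lam₁ lam₂ l p q y κ (-(κᴴ * symbol 1 β * κ.map (starRingEnd ℂ))) 0 =
      Complex.I / 2 * ∑ j₀, ∑ ε, wTerm 1 lam₁ lam₂ j n m₂ l p q x y κ (mRoot 1 β) j₀ ε := by
  have h0 : κ.det ≠ 0 := left_ne_zero_of_mul_eq_one (det_mul_conj_det_of_unitary hu)
  have hx : (x : ℂ) = p + q - y := by
    rw [eq_sub_iff_add_eq]
    exact_mod_cast hsum.symm
  rw [sum_wTerm_pos lam₁ lam₂ hp hq hl x y h0]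
  cases β
  · rw [symbol, wDeriv_pos _ _ _ _ _ _ hu]
    rw [natCast_mul_wCoeff_pred_zero_zero_zero_one κ p q y rfl,
      wCoeff_mul_zero_one_sq κ y (Int.natCast_nonneg p) (Int.natCast_nonneg q) rfl,
      wCoeff_mul_zero_zero_sq κ y (Int.natCast_nonneg p) (Int.natCast_nonneg q) rfl]
    simp only [mRoot, if_true, rowCoeff, SignType.neg_eq_neg_one, SignType.coe_neg_one]
    rw [show (y : ℤ) + -1 + 1 = y by ring, show (y : ℤ) + -1 - 1 = y - 2 by ring,
      show (y : ℤ) + -1 = y - 1 by ring]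
    push_cast
    rw [hx]
    ring
  · rw [symbol, wDeriv_pos _ _ _ _ _ _ hu]
    rw [natCast_mul_wCoeff_pred_permanent κ p q y rfl,
      wCoeff_mul_zero_one_one_one κ y (Int.natCast_nonneg p) (Int.natCast_nonneg q) rfl,
      wCoeff_mul_zero_zero_one_zero κ y (Int.natCast_nonneg p) (Int.natCast_nonneg q) rfl]
    simp only [mRoot, rowCoeff, SignType.zero_eq_zero, SignType.coe_zero]
    rw [add_zero]
    push_cast
    rw [hx]
    ring
  · rw [symbol, wDeriv_pos _ _ _ _ _ _ hu]
    rw [natCast_mul_wCoeff_pred_one_zero_one_one κ p q y rfl,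
      wCoeff_mul_one_one_sq κ y (Int.natCast_nonneg p) (Int.natCast_nonneg q) rfl,
      wCoeff_mul_one_zero_sq κ y (Int.natCast_nonneg p) (Int.natCast_nonneg q) rfl]
    simp only [mRoot, if_true, rowCoeff, SignType.pos_eq_one, SignType.coe_one]
    rw [show (y : ℤ) + 1 + 1 = y + 2 by ring, show (y : ℤ) + 1 - 1 = y by ring]
    push_cast
    rw [hx]
    ring

/-- The derivative along `u_{-β}`, from the same expansions as for `s = 1`. -/
theorem wDeriv_symbol_neg (lam₁ lam₂ : ℂ) {j n m₂ : ℝ} {l : ℤ} {p q x y : ℕ} (hp : j - m₂ = p)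
    (hq : j + m₂ = q) (hl : j + n = l) (hsum : p + q = x + y) {κ : Matrix (Fin 2) (Fin 2) ℂ}
    (hu : κᴴ * κ = 1) (β : PosRoot) :
    wDeriv lam₁ lam₂ l p q y κ 0 (-(κᵀ * symbol (-1) β * κ)) =
      Complex.I / 2 *
        ∑ j₀, ∑ ε, wTerm (-1) lam₁ lam₂ j n m₂ l p q x y κ (mRoot (-1) β) j₀ ε := by
  have h0 : κ.det ≠ 0 := left_ne_zero_of_mul_eq_one (det_mul_conj_det_of_unitary hu)
  have hx : (x : ℂ) = p + q - y := by
    rw [eq_sub_iff_add_eq]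
    exact_mod_cast hsum.symm
  have hs : (-1 : ℤˣ) ≠ 1 := by decide
  rw [sum_wTerm_neg lam₁ lam₂ hp hq hl x y h0]
  cases β
  · rw [symbol, wDeriv_neg]
    rw [natCast_mul_wCoeff_succ_one_zero_one_one κ p q y rfl,
      wCoeff_mul_one_one_sq κ y (Int.natCast_nonneg p) (Int.natCast_nonneg q) rfl,
      wCoeff_mul_one_zero_sq κ y (Int.natCast_nonneg p) (Int.natCast_nonneg q) rfl]
    simp only [mRoot, if_neg hs, rowCoeff, SignType.pos_eq_one, SignType.coe_one]
    rw [show (y : ℤ) + 1 + 1 = y + 2 by ring, show (y : ℤ) + 1 - 1 = y by ring]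
    push_cast
    rw [hx]
    ring
  · rw [symbol, wDeriv_neg]
    rw [natCast_mul_wCoeff_succ_permanent κ p q y rfl,
      wCoeff_mul_zero_one_one_one κ y (Int.natCast_nonneg p) (Int.natCast_nonneg q) rfl,
      wCoeff_mul_zero_zero_one_zero κ y (Int.natCast_nonneg p) (Int.natCast_nonneg q) rfl]
    simp only [mRoot, rowCoeff, SignType.zero_eq_zero, SignType.coe_zero]
    rw [add_zero]
    push_cast
    rw [hx]
    ring
  · rw [symbol, wDeriv_neg]
    rw [natCast_mul_wCoeff_succ_zero_zero_zero_one κ p q y rfl,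
      wCoeff_mul_zero_one_sq κ y (Int.natCast_nonneg p) (Int.natCast_nonneg q) rfl,
      wCoeff_mul_zero_zero_sq κ y (Int.natCast_nonneg p) (Int.natCast_nonneg q) rfl]
    simp only [mRoot, if_neg hs, rowCoeff, SignType.neg_eq_neg_one, SignType.coe_neg_one]
    rw [show (y : ℤ) + -1 + 1 = y by ring, show (y : ℤ) + -1 - 1 = y - 2 by ring,
      show (y : ℤ) + -1 = y - 1 by ring]
    push_cast
    rw [hx]
    ring

/-! ### The formula for the Wigner functions -/

/-- The integral parameters `p = j - m₂`, `q = j + m₂`, `x = j - m₁`, `y = j + m₁`, `l = j + n`. -/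
theorem exists_params {δ₁ δ₂ : Fin 2} {j n m₁ m₂ : ℝ} (hjn : (j, n) ∈ KTypes δ₁ δ₂)
    (hm₁ : m₁ ∈ weights j) (hm₂ : m₂ ∈ MSet j n δ₁ δ₂) :
    ∃ (p q x y : ℕ) (l : ℤ), j - m₂ = p ∧ j + m₂ = q ∧ j - m₁ = x ∧ j + m₁ = y ∧ j + n = l ∧
      q - l ≡ (δ₁ : ℕ) [ZMOD 2] ∧ p - l ≡ (δ₂ : ℕ) [ZMOD 2] := by
  have hw : ∀ a : ℕ, j = a / 2 → ∀ m ∈ weights j, ∃ x y : ℕ, j - m = x ∧ j + m = y := by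
    rintro a ha m ⟨y, hy, hm⟩
    have h : (y : ℝ) ≤ a := by linarith
    have h' : y ≤ a := by exact_mod_cast h
    refine ⟨a - y, y, ?_, by linarith⟩
    rw [Nat.cast_sub h']
    linarith
  obtain ⟨a, b, ha, hb, hab, -⟩ := hjn
  obtain ⟨hm₂, ⟨z₁, hz₁⟩, z₂, hz₂⟩ := hm₂
  obtain ⟨x, y, hx, hy⟩ := hw a ha m₁ hm₁
  obtain ⟨p, q, hp, hq⟩ := hw a ha m₂ hm₂
  obtain ⟨c, hc⟩ := hab.dvd
  have hl : j + n = (a + c : ℤ) := by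
    have : (b : ℝ) - a = 2 * c := by exact_mod_cast hc
    simp only at ha hb
    push_cast
    linarith
  refine ⟨p, q, x, y, a + c, hp, hq, hx, hy, hl, ?_, ?_⟩
  · have : (q - (a + c : ℤ) : ℤ) = -((δ₁ : ℕ) + 2 * z₁) := by
      have : (q - (a + c : ℤ) : ℝ) = -((δ₁ : ℕ) + 2 * z₁) := by rw [← hl, ← hq, ← hz₁]; ring
      exact_mod_cast this
    exact Int.modEq_iff_dvd.2 ⟨(δ₁ : ℕ) + z₁, by rw [this]; ring⟩
  · have : (p - (a + c : ℤ) : ℤ) = -((δ₂ : ℕ) + 2 * z₂) := by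
      have : (p - (a + c : ℤ) : ℝ) = -((δ₂ : ℕ) + 2 * z₂) := by rw [← hl, ← hp, ← hz₂]; ring
      exact_mod_cast this
    exact Int.modEq_iff_dvd.2 ⟨(δ₂ : ℕ) + z₂, by rw [this]; ring⟩

/-- The derivative on `K` of the extended Wigner function along a noncompact root vector. -/
theorem dl_u_wExt (lam₁ lam₂ : ℂ) {j n m₂ : ℝ} {l : ℤ} {p q x y : ℕ} (hp : j - m₂ = p)
    (hq : j + m₂ = q) (hl : j + n = l) (hsum : p + q = x + y) (r : ℂ) (s : ℤˣ) (β : PosRoot)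
    (k : K) :
    dl (u s β) (fun g => r * wExt lam₁ lam₂ l p q y (cMat g.1)) k = r * (Complex.I / 2 *
      ∑ j₀, ∑ ε, wTerm s lam₁ lam₂ j n m₂ l p q x y (cMat k.1.1) (mRoot s β) j₀ ε) := by
  obtain ⟨P, Q, hPQ, hP, hQ, h₁, h₂⟩ := exists_uMatrix_blocks s β
  have hu := cMat_K_unitary k
  rw [dl_wExt lam₁ lam₂ l p q y r (u s β) hPQ hP hQ k rfl, h₁, h₂]
  rcases Int.units_eq_one_or s with rfl | rfl
  · rw [if_pos rfl, if_pos rfl, mul_zero, zero_mul, neg_zero,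
      wDeriv_symbol_pos lam₁ lam₂ hp hq hl hsum hu]
  · rw [if_neg (by decide), if_neg (by decide), mul_zero, zero_mul, neg_zero,
      wDeriv_symbol_neg lam₁ lam₂ hp hq hl hsum hu]

end Sp4
end

theorem mainTheorem5 (δ₁ δ₂ : Fin 2) (lam₁ lam₂ : ℂ) (j n m₁ m₂ : ℝ)
    (hjn : (j, n) ∈ Sp4.KTypes δ₁ δ₂) (hm₁ : m₁ ∈ Sp4.weights j)
    (hm₂ : m₂ ∈ Sp4.MSet j n δ₁ δ₂) :
    Sp4.W j n m₁ m₂ ∈ Sp4.CδK δ₁ δ₂ ∧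
    (∃! f : Sp4.G → ℂ, f ∈ Sp4.principalSeries δ₁ δ₂ lam₁ lam₂ ∧
      ∀ k : Sp4.K, f k = Sp4.W j n m₁ m₂ k) ∧
    ∀ f ∈ Sp4.principalSeries δ₁ δ₂ lam₁ lam₂, (∀ k : Sp4.K, f k = Sp4.W j n m₁ m₂ k) →
      ∀ (s : ℤˣ) (β : Sp4.PosRoot),
        Sp4.dl (Sp4.u s β) f ∈ Sp4.principalSeries δ₁ δ₂ lam₁ lam₂ ∧
        ∀ k : Sp4.K, Sp4.dl (Sp4.u s β) f k =
          Complex.I / 2 * ∑ j₀ : SignType, ∑ ε : ℤˣ,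
            (Sp4.clebschGordan j m₁ j₀ (Sp4.mRoot s β) : ℂ) * (Sp4.coeffC j j₀ : ℂ) *
              (Sp4.coeffq j m₂ j₀ ε : ℂ) * Sp4.kappa s j n m₂ lam₁ lam₂ j₀ ε *
              Sp4.W (j + (j₀ : ℝ)) (n + ((s : ℤ) : ℝ)) (m₁ + (Sp4.mRoot s β : ℝ))
                (m₂ + ((ε : ℤ) : ℝ)) k := by
  obtain ⟨p, q, x, y, l, hp, hq, hx, hy, hl, h₁, h₂⟩ := Sp4.exists_params hjn hm₁ hm₂
  have hsum : p + q = x + y := by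
    have : (p + q : ℝ) = x + y := by rw [← hp, ← hq, ← hx, ← hy]; ring
    exact_mod_cast this
  set r : ℂ := (Sp4.cNorm j m₁ : ℂ) / Sp4.cNorm j m₂ with hr
  have hmem := Sp4.wExt_mem_principalSeries lam₁ lam₂ (y := y) h₁ h₂ r
  have hres : ∀ k : Sp4.K, r * Sp4.wExt lam₁ lam₂ l p q y (Sp4.cMat k.1.1) =
      Sp4.W j n m₁ m₂ k := fun k => by
    rw [Sp4.wExt_of_unitary _ _ _ _ _ _ (Sp4.cMat_K_unitary k), Sp4.wFun,
      Sp4.W_eq_wCoeff (p := p) (q := q) (x := x) (y := y) hp hq hx hy hl]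
  -- The extension is `r * wExt` on frames: it lies in `I(χ_{δ,λ})` and restricts to `W` on `K`.
  refine ⟨?_, ⟨_, ⟨hmem, hres⟩, fun f hf => Sp4.principalSeries_ext hf.1 hmem fun k => ?_⟩,
    fun f hf hfW s β => ⟨Sp4.dl_mem_principalSeries hf _, fun k => ?_⟩⟩
  · rw [← funext hres]
    exact Sp4.mem_CδK_of_mem_principalSeries hmem
  · rw [hf.2 k, hres k]
  · rw [Sp4.principalSeries_ext hf hmem fun k => (hfW k).trans (hres k).symm,
      Sp4.dl_u_wExt lam₁ lam₂ hp hq hl hsum, mul_left_comm]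
    refine congrArg _ ?_
    simp only [Finset.mul_sum]
    refine Finset.sum_congr rfl fun j₀ _ => Finset.sum_congr rfl fun ε _ => ?_
    have e := Sp4.coeff_mul_W hp hq hx hy hl k s j₀ (Sp4.mRoot s β) ε
    rw [Sp4.wTerm]
    linear_combination (-Sp4.kappa s j n m₂ lam₁ lam₂ j₀ ε) * e
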